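/- A \emph{Frobenius $3$-fold} is a complex analytic $3$-manifold $M$ with a holomorphic commutative associative multiplication on the tangent spaces $T_pM$, a holomorphic non-degenerate flat inner product with $\langle u\cdot v,w\rangle=\langle u,v\cdot w\rangle$, a unity field $e$ with $\nabla e=0$, and an Euler field $E$ with $\nabla(\nabla E)=0$ whose flow rescales the multiplication and the inner product and with $e\wedge E\not\equiv0$, such that $(\nabla_zc)(u,v,w)$, where $c(u,v,w)=\langle u\cdot v,w\rangle$, is symmetric in $u,v,w,z$ ($\nabla$ is the Levi-Civita connection). It is \emph{massive} if $T_pM$ is semi-simple for $p$ in a dense open set; then $T_pM$ has a basis of idempotents $e_1,e_2,e_3$ with $e_i\cdot e_j=\delta_{ij}e_i$ there. The planes spanned by $e$ and $e_i$ cut three directions on a surface $S$ transverse to $e$; the resulting (singular) $3$-web on $S$, with coinciding directions where $T_pM$ is not semi-simple, considered up to biholomorphism, is the \emph{booklet $3$-web} of $M$. Two germs $(M,g)$, $(\tilde M,\tilde g)$ of Frobenius $3$-folds are \emph{equivalent} if there is a germ of biholomorphism $\varphi:M\to\tilde M$, mapping base point to base point, with $\varphi^*\tilde g=c^2g$ for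 a constant $c\neq0$ and with $d\varphi$ an isomorphism of the tangent algebras. \textbf{Proposition.} Consider the $3$-web germs at $(0,0)\in\mathbb C^2$ formed by the solutions of one of the following implicit cubic equations, where $p=dy/dx$: \begin{itemize} \item[2)] $p^3+2xp+y=0$; \item[3)] $\left(p-\frac23x\right)\left(p^2+\frac23xp+y-\frac29x^2\right)=0$; \item[4)] $p^3+4x\left(y-\frac49x^3\right)p+y^2+\frac{64}{81}x^6-\frac{32}{9}yx^3=0$. \end{itemize} Each of these germs is the booklet $3$-web of some germ of a massive Frobenius $3$-fold with $\langle e,e\rangle=0$, and this Frobenius $3$-fold germ is unique up to equivalence. Moreover, the germ can be realized at $0\in\mathbb C^3$ with flat coordinates $(t,\bar x,\bar y)$ in which $e=\partial_t$, the inner product is $2\,dt\,d\bar x+d\bar y^2$, and the web cut on the surface $t=0$ is the given one after the coordinate change $\bar x=x$ and $\bar y=y$ in case 2), $\bar y=y-\frac1{12}x^2$ in case 3), $\bar y=y-\frac19x^3$ in case 4). -/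

import Mathlib

open Filter Topology

/-- Local coordinates on a complex 3-fold; the base point of a germ is `0`. -/
abbrev C3 : Type := Fin 3 → ℂ

/-- Local coordinates on a complex surface; the base point of a germ is `0`. -/
abbrev C2 : Type := Fin 2 → ℂ

/-- A field of bilinear products on the tangent spaces, in local coordinates. -/
abbrev ProductField : Type := C3 → C3 →L[ℂ] C3 →L[ℂ] C3

/-- A field of bilinear forms on the tangent spaces, in local coordinates. -/
abbrev FormField : Type := C3 → C3 →L[ℂ] C3 →L[ℂ] ℂ

noncomputable section

/-- `Γ` is the Levi-Civita connection `∇_u w = dw(u) + Γ(u, w)` of the metric `g` near `0`: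
it is torsion free and `∇ g = 0`. For a non-degenerate `g` these two conditions determine the germ
of `Γ`. -/
def IsLeviCivita (g : FormField) (Γ : ProductField) : Prop :=
  (∀ᶠ p in 𝓝 0, ∀ u v, Γ p u v = Γ p v u) ∧
  ∀ᶠ p in 𝓝 0, ∀ z u v, fderiv ℂ g p z u v = g p (Γ p z u) v + g p u (Γ p z v)

/-- The metric `g` is flat near `0`: its coefficients are constant in suitable holomorphic local
coordinates `ψ`. -/
def IsFlatMetric (g : FormField) : Prop :=
  ∃ (ψ : C3 → C3) (g₀ : C3 →L[ℂ] C3 →L[ℂ] ℂ), AnalyticAt ℂ ψ 0 ∧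
    Function.Injective (fderiv ℂ ψ 0) ∧
    ∀ᶠ p in 𝓝 0, ∀ u v, g p u v = g₀ (fderiv ℂ ψ p u) (fderiv ℂ ψ p v)

/-- The covariant derivative `∇ w` of a vector field, as an endomorphism `u ↦ ∇_u w`. -/
def covVec (Γ : ProductField) (w : C3 → C3) (p : C3) : C3 →L[ℂ] C3 :=
  fderiv ℂ w p + (Γ p).flip (w p)

/-- The covariant derivative `(∇_z T)(u)` of a field of endomorphisms. -/
def covEnd (Γ : ProductField) (T : C3 → C3 →L[ℂ] C3) (p z u : C3) : C3 :=
  fderiv ℂ T p z u + Γ p z (T p u) - T p (Γ p z u)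

/-- The 3-tensor `c(u, v, w) = ⟨u ∘ v, w⟩`. -/
def tensorC (g : FormField) (m : ProductField) (p u v w : C3) : ℂ :=
  g p (m p u v) w

/-- The 4-tensor `(∇_z c)(u, v, w)`. -/
def covC (g : FormField) (m Γ : ProductField) (p z u v w : C3) : ℂ :=
  fderiv ℂ (fun q => tensorC g m q u v w) p z
    - tensorC g m p (Γ p z u) v w - tensorC g m p u (Γ p z v) w - tensorC g m p u v (Γ p z w)

/-- The Lie derivative `(L_E g)(u, v)`. -/
def lieMetric (E : C3 → C3) (g : FormField) (p u v : C3) : ℂ :=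
  fderiv ℂ g p (E p) u v + g p (fderiv ℂ E p u) v + g p u (fderiv ℂ E p v)

/-- The Lie derivative `(L_E m)(u, v)` of a product. -/
def lieMul (E : C3 → C3) (m : ProductField) (p u v : C3) : C3 :=
  fderiv ℂ m p (E p) u v - fderiv ℂ E p (m p u v)
    + m p (fderiv ℂ E p u) v + m p u (fderiv ℂ E p v)

/-- A germ at `0` of a Frobenius 3-fold, in arbitrary holomorphic local coordinates. Only the germs
at `0` of the fields matter. -/
structure FrobeniusGerm where
  /-- multiplication on the tangent spaces -/
  mul : ProductField
  /-- inner product -/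
  metric : FormField
  /-- the Levi-Civita connection of the inner product -/
  conn : ProductField
  /-- unity vector field -/
  unit : C3 → C3
  /-- Euler vector field -/
  euler : C3 → C3
  analytic_mul : AnalyticAt ℂ mul 0
  analytic_metric : AnalyticAt ℂ metric 0
  analytic_conn : AnalyticAt ℂ conn 0
  analytic_unit : AnalyticAt ℂ unit 0
  analytic_euler : AnalyticAt ℂ euler 0
  mul_comm : ∀ᶠ p in 𝓝 0, ∀ u v, mul p u v = mul p v u
  mul_assoc : ∀ᶠ p in 𝓝 0, ∀ u v w, mul p (mul p u v) w = mul p u (mul p v w)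
  metric_symm : ∀ᶠ p in 𝓝 0, ∀ u v, metric p u v = metric p v u
  metric_nondegenerate : ∀ᶠ p in 𝓝 0, ∀ u, (∀ v, metric p u v = 0) → u = 0
  metric_invariant : ∀ᶠ p in 𝓝 0, ∀ u v w, metric p (mul p u v) w = metric p u (mul p v w)
  metric_flat : IsFlatMetric metric
  leviCivita : IsLeviCivita metric conn
  unit_mul : ∀ᶠ p in 𝓝 0, ∀ v, mul p (unit p) v = v
  unit_constant : ∀ᶠ p in 𝓝 0, covVec conn unit p = 0
  euler_linear : ∀ᶠ p in 𝓝 0, ∀ z u, covEnd conn (covVec conn euler) p z u = 0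
  /-- the flow of `E` rescales the multiplication -/
  euler_mul : ∃ k : ℂ, ∀ᶠ p in 𝓝 0, ∀ u v, lieMul euler mul p u v = k • mul p u v
  /-- the flow of `E` rescales the inner product -/
  euler_metric : ∃ d : ℂ, ∀ᶠ p in 𝓝 0, ∀ u v, lieMetric euler metric p u v = d * metric p u v
  /-- `e ∧ E` does not vanish identically -/
  euler_nontrivial : ∃ᶠ p in 𝓝 0, LinearIndependent ℂ ![unit p, euler p]
  /-- `(∇_z c)(u, v, w)` is symmetric in its four arguments (three generating transpositions) -/
  potential : ∀ᶠ p in 𝓝 0, ∀ z u v w,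
    covC metric mul conn p z u v w = covC metric mul conn p u z v w ∧
    covC metric mul conn p z u v w = covC metric mul conn p z v u w ∧
    covC metric mul conn p z u v w = covC metric mul conn p z u w v

namespace FrobeniusGerm

/-- `⟨e, e⟩ = 0`. -/
def NullUnit (F : FrobeniusGerm) : Prop :=
  ∀ᶠ p in 𝓝 0, F.metric p (F.unit p) (F.unit p) = 0

/-- `ε 0, ε 1, ε 2` is a basis of the tangent space at `p` with `ε i ∘ ε j = δ_ij ε i`. -/
def IsIdempotentBasis (F : FrobeniusGerm) (p : C3) (ε : Fin 3 → C3) : Prop :=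
  LinearIndependent ℂ ε ∧ ∀ i j, F.mul p (ε i) (ε j) = if i = j then ε i else 0

/-- The germ is massive: arbitrarily close to the base point there are points with semi-simple
tangent algebra (the set of such points is open). -/
def Massive (F : FrobeniusGerm) : Prop :=
  ∃ᶠ p in 𝓝 0, ∃ ε, F.IsIdempotentBasis p ε

/-- `σ` is a holomorphic parametrization of a surface germ through the base point, transverse to
the unity field `e`. -/
def IsTransverseSurface (F : FrobeniusGerm) (σ : C2 → C3) : Prop :=
  AnalyticAt ℂ σ 0 ∧ σ 0 = 0 ∧
  ∀ (a : ℂ) (v : C2), a • F.unit 0 + fderiv ℂ σ 0 v = 0 → a = 0 ∧ v = 0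

/-- The planes spanned by `e` and the idempotents cut on the surface parametrized by `σ` the web
whose directions `v` at the point with parameters `q` are the roots of the binary form `P q`. At
points where the tangent algebra is not semi-simple the directions, with multiplicities, are
determined by continuity. -/
def CutsWeb (F : FrobeniusGerm) (σ : C2 → C3) (P : C2 → C2 → ℂ) : Prop :=
  F.IsTransverseSurface σ ∧
  ∀ᶠ q in 𝓝 0, ∀ ε, F.IsIdempotentBasis (σ q) ε → ∀ v : C2, v ≠ 0 →
    (P q v = 0 ↔ ∃ i, fderiv ℂ σ q v ∈ Submodule.span ℂ {F.unit (σ q), ε i})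

/-- The web germ at `0 ∈ ℂ²` given by the binary form `P` is (up to biholomorphisms) the booklet
3-web of the massive Frobenius 3-fold germ `F`. -/
def IsBookletWeb (F : FrobeniusGerm) (P : C2 → C2 → ℂ) : Prop :=
  F.Massive ∧ ∃ σ, F.CutsWeb σ P

/-- Equivalence of germs of Frobenius 3-folds. -/
def Equivalent (F G : FrobeniusGerm) : Prop :=
  ∃ (φ : C3 → C3) (c : ℂ), AnalyticAt ℂ φ 0 ∧ φ 0 = 0 ∧ Function.Bijective (fderiv ℂ φ 0) ∧
    c ≠ 0 ∧
    (∀ᶠ p in 𝓝 0, ∀ u v,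
      G.metric (φ p) (fderiv ℂ φ p u) (fderiv ℂ φ p v) = c ^ 2 * F.metric p u v) ∧
    ∀ᶠ p in 𝓝 0, ∀ u v,
      fderiv ℂ φ p (F.mul p u v) = G.mul (φ p) (fderiv ℂ φ p u) (fderiv ℂ φ p v)

end FrobeniusGerm

/-- The three normal forms with an elliptic symmetry operator and triple root at the origin. -/
inductive EllipticForm
  | form2
  | form3
  | form4

namespace EllipticForm

/-- The implicit cubic equation of the normal form at `q = (x, y)`, with `p = dy / dx` and
multiplied by `dx ^ 3`, on the direction `v = (dx, dy)`. -/
def web : EllipticForm → C2 → C2 → ℂ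
  | form2, q, v => v 1 ^ 3 + 2 * q 0 * v 1 * v 0 ^ 2 + q 1 * v 0 ^ 3
  | form3, q, v => (v 1 - 2 / 3 * q 0 * v 0) *
      (v 1 ^ 2 + 2 / 3 * q 0 * v 1 * v 0 + (q 1 - 2 / 9 * q 0 ^ 2) * v 0 ^ 2)
  | form4, q, v => v 1 ^ 3 + 4 * q 0 * (q 1 - 4 / 9 * q 0 ^ 3) * v 1 * v 0 ^ 2
      + (q 1 ^ 2 + 64 / 81 * q 0 ^ 6 - 32 / 9 * q 1 * q 0 ^ 3) * v 0 ^ 3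

/-- The plane `t = 0` in the coordinates `(t, x̄, ȳ)`, parametrized by the coordinates `(x, y)` of
the normal form: `x̄ = x` and `ȳ = y`, `ȳ = y - x ^ 2 / 12`, `ȳ = y - x ^ 3 / 9` respectively. -/
def flatSurface : EllipticForm → C2 → C3
  | form2, q => ![0, q 0, q 1]
  | form3, q => ![0, q 0, q 1 - 1 / 12 * q 0 ^ 2]
  | form4, q => ![0, q 0, q 1 - 1 / 9 * q 0 ^ 3]

end EllipticForm

end

/-! A Frobenius 3-fold with null unity has flat coordinates `(t, x, y)` with metric `2 dt dx + dy ^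
2` and `e = ∂_t`. The product then depends only on three third derivatives `a = f_yyy`, `b = f_xyy`,
`c = f_xxy` of a potential `f(x, y)`, and associativity is the single equation `f_xxx = b ^ 2 - a
c`. The tangent algebra is generated by `Y = ∂_y` with `Y ^ 3 - a Y ^ 2 - 2 b Y - c = 0`, and the
slopes `dy / dx` of the booklet web are the roots of this same cubic. Existence is therefore a
computation: three weighted homogeneous polynomial potentials are exhibited and their cubics are the
normal forms after the stated shift of `y`.

Uniqueness compares an arbitrary germ with its normal form. The web determines the cubic only up to
a factor and a change of coordinates on the surface, but this suffices: after a shear preserving the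
flat structure, `a`, `b`, `c` vanish at the origin, the origin is the only point of the plane with a
triple root, and the linear parts of `b` and `c` remember which normal form is meant
(`exists_adapted_chart`).

The Euler field is affine in flat coordinates. Its flow preserves the triple-root locus, so it fixes
the isolated triple point; its planar part is then diagonal with weights `w₁`, `w₂`
(`IsHomogeneous.shift_eq_zero`). On each axis some one of `a`, `b`, `c` is a nonzero function of one
variable and hence has a positive integer degree; this leaves `w₂ / w₁` equal to `3 / 2`, `2` or `3`
(`IsHomogeneous.weights`). For each ratio the coefficients are weighted homogeneous polynomials, and
the compatibility and associativity equations leave one constant (`IsPotential.two_three`,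
`IsPotential.one_two`, `IsPotential.one_three`). The linear parts match the ratio with the normal
form, and the conformal dilation `(t, μ ^ 2 x, μ y)` normalizes the constant
(`IsAdapted.exists_dilation`). -/

noncomputable section

/-! ### The tangent algebra, its idempotents and the booklet cubic -/

/-- The bilinear map `u, v ↦ u i * v j * ∂_k`. -/
def unitTensor (i j k : Fin 3) : C3 →L[ℂ] C3 →L[ℂ] C3 :=
  (ContinuousLinearMap.proj i : C3 →L[ℂ] ℂ).smulRight
    ((ContinuousLinearMap.proj j : C3 →L[ℂ] ℂ).smulRight (Pi.single k 1 : C3))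

theorem unitTensor_apply (i j k : Fin 3) (u v : C3) :
    unitTensor i j k u v = Pi.single k (u i * v j) := by
  ext l
  simp [unitTensor, Pi.single_apply]

/-- The form `2 dt dx + dy ^ 2` on `ℂ³`. -/
def flatForm : C3 →L[ℂ] C3 →L[ℂ] ℂ :=
  (ContinuousLinearMap.proj 0 : C3 →L[ℂ] ℂ).smulRight (ContinuousLinearMap.proj 1 : C3 →L[ℂ] ℂ) +
  (ContinuousLinearMap.proj 1 : C3 →L[ℂ] ℂ).smulRight (ContinuousLinearMap.proj 0 : C3 →L[ℂ] ℂ) +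
  (ContinuousLinearMap.proj 2 : C3 →L[ℂ] ℂ).smulRight (ContinuousLinearMap.proj 2 : C3 →L[ℂ] ℂ)

@[simp] theorem flatForm_apply (u v : C3) :
    flatForm u v = u 0 * v 1 + u 1 * v 0 + u 2 * v 2 := by
  simp [flatForm]

/-- Part of the Frobenius product that does not depend on the potential. -/
def mulConst : C3 →L[ℂ] C3 →L[ℂ] C3 :=
  unitTensor 0 0 0 + unitTensor 0 1 1 + unitTensor 1 0 1 + unitTensor 2 2 1 +
    unitTensor 0 2 2 + unitTensor 2 0 2

/-- Coefficient of `f_yyy` in the Frobenius product. -/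
def mulYYY : C3 →L[ℂ] C3 →L[ℂ] C3 := unitTensor 2 2 2

/-- Coefficient of `f_xyy` in the Frobenius product. -/
def mulXYY : C3 →L[ℂ] C3 →L[ℂ] C3 := unitTensor 2 2 0 + unitTensor 1 2 2 + unitTensor 2 1 2

/-- Coefficient of `f_xxy` in the Frobenius product. -/
def mulXXY : C3 →L[ℂ] C3 →L[ℂ] C3 := unitTensor 1 2 0 + unitTensor 2 1 0 + unitTensor 1 1 2

/-- Coefficient of `f_xxx` in the Frobenius product. -/
def mulXXX : C3 →L[ℂ] C3 →L[ℂ] C3 := unitTensor 1 1 0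

theorem mulConst_apply (u v : C3) : mulConst u v =
    ![u 0 * v 0, u 0 * v 1 + u 1 * v 0 + u 2 * v 2, u 0 * v 2 + u 2 * v 0] := by
  ext l; fin_cases l <;> simp [mulConst, unitTensor_apply]

theorem mulYYY_apply (u v : C3) : mulYYY u v = ![0, 0, u 2 * v 2] := by
  ext l; fin_cases l <;> simp [mulYYY, unitTensor_apply]

theorem mulXYY_apply (u v : C3) :
    mulXYY u v = ![u 2 * v 2, 0, u 1 * v 2 + u 2 * v 1] := by
  ext l; fin_cases l <;> simp [mulXYY, unitTensor_apply]

theorem mulXXY_apply (u v : C3) :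
    mulXXY u v = ![u 1 * v 2 + u 2 * v 1, 0, u 1 * v 1] := by
  ext l; fin_cases l <;> simp [mulXXY, unitTensor_apply]

theorem mulXXX_apply (u v : C3) : mulXXX u v = ![u 1 * v 1, 0, 0] := by
  ext l; fin_cases l <;> simp [mulXXX, unitTensor_apply]

/-- The Frobenius product on `ℂ³` with unit `∂_t`, invariant form `2 dt dx + dy ^ 2` and third
derivatives `f_yyy = a`, `f_xyy = b`, `f_xxy = c`, `f_xxx = b ^ 2 - a c` of the potential. -/
def frobMul (a b c : ℂ) : C3 →L[ℂ] C3 →L[ℂ] C3 :=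
  mulConst + a • mulYYY + b • mulXYY + c • mulXXY + (b ^ 2 - a * c) • mulXXX

theorem frobMul_apply (a b c : ℂ) (u v : C3) : frobMul a b c u v =
    ![u 0 * v 0 + b * (u 2 * v 2) + c * (u 1 * v 2 + u 2 * v 1) + (b ^ 2 - a * c) * (u 1 * v 1),
      u 0 * v 1 + u 1 * v 0 + u 2 * v 2,
      u 0 * v 2 + u 2 * v 0 + a * (u 2 * v 2) + b * (u 1 * v 2 + u 2 * v 1) + c * (u 1 * v 1)] := by
  ext l
  fin_cases l <;>
    simp [frobMul, mulConst_apply, mulYYY_apply, mulXYY_apply, mulXXY_apply, mulXXX_apply]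

theorem frobMul_comm (a b c : ℂ) (u v : C3) : frobMul a b c u v = frobMul a b c v u := by
  ext l; fin_cases l <;> simp [frobMul_apply] <;> ring

/-- The algebra is `ℂ[Y] / (Y ^ 3 - a Y ^ 2 - 2 b Y - c)` with `Y = ∂_y` and `∂_x = Y ^ 2 - a Y -
b`; the value `b ^ 2 - a c` is the `∂_t`-component of `∂_x ∘ ∂_x` in it. -/
theorem frobMul_assoc (a b c : ℂ) (u v w : C3) :
    frobMul a b c (frobMul a b c u v) w = frobMul a b c u (frobMul a b c v w) := by
  ext l; fin_cases l <;> simp [frobMul_apply] <;> ring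

theorem frobMul_invariant (a b c : ℂ) (u v w : C3) :
    flatForm (frobMul a b c u v) w = flatForm u (frobMul a b c v w) := by
  simp [frobMul_apply]; ring

theorem frobMul_unit (a b c : ℂ) (v : C3) : frobMul a b c ![1, 0, 0] v = v := by
  ext l; fin_cases l <;> simp [frobMul_apply]

theorem flatForm_nondegenerate (u : C3) (h : ∀ v, flatForm u v = 0) : u = 0 := by
  have h0 := h ![1, 0, 0]
  have h1 := h ![0, 1, 0]
  have h2 := h ![0, 0, 1]
  simp at h0 h1 h2
  ext l; fin_cases l <;> simp [h0, h1, h2]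

/-- The binary cubic form of the booklet web of `frobMul a b c`. -/
def bookletCubic (a b c : ℂ) (V : C3) : ℂ :=
  V 2 ^ 3 - a * V 2 ^ 2 * V 1 - 2 * b * V 2 * V 1 ^ 2 - c * V 1 ^ 3

/-- `λ i` are the roots of `p ^ 3 - a p ^ 2 - 2 b p - c`. -/
def IsRootTriple (a b c : ℂ) (l : Fin 3 → ℂ) : Prop :=
  a = l 0 + l 1 + l 2 ∧ -2 * b = l 0 * l 1 + l 0 * l 2 + l 1 * l 2 ∧ c = l 0 * l 1 * l 2

theorem exists_isRootTriple (a b c : ℂ) : ∃ l, IsRootTriple a b c l := by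
  obtain ⟨z, hz⟩ : ∃ z : ℂ, z ^ 3 - a * z ^ 2 - 2 * b * z - c = 0 := by
    have hd : (Cubic.mk 1 (-a) (-2 * b) (-c)).toPoly.degree ≠ 0 := by
      rw [Cubic.degree_of_a_ne_zero (by simp)]; norm_num
    obtain ⟨z, hz⟩ := IsAlgClosed.exists_root _ hd
    refine ⟨z, ?_⟩
    simp [Cubic.toPoly, Polynomial.IsRoot] at hz
    linear_combination hz
  -- The other two roots have sum `a - z` and product `-2 b - z (a - z)`; `s` is a square root of
  -- the discriminant of their quadratic.
  obtain ⟨s, hs⟩ := IsAlgClosed.exists_eq_mul_self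
    ((a - z) ^ 2 - 4 * (-2 * b - z * (a - z)))
  refine ⟨![z, ((a - z) + s) / 2, ((a - z) - s) / 2], ?_, ?_, ?_⟩
  · simp; ring
  · simp; linear_combination (-1 / 4) * hs
  · simp; linear_combination (- 1 / 4 * z) * hs - hz

/-- The discriminant of `p ^ 3 - a p ^ 2 - 2 b p - c`. -/
def bookletDiscr (a b c : ℂ) : ℂ :=
  4 * a ^ 2 * b ^ 2 + 32 * b ^ 3 - 4 * a ^ 3 * c - 36 * a * b * c - 27 * c ^ 2

theorem IsRootTriple.discr_eq {a b c : ℂ} {l : Fin 3 → ℂ} (h : IsRootTriple a b c l) :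
    bookletDiscr a b c = ((l 0 - l 1) * (l 0 - l 2) * (l 1 - l 2)) ^ 2 := by
  obtain ⟨h1, h2, h3⟩ := h
  have hb : b = -(l 0 * l 1 + l 0 * l 2 + l 1 * l 2) / 2 := by linear_combination (-1/2) * h2
  rw [bookletDiscr, hb, h1, h3]; ring

theorem IsRootTriple.cubic_eq {a b c : ℂ} {l : Fin 3 → ℂ} (h : IsRootTriple a b c l) (V : C3) :
    bookletCubic a b c V = (V 2 - l 0 * V 1) * (V 2 - l 1 * V 1) * (V 2 - l 2 * V 1) := by
  obtain ⟨h1, h2, h3⟩ := h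
  rw [bookletCubic]
  linear_combination (-V 2 ^ 2 * V 1) * h1 + V 2 * V 1 ^ 2 * h2 - V 1 ^ 3 * h3

/-- A basis of idempotents of an algebra structure on `ℂ³`. -/
def IsIdempotents (m : C3 →L[ℂ] C3 →L[ℂ] C3) (ε : Fin 3 → C3) : Prop :=
  LinearIndependent ℂ ε ∧ ∀ i j, m (ε i) (ε j) = if i = j then ε i else 0

/-- The idempotent of `frobMul a b c` for the root `x` of the cubic with other roots `y`, `z`. -/
def rootIdempotent (b x y z : ℂ) : C3 :=
  ((x - y) * (x - z))⁻¹ • ![b + y * z, 1, x]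

/-- The idempotents are the Lagrange interpolation polynomials `(Y - y) (Y - z) / ((x - y) (x - z))`
at the roots, rewritten in the basis `∂_t`, `∂_x`, `∂_y` by means of `Y ^ 2 = b ∂_t + ∂_x + a Y`. -/
theorem IsRootTriple.exists_isIdempotents {a b c : ℂ} {l : Fin 3 → ℂ} (h : IsRootTriple a b c l)
    (hd : bookletDiscr a b c ≠ 0) : ∃ ε, IsIdempotents (frobMul a b c) ε := by
  rw [h.discr_eq] at hd
  have h01 : l 0 - l 1 ≠ 0 := by rintro e; simp [e] at hd
  have h02 : l 0 - l 2 ≠ 0 := by rintro e; simp [e] at hd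
  have h12 : l 1 - l 2 ≠ 0 := by rintro e; simp [e] at hd
  have h10 : l 1 - l 0 ≠ 0 := by rwa [← neg_sub, neg_ne_zero]
  have h20 : l 2 - l 0 ≠ 0 := by rwa [← neg_sub, neg_ne_zero]
  have h21 : l 2 - l 1 ≠ 0 := by rwa [← neg_sub, neg_ne_zero]
  obtain ⟨ha, hb, hc⟩ := h
  have hb : b = -(l 0 * l 1 + l 0 * l 2 + l 1 * l 2) / 2 := by linear_combination (-1/2) * hb
  have key : ∀ x y z : ℂ, x - y ≠ 0 → x - z ≠ 0 → a = x + y + z →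
      b = -(x * y + x * z + y * z) / 2 → c = x * y * z →
      frobMul a b c (rootIdempotent b x y z) (rootIdempotent b x y z) = rootIdempotent b x y z := by
    intro x y z hxy hxz ha hb hc
    subst ha hb hc
    ext i; fin_cases i <;> simp [frobMul_apply, rootIdempotent] <;> field_simp <;> ring
  have key2 : ∀ x y z y' z' : ℂ, a = x + y + z →
      b = -(x * y + x * z + y * z) / 2 → c = x * y * z → y' = x → z' = z →
      frobMul a b c (rootIdempotent b x y z) (rootIdempotent b y y' z') = 0 := by
    intro x y z y' z' ha hb hc e1 e2
    subst e1 e2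
    simp only [rootIdempotent, map_smul, _root_.smul_apply]
    have : frobMul a b c ![b + y * z', 1, y'] ![b + y' * z', 1, y] = 0 := by
      subst ha hb hc
      ext i; fin_cases i <;> simp [frobMul_apply] <;> ring
    rw [this]; simp
  have key3 : ∀ x y z : ℂ, rootIdempotent b x y z = rootIdempotent b x z y := by
    intro x y z; simp [rootIdempotent, mul_comm]
  have c01 := key2 (l 0) (l 1) (l 2) _ _ ha hb hc rfl rfl
  have c02 := key2 (l 0) (l 2) (l 1) _ _ (by rw [ha]; ring) (by rw [hb]; ring) (by rw [hc]; ring)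
    rfl rfl
  have c12 := key2 (l 1) (l 2) (l 0) _ _ (by rw [ha]; ring) (by rw [hb]; ring) (by rw [hc]; ring)
    rfl rfl
  have d0 := key (l 0) (l 1) (l 2) h01 h02 ha hb hc
  have d1 := key (l 1) (l 0) (l 2) h10 h12 (by rw [ha]; ring) (by rw [hb]; ring) (by rw [hc]; ring)
  have d2 := key (l 2) (l 0) (l 1) h20 h21 (by rw [ha]; ring) (by rw [hb]; ring) (by rw [hc]; ring)
  rw [key3 (l 0) (l 2) (l 1)] at c02
  rw [key3 (l 1) (l 2) (l 0), key3 (l 2) (l 1) (l 0)] at c12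
  refine ⟨![rootIdempotent b (l 0) (l 1) (l 2), rootIdempotent b (l 1) (l 0) (l 2),
    rootIdempotent b (l 2) (l 0) (l 1)], ?_, ?_⟩
  · rw [Fintype.linearIndependent_iff]
    intro g hg
    simp only [Fin.sum_univ_three] at hg
    simp only [Matrix.cons_val] at hg
    have n0 : rootIdempotent b (l 0) (l 1) (l 2) ≠ 0 := fun e => by
      have := congrFun e 1; simp [rootIdempotent, h01, h02] at this
    have n1 : rootIdempotent b (l 1) (l 0) (l 2) ≠ 0 := fun e => by
      have := congrFun e 1; simp [rootIdempotent, h10, h12] at this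
    have n2 : rootIdempotent b (l 2) (l 0) (l 1) ≠ 0 := fun e => by
      have := congrFun e 1; simp [rootIdempotent, h20, h21] at this
    have m0 := congrArg (frobMul a b c (rootIdempotent b (l 0) (l 1) (l 2))) hg
    have m1 := congrArg (frobMul a b c (rootIdempotent b (l 1) (l 0) (l 2))) hg
    have m2 := congrArg (frobMul a b c (rootIdempotent b (l 2) (l 0) (l 1))) hg
    rw [map_add, map_add, map_smul, map_smul, map_smul, map_zero] at m0 m1 m2
    rw [d0, c01, c02] at m0
    rw [frobMul_comm, c01, d1, c12] at m1
    rw [frobMul_comm, c02, frobMul_comm, c12, d2] at m2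
    simp [n0] at m0
    simp [n1] at m1
    simp [n2] at m2
    intro i; fin_cases i <;> assumption
  · intro i j
    fin_cases i <;> fin_cases j <;> simp
    · exact d0
    · exact c01
    · exact c02
    · rw [frobMul_comm]; exact c01
    · exact d1
    · exact c12
    · rw [frobMul_comm]; exact c02
    · rw [frobMul_comm]; exact c12
    · exact d2

/-- For a basis of idempotents, the coordinate functions are the characters of the algebra,
given by the three distinct roots of the cubic. -/
theorem IsIdempotents.exists_roots {a b c : ℂ} {ε : Fin 3 → C3}
    (h : IsIdempotents (frobMul a b c) ε) : ∃ l : Fin 3 → ℂ, IsRootTriple a b c l ∧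
      Function.Injective l ∧ ε 0 + ε 1 + ε 2 = ![1, 0, 0] ∧
      ∀ V : C3, V = ∑ i, (V 0 + V 1 * (l i ^ 2 - b - a * l i) + V 2 * l i) • ε i := by
  obtain ⟨hli, hm⟩ := h
  have hspan : ∀ V : C3, ∃ x : Fin 3 → ℂ, V = ∑ i, x i • ε i := by
    intro V
    let B := basisOfLinearIndependentOfCardEqFinrank hli (by simp)
    refine ⟨fun i => B.repr V i, ?_⟩
    conv_lhs => rw [← B.sum_repr V]
    simp [B]
  have hne : ∀ i, ε i ≠ 0 := hli.ne_zero
  have hmul : ∀ (x : Fin 3 → ℂ) j, frobMul a b c (∑ i, x i • ε i) (ε j) = x j • ε j := by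
    intro x j
    rw [map_sum, _root_.sum_apply]
    simp [hm]
  -- The eigenvalues of multiplication by `∂_y` on the idempotents are the candidates for the roots.
  obtain ⟨l, hl⟩ := hspan ![0, 0, 1]
  have hy : ∀ j, frobMul a b c ![0, 0, 1] (ε j) = l j • ε j := fun j => by rw [hl, hmul]
  have hx : ∀ j, frobMul a b c ![0, 1, 0] (ε j) = (l j ^ 2 - b - a * l j) • ε j := by
    intro j
    have e : (![0, 1, 0] : C3) = frobMul a b c ![0, 0, 1] ![0, 0, 1] - b • ![1, 0, 0]
        - a • ![0, 0, 1] := by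
      ext i; fin_cases i <;> simp [frobMul_apply]
    rw [e]
    simp only [map_sub, map_smul, _root_.sub_apply, _root_.smul_apply,
      frobMul_unit, frobMul_assoc, hy, sub_smul, smul_smul, pow_two]
  have hV : ∀ V : C3, V = ∑ i, (V 0 + V 1 * (l i ^ 2 - b - a * l i) + V 2 * l i) • ε i := by
    intro V
    obtain ⟨x, hx'⟩ := hspan V
    have : ∀ j, x j = V 0 + V 1 * (l j ^ 2 - b - a * l j) + V 2 * l j := by
      intro j
      have e1 := hmul x j
      rw [← hx'] at e1
      have e : V = V 0 • ![1, 0, 0] + V 1 • ![0, 1, 0] + V 2 • ![0, 0, 1] := by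
        ext i; fin_cases i <;> simp
      rw [e] at e1
      simp only [map_add, map_smul, _root_.add_apply, _root_.smul_apply,
        frobMul_unit, hx, hy, smul_smul, ← add_smul] at e1
      exact (smul_left_injective ℂ (hne j) e1).symm
    rw [hx']
    conv_lhs => simp only [this]
    rw [← hx']
  have huniq : ∀ x y : Fin 3 → ℂ, ∑ i, x i • ε i = ∑ i, y i • ε i → x = y := by
    intro x y hxy
    have := Fintype.linearIndependent_iff.1 hli (fun i => x i - y i)
      (by simp [sub_smul, Finset.sum_sub_distrib, hxy])
    funext i; exact sub_eq_zero.1 (this i)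
  have hchar : ∀ j i, ε j 0 + ε j 1 * (l i ^ 2 - b - a * l i) + ε j 2 * l i =
      if i = j then 1 else 0 := by
    intro j i
    have h1 := hV (ε j)
    have h2 : ε j = ∑ i, (if i = j then (1 : ℂ) else 0) • ε i := by simp
    exact congrFun (huniq _ _ (h1.symm.trans h2)) i
  have hinj : Function.Injective l := by
    intro i j hij
    by_contra hne
    have h1 := hchar j i
    have h2 := hchar j j
    rw [hij, h2] at h1
    simp [hne] at h1
  have hroot : ∀ j, l j ^ 3 - a * l j ^ 2 - 2 * b * l j - c = 0 := by
    intro j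
    -- Acting on `ε j`, this relation becomes the cubic equation for `l j`.
    have e : frobMul a b c ![0, 0, 1] ![0, 1, 0] = c • ![1, 0, 0] + b • ![0, 0, 1] := by
      ext i; fin_cases i <;> simp [frobMul_apply]
    have e1 := congrArg (fun w => frobMul a b c w (ε j)) e
    simp only [frobMul_assoc, map_add, map_smul, _root_.add_apply,
      _root_.smul_apply, frobMul_unit, hx, hy, smul_smul, ← add_smul] at e1
    have := smul_left_injective ℂ (hne j) e1
    linear_combination this
  refine ⟨l, ?_, hinj, ?_, hV⟩
  · have h01 : l 0 - l 1 ≠ 0 := sub_ne_zero.2 fun e => by simpa using hinj e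
    have h02 : l 0 - l 2 ≠ 0 := sub_ne_zero.2 fun e => by simpa using hinj e
    have h12 : l 1 - l 2 ≠ 0 := sub_ne_zero.2 fun e => by simpa using hinj e
    -- Vieta's formulas by divided differences: the cubic at distinct roots is subtracted and
    -- divided by their difference, twice.
    have r01 : l 0 ^ 2 + l 0 * l 1 + l 1 ^ 2 - a * (l 0 + l 1) - 2 * b = 0 := by
      apply mul_left_cancel₀ h01; linear_combination hroot 0 - hroot 1
    have r02 : l 0 ^ 2 + l 0 * l 2 + l 2 ^ 2 - a * (l 0 + l 2) - 2 * b = 0 := by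
      apply mul_left_cancel₀ h02; linear_combination hroot 0 - hroot 2
    have ra : l 0 + l 1 + l 2 - a = 0 := by
      apply mul_left_cancel₀ h12; linear_combination r01 - r02
    refine ⟨by linear_combination -ra, ?_, ?_⟩
    · linear_combination r01 - (l 0 + l 1) * ra
    · linear_combination -hroot 0 + l 0 * r01 - l 0 * l 1 * ra
  · have := hV ![1, 0, 0]
    simpa [Fin.sum_univ_three] using this.symm

theorem IsIdempotents.discr_ne_zero {a b c : ℂ} {ε : Fin 3 → C3}
    (h : IsIdempotents (frobMul a b c) ε) : bookletDiscr a b c ≠ 0 := by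
  obtain ⟨l, hl, hinj, -, -⟩ := h.exists_roots
  have h01 : l 0 - l 1 ≠ 0 := sub_ne_zero.2 fun e => by simpa using hinj e
  have h02 : l 0 - l 2 ≠ 0 := sub_ne_zero.2 fun e => by simpa using hinj e
  have h12 : l 1 - l 2 ≠ 0 := sub_ne_zero.2 fun e => by simpa using hinj e
  rw [hl.discr_eq]
  positivity

/-- The planes through the unity and the idempotents are the zeros of the booklet cubic. -/
theorem IsIdempotents.cubic_eq_zero_iff {a b c : ℂ} {ε : Fin 3 → C3}
    (h : IsIdempotents (frobMul a b c) ε) (V : C3) :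
    bookletCubic a b c V = 0 ↔ ∃ i, V ∈ Submodule.span ℂ {![1, 0, 0], ε i} := by
  obtain ⟨l, hl, hinj, hsum, hV⟩ := h.exists_roots
  have h01 : l 0 - l 1 ≠ 0 := sub_ne_zero.2 fun e => by simpa using hinj e
  have h02 : l 0 - l 2 ≠ 0 := sub_ne_zero.2 fun e => by simpa using hinj e
  have h12 : l 1 - l 2 ≠ 0 := sub_ne_zero.2 fun e => by simpa using hinj e
  obtain ⟨x, hx⟩ : ∃ x : Fin 3 → ℂ, x = fun i => V 0 + V 1 * (l i ^ 2 - b - a * l i) + V 2 * l i :=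
    ⟨_, rfl⟩
  have hVx : V = x 0 • ε 0 + x 1 • ε 1 + x 2 • ε 2 := by
    conv_lhs => rw [hV V]
    simp [Fin.sum_univ_three, hx]
  have ha := hl.1
  -- As `e` is the sum of the idempotents, `V` lies in the plane of `e` and `ε k` exactly when its
  -- other two coordinates agree; their difference is a nonzero multiple of `V 2 - l k * V 1`.
  have e01 : x 0 - x 1 = (l 0 - l 1) * (V 2 - l 2 * V 1) := by
    simp only [hx]; linear_combination (-(l 0 - l 1) * V 1) * ha
  have e02 : x 0 - x 2 = (l 0 - l 2) * (V 2 - l 1 * V 1) := by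
    simp only [hx]; linear_combination (-(l 0 - l 2) * V 1) * ha
  have e12 : x 1 - x 2 = (l 1 - l 2) * (V 2 - l 0 * V 1) := by
    simp only [hx]; linear_combination (-(l 1 - l 2) * V 1) * ha
  have huniq : ∀ y : Fin 3 → ℂ, V = y 0 • ε 0 + y 1 • ε 1 + y 2 • ε 2 → y = x := by
    intro y hy
    have := Fintype.linearIndependent_iff.1 h.1 (fun i => y i - x i) (by
      simp only [Fin.sum_univ_three, sub_smul]
      have := hy.symm.trans hVx
      linear_combination (exp := 1) this)
    funext i; exact sub_eq_zero.1 (this i)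
  rw [hl.cubic_eq, mul_eq_zero, mul_eq_zero]
  have hmem : ∀ i, V ∈ Submodule.span ℂ {![1, 0, 0], ε i} ↔
      ∃ s t : ℂ, V = s • (ε 0 + ε 1 + ε 2) + t • ε i := by
    intro i
    rw [Submodule.mem_span_pair, hsum]
    constructor <;> rintro ⟨s, t, h⟩ <;> exact ⟨s, t, h.symm⟩
  simp only [hmem]
  constructor
  · rintro ((h | h) | h)
    · refine ⟨0, x 1, x 0 - x 1, ?_⟩
      have : x 2 = x 1 := by rw [h, mul_zero] at e12; linear_combination -e12
      conv_lhs => rw [hVx, this]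
      module
    · refine ⟨1, x 0, x 1 - x 0, ?_⟩
      have : x 2 = x 0 := by rw [h, mul_zero] at e02; linear_combination -e02
      conv_lhs => rw [hVx, this]
      module
    · refine ⟨2, x 0, x 2 - x 0, ?_⟩
      have : x 1 = x 0 := by rw [h, mul_zero] at e01; linear_combination -e01
      conv_lhs => rw [hVx, this]
      module
  · rintro ⟨i, s, t, hst⟩
    fin_cases i
    · left; left
      have := huniq ![s + t, s, s] (by rw [hst]; simp; module)
      apply mul_left_cancel₀ h12
      rw [← e12, ← this]; simp
    · left; right
      have := huniq ![s, s + t, s] (by rw [hst]; simp; module)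
      apply mul_left_cancel₀ h02
      rw [← e02, ← this]; simp
    · right
      have := huniq ![s, s, s + t] (by rw [hst]; simp; module)
      apply mul_left_cancel₀ h01
      rw [← e01, ← this]; simp

end

/-! ### Frobenius germs of homogeneous potentials -/

noncomputable section

/-- The partial derivative of a function on `ℂ³`. -/
def pd (i : Fin 3) (f : C3 → ℂ) (p : C3) : ℂ := fderiv ℂ f p (Pi.single i 1)

theorem fderiv_eq_pd (f : C3 → ℂ) (p u : C3) :
    fderiv ℂ f p u = u 0 * pd 0 f p + u 1 * pd 1 f p + u 2 * pd 2 f p := by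
  have : u = u 0 • Pi.single 0 1 + u 1 • Pi.single 1 1 + u 2 • Pi.single 2 1 := by
    ext l; fin_cases l <;> simp
  conv_lhs => rw [this]
  simp [pd]

/-- The derivative of the Frobenius product in terms of those of the coefficients. -/
def frobMulDeriv (a b c a' b' c' : ℂ) : C3 →L[ℂ] C3 →L[ℂ] C3 :=
  a' • mulYYY + b' • mulXYY + c' • mulXXY + (2 * b * b' - a' * c - a * c') • mulXXX

theorem frobMulDeriv_apply (a b c a' b' c' : ℂ) (u v : C3) : frobMulDeriv a b c a' b' c' u v =
    ![b' * (u 2 * v 2) + c' * (u 1 * v 2 + u 2 * v 1) +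
        (2 * b * b' - a' * c - a * c') * (u 1 * v 1),
      0,
      a' * (u 2 * v 2) + b' * (u 1 * v 2 + u 2 * v 1) + c' * (u 1 * v 1)] := by
  ext l
  fin_cases l <;>
    simp [frobMulDeriv, mulYYY_apply, mulXYY_apply, mulXXY_apply, mulXXX_apply]

theorem fderiv_quadratic_combination {F : Type*} [NormedAddCommGroup F] [NormedSpace ℂ F]
    (m₀ m₁ m₂ m₃ m₄ : F) {a b c : C3 → ℂ} {p : C3} (ha : DifferentiableAt ℂ a p)
    (hb : DifferentiableAt ℂ b p) (hc : DifferentiableAt ℂ c p) (z : C3) :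
    fderiv ℂ (fun q => m₀ + a q • m₁ + b q • m₂ + c q • m₃ + (b q ^ 2 - a q * c q) • m₄) p z =
      fderiv ℂ a p z • m₁ + fderiv ℂ b p z • m₂ + fderiv ℂ c p z • m₃ +
        (2 * b p * fderiv ℂ b p z - fderiv ℂ a p z * c p - a p * fderiv ℂ c p z) • m₄ := by
  have h := ((((hasFDerivAt_const m₀ p).add (ha.hasFDerivAt.smul_const m₁)).add
    (hb.hasFDerivAt.smul_const m₂)).add (hc.hasFDerivAt.smul_const m₃)).add
    (((hb.hasFDerivAt.pow 2).sub (ha.hasFDerivAt.mul hc.hasFDerivAt)).smul_const m₄)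
  have h' : HasFDerivAt (fun q => m₀ + a q • m₁ + b q • m₂ + c q • m₃ +
    (b q ^ 2 - a q * c q) • m₄) _ p := h
  rw [h'.fderiv]
  simp
  module

theorem analyticAt_quadratic_combination {F : Type*} [NormedAddCommGroup F] [NormedSpace ℂ F]
    (m₀ m₁ m₂ m₃ m₄ : F) {a b c : C3 → ℂ} {p : C3} (ha : AnalyticAt ℂ a p)
    (hb : AnalyticAt ℂ b p) (hc : AnalyticAt ℂ c p) :
    AnalyticAt ℂ
      (fun q => m₀ + a q • m₁ + b q • m₂ + c q • m₃ + (b q ^ 2 - a q * c q) • m₄) p :=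
  (((analyticAt_const.add (ha.smul analyticAt_const)).add (hb.smul analyticAt_const)).add
    (hc.smul analyticAt_const)).add (((hb.pow 2).sub (ha.mul hc)).smul analyticAt_const)

theorem fderiv_frobMul {a b c : C3 → ℂ} {p : C3} (ha : DifferentiableAt ℂ a p)
    (hb : DifferentiableAt ℂ b p) (hc : DifferentiableAt ℂ c p) (z : C3) :
    fderiv ℂ (fun q => frobMul (a q) (b q) (c q)) p z =
      frobMulDeriv (a p) (b p) (c p) (fderiv ℂ a p z) (fderiv ℂ b p z) (fderiv ℂ c p z) := by
  have := fderiv_quadratic_combination mulConst mulYYY mulXYY mulXXY mulXXX ha hb hc z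
  simp only [frobMul, frobMulDeriv]
  exact this

theorem analyticAt_frobMul {a b c : C3 → ℂ} {p : C3} (ha : AnalyticAt ℂ a p)
    (hb : AnalyticAt ℂ b p) (hc : AnalyticAt ℂ c p) :
    AnalyticAt ℂ (fun q => frobMul (a q) (b q) (c q)) p :=
  analyticAt_quadratic_combination _ _ _ _ _ ha hb hc

theorem fderiv_tensor {g : FormField} {m : ProductField} {p : C3}
    (hg : DifferentiableAt ℂ g p) (hm : DifferentiableAt ℂ m p) (u v w z : C3) :
    fderiv ℂ (fun q => tensorC g m q u v w) p z =
      fderiv ℂ g p z (m p u v) w + g p (fderiv ℂ m p z u v) w := by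
  have h1 : HasFDerivAt (fun q => m q u v) _ p :=
    (hm.hasFDerivAt.clm_apply (hasFDerivAt_const u p)).clm_apply (hasFDerivAt_const v p)
  have h : HasFDerivAt (fun q => g q (m q u v) w) _ p :=
    (hg.hasFDerivAt.clm_apply h1).clm_apply (hasFDerivAt_const w p)
  unfold tensorC
  rw [h.fderiv]
  simp [add_comm]

/-- `a`, `b`, `c` are the third derivatives `f_yyy`, `f_xyy`, `f_xxy` of a solution `f(x, y)`
near the origin of the associativity equation `f_xxx = f_xyy ^ 2 - f_yyy f_xxy`. -/
structure IsPotential (a b c : C3 → ℂ) : Prop where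
  analytic_a : AnalyticAt ℂ a 0
  analytic_b : AnalyticAt ℂ b 0
  analytic_c : AnalyticAt ℂ c 0
  a_t : ∀ᶠ p in 𝓝 0, pd 0 a p = 0
  b_t : ∀ᶠ p in 𝓝 0, pd 0 b p = 0
  c_t : ∀ᶠ p in 𝓝 0, pd 0 c p = 0
  a_x : ∀ᶠ p in 𝓝 0, pd 1 a p = pd 2 b p
  b_x : ∀ᶠ p in 𝓝 0, pd 1 b p = pd 2 c p
  c_x : ∀ᶠ p in 𝓝 0, pd 1 c p = 2 * b p * pd 2 b p - pd 2 a p * c p - a p * pd 2 c p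

/-- `f` is homogeneous near the origin of degree `w` for the weights `w₁`, `w₂` of `x`, `y`. -/
def IsWeighted (w₁ w₂ w : ℂ) (f : C3 → ℂ) : Prop :=
  ∀ᶠ p in 𝓝 0, w₁ * p 1 * pd 1 f p + w₂ * p 2 * pd 2 f p = w * f p

/-- The linear Euler field with weights `w₀`, `w₁`, `w₂`. -/
def diagField (w₀ w₁ w₂ : ℂ) : C3 →L[ℂ] C3 :=
  (ContinuousLinearMap.proj 0 : C3 →L[ℂ] ℂ).smulRight ![w₀, 0, 0] +
  (ContinuousLinearMap.proj 1 : C3 →L[ℂ] ℂ).smulRight ![0, w₁, 0] +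
  (ContinuousLinearMap.proj 2 : C3 →L[ℂ] ℂ).smulRight ![0, 0, w₂]

theorem diagField_apply (w₀ w₁ w₂ : ℂ) (p : C3) :
    diagField w₀ w₁ w₂ p = ![w₀ * p 0, w₁ * p 1, w₂ * p 2] := by
  ext l; fin_cases l <;> simp [diagField, mul_comm]

/-- The `y`-axis leaves all the degenerate loci of the normal forms, so it serves to check both `e ∧
E ≠ 0` and massiveness. -/
theorem frequently_of_axis {P : C3 → Prop} (h : ∀ s : ℂ, s ≠ 0 → P ![0, 0, s]) :
    ∃ᶠ p in 𝓝 0, P p := by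
  have ht : Tendsto (fun s : ℂ => (![0, 0, s] : C3)) (𝓝[≠] 0) (𝓝 0) := by
    have : Continuous fun s : ℂ => (![0, 0, s] : C3) := by
      refine continuous_pi fun i => ?_
      fin_cases i <;> simp <;> fun_prop
    have h2 := this.tendsto 0
    have h3 : (![0, 0, 0] : C3) = 0 := by ext i; fin_cases i <;> rfl
    rw [h3] at h2
    exact h2.mono_left nhdsWithin_le_nhds
  apply ht.frequently
  exact (eventually_nhdsWithin_of_forall (s := {0}ᶜ) fun s hs => h s hs).frequently

/-- The Frobenius germ with constant metric `2 dt dx + dy ^ 2` of a homogeneous potential. -/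
def germOfPotential (a b c : C3 → ℂ) (w₁ w₂ : ℂ) (h : IsPotential a b c) (hw : w₂ ≠ 0)
    (ha : IsWeighted w₁ w₂ (w₂ - w₁) a) (hb : IsWeighted w₁ w₂ (2 * (w₂ - w₁)) b)
    (hc : IsWeighted w₁ w₂ (3 * (w₂ - w₁)) c) : FrobeniusGerm where
  mul p := frobMul (a p) (b p) (c p)
  metric _ := flatForm
  conn _ := 0
  unit _ := ![1, 0, 0]
  -- With this weight of `t`, both `t x` and `y ^ 2` have degree `2 * w₂`, so the metric is
  -- rescaled; the same number is the factor by which the product is rescaled.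
  euler := diagField (2 * w₂ - w₁) w₁ w₂
  analytic_mul := analyticAt_frobMul h.analytic_a h.analytic_b h.analytic_c
  analytic_metric := analyticAt_const
  analytic_conn := analyticAt_const
  analytic_unit := analyticAt_const
  analytic_euler := ContinuousLinearMap.analyticAt _ _
  mul_comm := .of_forall fun p u v => frobMul_comm _ _ _ u v
  mul_assoc := .of_forall fun p u v w => frobMul_assoc _ _ _ u v w
  metric_symm := .of_forall fun p u v => by simp; ring
  metric_nondegenerate := .of_forall fun p u hu => flatForm_nondegenerate u hu
  metric_invariant := .of_forall fun p u v w => frobMul_invariant _ _ _ u v w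
  metric_flat := ⟨id, flatForm, analyticAt_id, by
    rw [fderiv_id]; exact Function.injective_id, .of_forall fun p u v => by simp⟩
  leviCivita := ⟨.of_forall fun p u v => by simp, .of_forall fun p z u v => by simp⟩
  unit_mul := .of_forall fun p v => frobMul_unit _ _ _ v
  unit_constant := .of_forall fun p => by simp [covVec]
  euler_linear := .of_forall fun p z u => by
    have : covVec (fun _ => 0) (diagField (2 * w₂ - w₁) w₁ w₂) =
        fun _ => diagField (2 * w₂ - w₁) w₁ w₂ := by
      funext q; simp [covVec]
    rw [covEnd, this]
    simp
  euler_mul := by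
    refine ⟨2 * w₂ - w₁, ?_⟩
    filter_upwards [h.analytic_a.eventually_analyticAt, h.analytic_b.eventually_analyticAt,
      h.analytic_c.eventually_analyticAt, h.a_t, h.b_t, h.c_t, ha, hb, hc]
      with p pa pb pc at0 bt0 ct0 ha hb hc u v
    rw [lieMul, fderiv_frobMul pa.differentiableAt pb.differentiableAt pc.differentiableAt]
    simp only [fderiv_eq_pd, at0, bt0, ct0, ContinuousLinearMap.fderiv, frobMul_apply,
      frobMulDeriv_apply, diagField_apply]
    ext l
    fin_cases l
    · simp
      linear_combination (u 2 * v 2 + 2 * b p * u 1 * v 1) * hb +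
        (u 1 * v 2 + u 2 * v 1 - a p * u 1 * v 1) * hc - c p * u 1 * v 1 * ha
    · simp; ring
    · simp
      linear_combination (u 2 * v 2) * ha + (u 1 * v 2 + u 2 * v 1) * hb + (u 1 * v 1) * hc
  euler_metric := by
    refine ⟨2 * w₂, .of_forall fun p u v => ?_⟩
    simp [lieMetric, diagField_apply]
    ring
  euler_nontrivial := by
    apply frequently_of_axis
    intro s hs
    rw [LinearIndependent.pair_iff]
    intro x y hxy
    have h0 := congrFun hxy 0
    have h2 := congrFun hxy 2
    simp [diagField_apply] at h0 h2
    exact ⟨h0, by tauto⟩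
  potential := by
    filter_upwards [h.analytic_a.eventually_analyticAt, h.analytic_b.eventually_analyticAt,
      h.analytic_c.eventually_analyticAt, h.a_t, h.b_t, h.c_t, h.a_x, h.b_x, h.c_x]
      with p pa pb pc at0 bt0 ct0 hax hbx hcx z u v w
    -- With constant metric and zero connection, only the derivatives of the coefficients of the
    -- product remain. Their total symmetry is `a_x = b_y`, `b_x = c_y` and the derivative in `y` of
    -- the associativity equation.
    have key : ∀ z u v w, covC (fun _ => flatForm) (fun p => frobMul (a p) (b p) (c p))
        (fun _ => 0) p z u v w = flatForm (frobMulDeriv (a p) (b p) (c p)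
          (fderiv ℂ a p z) (fderiv ℂ b p z) (fderiv ℂ c p z) u v) w := by
      intro z u v w
      rw [covC, fderiv_tensor (differentiableAt_const _) (analyticAt_frobMul pa pb pc).differentiableAt,
        fderiv_frobMul pa.differentiableAt pb.differentiableAt pc.differentiableAt]
      simp [tensorC]
    simp only [key, fderiv_eq_pd, at0, bt0, ct0, hax, hbx, hcx, frobMulDeriv_apply, flatForm_apply]
    refine ⟨?_, ?_, ?_⟩ <;> simp <;> ring

end

/-! ### Realization of the three normal forms -/

noncomputable section

section PartialDerivatives

variable {f g : C3 → ℂ} {p : C3} (i : Fin 3)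

theorem pd_add (hf : DifferentiableAt ℂ f p) (hg : DifferentiableAt ℂ g p) :
    pd i (fun q => f q + g q) p = pd i f p + pd i g p := by
  simp [pd, fderiv_fun_add hf hg]

theorem pd_mul (hf : DifferentiableAt ℂ f p) (hg : DifferentiableAt ℂ g p) :
    pd i (fun q => f q * g q) p = pd i f p * g p + f p * pd i g p := by
  simp [pd, fderiv_fun_mul hf hg]; ring

theorem pd_neg : pd i (fun q => -f q) p = -pd i f p := by
  simp [pd, fderiv_fun_neg]

theorem pd_const (c : ℂ) : pd i (fun _ => c) p = 0 := by
  simp [pd]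

theorem pd_pow (hf : DifferentiableAt ℂ f p) (n : ℕ) :
    pd i (fun q => f q ^ n) p = n * f p ^ (n - 1) * pd i f p := by
  simp [pd, fderiv_fun_pow n hf]

theorem pd_coord (j : Fin 3) : pd i (fun q => q j) p = if i = j then 1 else 0 := by
  have : (fun q : C3 => q j) = (ContinuousLinearMap.proj j : C3 →L[ℂ] ℂ) := rfl
  rw [pd, this, ContinuousLinearMap.fderiv]
  simp [Pi.single_apply, eq_comm]

end PartialDerivatives

theorem analyticAt_coord {n : ℕ} (i : Fin n) (p : Fin n → ℂ) :
    AnalyticAt ℂ (fun q : Fin n → ℂ => q i) p :=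
  (ContinuousLinearMap.proj (R := ℂ) (φ := fun _ : Fin n => ℂ) i).analyticAt p

namespace EllipticForm

/-- The coefficient `f_yyy` of the potential of the normal form. -/
def coeffA : EllipticForm → C3 → ℂ
  | form2, _ => 0
  | form3, p => -(1 / 2) * p 1
  | form4, p => -(p 1 ^ 2)

/-- The coefficient `f_xyy` of the potential of the normal form. -/
def coeffB : EllipticForm → C3 → ℂ
  | form2, p => -p 1
  | form3, p => -(1 / 2) * p 2 + 1 / 4 * p 1 ^ 2
  | form4, p => -2 * (p 1 * p 2) + 1 / 2 * p 1 ^ 4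

/-- The coefficient `f_xxy` of the potential of the normal form. -/
def coeffC : EllipticForm → C3 → ℂ
  | form2, p => -p 2
  | form3, p => 1 / 2 * (p 1 * p 2)
  | form4, p => -(p 2 ^ 2) + 2 * (p 1 ^ 3 * p 2)

/-- The weight of `x`. -/
def weightX : EllipticForm → ℂ
  | form2 => 2
  | form3 => 1
  | form4 => 1

/-- The weight of `y`. -/
def weightY : EllipticForm → ℂ
  | form2 => 3
  | form3 => 2
  | form4 => 3

theorem weightY_ne_zero (k : EllipticForm) : k.weightY ≠ 0 := by
  cases k <;> simp [weightY]

theorem analyticAt_coeffA (k : EllipticForm) (p : C3) : AnalyticAt ℂ k.coeffA p := by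
  have h1 := analyticAt_coord 1 p
  cases k
  · exact analyticAt_const
  · exact analyticAt_const.mul h1
  · exact (h1.pow 2).neg

theorem analyticAt_coeffB (k : EllipticForm) (p : C3) : AnalyticAt ℂ k.coeffB p := by
  have h1 := analyticAt_coord 1 p
  have h2 := analyticAt_coord 2 p
  cases k
  · exact h1.neg
  · exact (analyticAt_const.mul h2).add (analyticAt_const.mul (h1.pow 2))
  · exact (analyticAt_const.mul (h1.mul h2)).add (analyticAt_const.mul (h1.pow 4))

theorem analyticAt_coeffC (k : EllipticForm) (p : C3) : AnalyticAt ℂ k.coeffC p := by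
  have h1 := analyticAt_coord 1 p
  have h2 := analyticAt_coord 2 p
  cases k
  · exact h2.neg
  · exact analyticAt_const.mul (h1.mul h2)
  · exact (h2.pow 2).neg.add (analyticAt_const.mul ((h1.pow 3).mul h2))

theorem pd_coeffA (k : EllipticForm) (p : C3) : pd 0 k.coeffA p = 0 ∧
    pd 1 k.coeffA p = (match k with | form2 => 0 | form3 => -(1 / 2) | form4 => -2 * p 1) ∧
    pd 2 k.coeffA p = 0 := by
  cases k <;> simp only [funext (coeffA.eq_1), funext (coeffA.eq_2), funext (coeffA.eq_3)] <;>
    refine ⟨?_, ?_, ?_⟩ <;>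
    simp (disch := fun_prop) [pd_neg, pd_mul, pd_pow, pd_const, pd_coord]

theorem pd_coeffB (k : EllipticForm) (p : C3) : pd 0 k.coeffB p = 0 ∧
    pd 1 k.coeffB p = (match k with
      | form2 => -1 | form3 => 1 / 2 * p 1 | form4 => -2 * p 2 + 2 * p 1 ^ 3) ∧
    pd 2 k.coeffB p = (match k with | form2 => 0 | form3 => -(1 / 2) | form4 => -2 * p 1) := by
  cases k <;> simp only [funext (coeffB.eq_1), funext (coeffB.eq_2), funext (coeffB.eq_3)] <;>
    refine ⟨?_, ?_, ?_⟩ <;>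
    simp (disch := fun_prop) [pd_add, pd_neg, pd_mul, pd_pow, pd_const, pd_coord] <;> ring

theorem pd_coeffC (k : EllipticForm) (p : C3) : pd 0 k.coeffC p = 0 ∧
    pd 1 k.coeffC p = (match k with
      | form2 => 0 | form3 => 1 / 2 * p 2 | form4 => 6 * p 1 ^ 2 * p 2) ∧
    pd 2 k.coeffC p = (match k with
      | form2 => -1 | form3 => 1 / 2 * p 1 | form4 => -2 * p 2 + 2 * p 1 ^ 3) := by
  cases k <;> simp only [funext (coeffC.eq_1), funext (coeffC.eq_2), funext (coeffC.eq_3)] <;>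
    refine ⟨?_, ?_, ?_⟩ <;>
    simp (disch := fun_prop) [pd_add, pd_neg, pd_mul, pd_pow, pd_const, pd_coord] <;> ring

theorem isPotential (k : EllipticForm) : IsPotential k.coeffA k.coeffB k.coeffC where
  analytic_a := k.analyticAt_coeffA 0
  analytic_b := k.analyticAt_coeffB 0
  analytic_c := k.analyticAt_coeffC 0
  a_t := .of_forall fun p => (k.pd_coeffA p).1
  b_t := .of_forall fun p => (k.pd_coeffB p).1
  c_t := .of_forall fun p => (k.pd_coeffC p).1
  a_x := .of_forall fun p => by
    rw [(k.pd_coeffA p).2.1, (k.pd_coeffB p).2.2]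
  b_x := .of_forall fun p => by
    rw [(k.pd_coeffB p).2.1, (k.pd_coeffC p).2.2]
  c_x := .of_forall fun p => by
    rw [(k.pd_coeffC p).2.1, (k.pd_coeffC p).2.2, (k.pd_coeffB p).2.2, (k.pd_coeffA p).2.2]
    cases k <;> simp [coeffA, coeffB, coeffC] <;> ring

/-- The Frobenius germ with the given normal form as its booklet web. -/
def germ (k : EllipticForm) : FrobeniusGerm :=
  germOfPotential k.coeffA k.coeffB k.coeffC k.weightX k.weightY k.isPotential k.weightY_ne_zero
    (.of_forall fun p => by
      rw [(k.pd_coeffA p).2.1, (k.pd_coeffA p).2.2]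
      cases k <;> simp only [coeffA, weightX, weightY] <;> ring)
    (.of_forall fun p => by
      rw [(k.pd_coeffB p).2.1, (k.pd_coeffB p).2.2]
      cases k <;> simp only [coeffB, weightX, weightY] <;> ring)
    (.of_forall fun p => by
      rw [(k.pd_coeffC p).2.1, (k.pd_coeffC p).2.2]
      cases k <;> simp only [coeffC, weightX, weightY] <;> ring)

theorem germ_massive (k : EllipticForm) : k.germ.Massive := by
  apply frequently_of_axis
  intro s hs
  obtain ⟨l, hl⟩ := exists_isRootTriple (k.coeffA ![0, 0, s]) (k.coeffB ![0, 0, s])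
    (k.coeffC ![0, 0, s])
  refine hl.exists_isIdempotents ?_
  -- At `x = 0` the discriminant is `-27 c ^ 2` for forms 2 and 4, and `32 b ^ 3` for form 3.
  cases k <;> simp [bookletDiscr, coeffA, coeffB, coeffC, hs]

/-- The second coordinate of the flat coordinates on the surface `t = 0`. -/
def shift : EllipticForm → ℂ → ℂ
  | form2, _ => 0
  | form3, x => 1 / 12 * x ^ 2
  | form4, x => 1 / 9 * x ^ 3

/-- The derivative of `shift`. -/
def shiftDeriv : EllipticForm → ℂ → ℂ
  | form2, _ => 0
  | form3, x => 1 / 6 * x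
  | form4, x => 1 / 3 * x ^ 2

theorem hasDerivAt_shift (k : EllipticForm) (x : ℂ) : HasDerivAt k.shift (k.shiftDeriv x) x := by
  cases k
  · exact hasDerivAt_const x 0
  · have := (hasDerivAt_pow 2 x).const_mul (1 / 12)
    exact this.congr_deriv (by simp [shiftDeriv]; ring)
  · have := (hasDerivAt_pow 3 x).const_mul (1 / 9)
    exact this.congr_deriv (by simp [shiftDeriv]; ring)

theorem flatSurface_eq (k : EllipticForm) (q : C2) :
    k.flatSurface q = ![0, q 0, q 1 - k.shift (q 0)] := by
  cases k <;> simp [flatSurface, shift]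

theorem fderiv_flatSurface (k : EllipticForm) (q v : C2) :
    fderiv ℂ k.flatSurface q v = ![0, v 0, v 1 - k.shiftDeriv (q 0) * v 0] := by
  have e : k.flatSurface = fun q => ![0, q 0, q 1 - k.shift (q 0)] := funext k.flatSurface_eq
  have h0 : HasFDerivAt (fun q : C2 => q 0) (ContinuousLinearMap.proj 0 : C2 →L[ℂ] ℂ) q :=
    (ContinuousLinearMap.proj 0 : C2 →L[ℂ] ℂ).hasFDerivAt
  have h1 : HasFDerivAt (fun q : C2 => q 1) (ContinuousLinearMap.proj 1 : C2 →L[ℂ] ℂ) q :=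
    (ContinuousLinearMap.proj 1 : C2 →L[ℂ] ℂ).hasFDerivAt
  have h2 := h1.sub ((k.hasDerivAt_shift (q 0)).comp_hasFDerivAt q h0)
  have h : HasFDerivAt k.flatSurface (ContinuousLinearMap.pi
      ![0, (ContinuousLinearMap.proj 0 : C2 →L[ℂ] ℂ), ContinuousLinearMap.proj 1 -
        k.shiftDeriv (q 0) • ContinuousLinearMap.proj 0]) q := by
    rw [e, hasFDerivAt_pi']
    intro i
    fin_cases i
    · exact hasFDerivAt_const (0 : ℂ) q
    · exact h0
    · exact h2
  rw [h.fderiv]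
  ext i
  fin_cases i <;> simp

/-- The shift satisfies `shiftDeriv = -a / 3`, so passing from `ȳ` to `y` is the Tschirnhaus
substitution: it removes the quadratic term of the booklet cubic, as the normal forms require. -/
theorem web_eq (k : EllipticForm) (q v : C2) :
    k.web q v = bookletCubic (k.coeffA (k.flatSurface q)) (k.coeffB (k.flatSurface q))
      (k.coeffC (k.flatSurface q)) (fderiv ℂ k.flatSurface q v) := by
  rw [fderiv_flatSurface, flatSurface_eq]
  cases k <;> simp [web, bookletCubic, coeffA, coeffB, coeffC, shift, shiftDeriv] <;> ring

theorem germ_cutsWeb (k : EllipticForm) : k.germ.CutsWeb k.flatSurface k.web := by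
  refine ⟨⟨?_, ?_, ?_⟩, .of_forall fun q ε hε v _ => ?_⟩
  · have e : k.flatSurface = fun q => ![0, q 0, q 1 - k.shift (q 0)] := funext k.flatSurface_eq
    have hs : AnalyticAt ℂ k.shift 0 := by
      cases k <;> simp only [funext (shift.eq_1), funext (shift.eq_2), funext (shift.eq_3)] <;>
        fun_prop
    have h0 (i : Fin 2) : AnalyticAt ℂ (fun q : C2 => q i) 0 := analyticAt_coord i 0
    have h1 : AnalyticAt ℂ (fun q : C2 => k.shift (q 0)) 0 := AnalyticAt.comp (g := k.shift) hs (h0 0)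
    rw [e, analyticAt_pi_iff]
    intro i
    fin_cases i
    · exact analyticAt_const
    · exact h0 0
    · exact (h0 1).sub h1
  · rw [flatSurface_eq]
    ext i
    cases k <;> fin_cases i <;> simp [shift]
  · intro a v h
    rw [fderiv_flatSurface] at h
    have e0 := congrFun h 0
    have e1 := congrFun h 1
    have e2 := congrFun h 2
    simp [germ, germOfPotential] at e0 e1 e2
    refine ⟨e0, ?_⟩
    rw [e1] at e2
    ext i
    fin_cases i
    · exact e1
    · simpa using e2
  · rw [web_eq]
    exact IsIdempotents.cubic_eq_zero_iff hε _

end EllipticForm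

theorem EllipticForm.germ_realizes (k : EllipticForm) :
    k.germ.NullUnit ∧ k.germ.IsBookletWeb k.web ∧
      (∀ᶠ p in 𝓝 0, k.germ.unit p = ![1, 0, 0] ∧
        ∀ u v, k.germ.metric p u v = u 0 * v 1 + u 1 * v 0 + u 2 * v 2) ∧
      k.germ.CutsWeb k.flatSurface k.web := by
  refine ⟨.of_forall fun p => ?_, ⟨k.germ_massive, _, k.germ_cutsWeb⟩, .of_forall fun p => ?_,
    k.germ_cutsWeb⟩
  · simp [EllipticForm.germ, germOfPotential]
  · simp [EllipticForm.germ, germOfPotential]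

end

/-! ### Local inverses and flat charts -/

noncomputable section

theorem exists_analytic_localInverse {ψ : C3 → C3} (hψ : AnalyticAt ℂ ψ 0) (h0 : ψ 0 = 0)
    (hi : Function.Injective (fderiv ℂ ψ 0)) :
    ∃ φ : C3 → C3, AnalyticAt ℂ φ 0 ∧ φ 0 = 0 ∧ (∀ᶠ p in 𝓝 0, φ (ψ p) = p) ∧
      ∀ᶠ p in 𝓝 0, ψ (φ p) = p := by
  let e : C3 ≃L[ℂ] C3 :=
    (LinearEquiv.ofInjectiveEndo (fderiv ℂ ψ 0 : C3 →ₗ[ℂ] C3) hi).toContinuousLinearEquiv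
  have he : (e : C3 →L[ℂ] C3) = fderiv ℂ ψ 0 := by
    ext1 u; rfl
  have hs : HasStrictFDerivAt ψ (e : C3 →L[ℂ] C3) 0 := by
    rw [he]; exact hψ.hasStrictFDerivAt
  have ha := (hs.toOpenPartialHomeomorph ψ).analyticAt_symm'
    hs.mem_toOpenPartialHomeomorph_source (i := e) hψ he.symm
  have hl := hs.eventually_left_inverse
  have hr := hs.eventually_right_inverse
  have hv := hs.localInverse_apply_image
  rw [h0] at hr hv
  refine ⟨hs.localInverse ψ e 0, ?_, hv, hl, hr⟩
  rw [hs.toOpenPartialHomeomorph_coe, h0] at ha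
  exact ha

theorem map_nhds_zero {ψ : C3 → C3} (hψ : AnalyticAt ℂ ψ 0) (h0 : ψ 0 = 0)
    (hi : Function.Injective (fderiv ℂ ψ 0)) : map ψ (𝓝 0) = 𝓝 0 := by
  let e : C3 ≃L[ℂ] C3 :=
    (LinearEquiv.ofInjectiveEndo (fderiv ℂ ψ 0 : C3 →ₗ[ℂ] C3) hi).toContinuousLinearEquiv
  have he : (e : C3 →L[ℂ] C3) = fderiv ℂ ψ 0 := by
    ext1 u; rfl
  have hs : HasStrictFDerivAt ψ (e : C3 →L[ℂ] C3) 0 := by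
    rw [he]; exact hψ.hasStrictFDerivAt
  have := hs.map_nhds_eq_of_equiv
  rwa [h0] at this

theorem tendsto_nhds_zero {E F : Type*} [NormedAddCommGroup E] [NormedSpace ℂ E]
    [NormedAddCommGroup F] [NormedSpace ℂ F] {ψ : E → F} (hψ : AnalyticAt ℂ ψ 0) (h0 : ψ 0 = 0) :
    Tendsto ψ (𝓝 0) (𝓝 0) := by
  have := hψ.continuousAt.tendsto
  rwa [h0] at this

/-- The differentials of mutually inverse germs are mutually inverse. -/
theorem fderiv_comp_eq_id {E F : Type*} [NormedAddCommGroup E] [NormedSpace ℂ E]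
    [CompleteSpace E] [NormedAddCommGroup F] [NormedSpace ℂ F] [CompleteSpace F]
    {ψ : E → F} {φ : F → E} (hψ : AnalyticAt ℂ ψ 0) (h0 : ψ 0 = 0)
    (hφ : AnalyticAt ℂ φ 0) (h : ∀ᶠ p in 𝓝 0, φ (ψ p) = p) :
    ∀ᶠ p in 𝓝 0, ∀ u, fderiv ℂ φ (ψ p) (fderiv ℂ ψ p u) = u := by
  filter_upwards [h.eventually_nhds, hψ.eventually_analyticAt,
    (tendsto_nhds_zero hψ h0).eventually hφ.eventually_analyticAt] with p hp h1 h2 u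
  have e : (fun q => φ (ψ q)) =ᶠ[𝓝 p] id := hp
  have h3 := e.fderiv_eq (𝕜 := ℂ)
  rw [fderiv_id] at h3
  have h4 := (h2.differentiableAt.hasFDerivAt.comp p h1.differentiableAt.hasFDerivAt).fderiv
  have h5 : fderiv ℂ (φ ∘ ψ) p = ContinuousLinearMap.id ℂ E := h3
  rw [h4] at h5
  exact congrArg (fun L : E →L[ℂ] E => L u) h5

theorem eventually_eq_of_fderiv_eq_zero {F : Type*} [NormedAddCommGroup F] [NormedSpace ℂ F]
    {f : C3 → F} (hf : ∀ᶠ p in 𝓝 0, DifferentiableAt ℂ f p) (h : ∀ᶠ p in 𝓝 0, fderiv ℂ f p = 0) :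
    ∀ᶠ p in 𝓝 0, f p = f 0 := by
  obtain ⟨r, hr, H⟩ := Metric.eventually_nhds_iff_ball.1 (hf.and h)
  refine Metric.eventually_nhds_iff_ball.2 ⟨r, hr, fun p hp => ?_⟩
  exact (convex_ball (0 : C3) r).is_const_of_fderivWithin_eq_zero (𝕜 := ℂ)
    (fun q hq => (H q hq).1.differentiableWithinAt)
    (fun q hq => by
      rw [fderivWithin_of_isOpen Metric.isOpen_ball hq]; exact (H q hq).2) hp
    (Metric.mem_ball_self hr)

theorem isSymm_fderiv_fderiv {ψ : C3 → C3} {p : C3} (h : AnalyticAt ℂ ψ p) (u v : C3) :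
    fderiv ℂ (fderiv ℂ ψ) p u v = fderiv ℂ (fderiv ℂ ψ) p v u :=
  (h.contDiffAt (n := 2)).isSymmSndFDerivAt (by simp) u v

theorem fderiv_clm_apply_const {E F G : Type*} [NormedAddCommGroup E] [NormedSpace ℂ E]
    [NormedAddCommGroup F] [NormedSpace ℂ F] [NormedAddCommGroup G] [NormedSpace ℂ G]
    {T : E → F →L[ℂ] G} {w : E → F} {p : E} (hT : DifferentiableAt ℂ T p)
    (hw : DifferentiableAt ℂ w p) (z : E) :
    fderiv ℂ (fun q => T q (w q)) p z = fderiv ℂ T p z (w p) + T p (fderiv ℂ w p z) := by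
  rw [(hT.hasFDerivAt.clm_apply hw.hasFDerivAt).fderiv]
  simp [add_comm]

namespace FrobeniusGerm

variable {F : FrobeniusGerm} {ψ : C3 → C3} {g₀ : C3 →L[ℂ] C3 →L[ℂ] ℂ}

theorem eventually_injective_of_metric
    (hg : ∀ᶠ p in 𝓝 0, ∀ u v, F.metric p u v = g₀ (fderiv ℂ ψ p u) (fderiv ℂ ψ p v)) :
    ∀ᶠ p in 𝓝 0, Function.Injective (fderiv ℂ ψ p) := by
  filter_upwards [hg, F.metric_nondegenerate] with p hp hn
  refine (injective_iff_map_eq_zero _).2 fun u hu => hn u fun v => ?_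
  rw [hp, hu]; simp

theorem surjective_of_injective {T : C3 →L[ℂ] C3} (h : Function.Injective T) :
    Function.Surjective T :=
  (LinearMap.injective_iff_surjective (f := (T : C3 →ₗ[ℂ] C3))).1 h

/-- The second derivative of flat coordinates is given by the Levi-Civita connection. -/
theorem fderiv_fderiv_eq_conn (hψ : AnalyticAt ℂ ψ 0)
    (hg : ∀ᶠ p in 𝓝 0, ∀ u v, F.metric p u v = g₀ (fderiv ℂ ψ p u) (fderiv ℂ ψ p v)) :
    ∀ᶠ p in 𝓝 0, ∀ z u, fderiv ℂ (fderiv ℂ ψ) p z u = fderiv ℂ ψ p (F.conn p z u) := by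
  filter_upwards [hg.eventually_nhds, eventually_injective_of_metric hg,
    hψ.eventually_analyticAt, F.analytic_metric.eventually_analyticAt, F.metric_symm,
    F.metric_nondegenerate, F.leviCivita.1, F.leviCivita.2]
    with p hp hinj hψp hgp hsymm hnd htf hcompat z u
  have hsurj := surjective_of_injective hinj
  have hp0 := hp.self_of_nhds
  have hd : ∀ z u v, fderiv ℂ F.metric p z u v =
      g₀ (fderiv ℂ (fderiv ℂ ψ) p z u) (fderiv ℂ ψ p v) +
        g₀ (fderiv ℂ ψ p u) (fderiv ℂ (fderiv ℂ ψ) p z v) := by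
    intro z u v
    have e : (fun q => F.metric q u v) =ᶠ[𝓝 p]
        fun q => g₀ (fderiv ℂ ψ q u) (fderiv ℂ ψ q v) := hp.mono fun q hq => hq u v
    have h1 := e.fderiv_eq (𝕜 := ℂ)
    have h2 := (hgp.differentiableAt.hasFDerivAt.clm_apply (hasFDerivAt_const u p)).clm_apply
      (hasFDerivAt_const v p)
    rw [h2.fderiv] at h1
    have h3 (w : C3) := hψp.fderiv.differentiableAt.hasFDerivAt.clm_apply (hasFDerivAt_const w p)
    have h4 := (g₀.hasFDerivAt.comp p (h3 u)).clm_apply (h3 v)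
    have h5 : fderiv ℂ (fun q => g₀ (fderiv ℂ ψ q u) (fderiv ℂ ψ q v)) p = _ := h4.fderiv
    rw [h5] at h1
    have h6 := congrArg (fun L : C3 →L[ℂ] ℂ => L z) h1
    simpa [add_comm] using h6
  -- `S` is the second derivative of `ψ` pulled back by `dψ`. Both `F.conn` and `S` are symmetric
  -- and compatible with the metric, so their difference is symmetric in its two arguments and skew
  -- with respect to the metric.
  have hX : ∀ z u, ∃ x, fderiv ℂ ψ p x = fderiv ℂ (fderiv ℂ ψ) p z u :=
    fun z u => hsurj _
  choose S hS using hX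
  have hSsymm : ∀ z u, S z u = S u z := fun z u => hinj (by
    rw [hS, hS, isSymm_fderiv_fderiv hψp])
  have key : ∀ z u v, F.metric p (F.conn p z u - S z u) v +
      F.metric p (F.conn p z v - S z v) u = 0 := by
    intro z u v
    have h1 := hcompat z u v
    rw [hd, ← hS, ← hS, ← hp0, ← hp0] at h1
    rw [map_sub, map_sub, _root_.sub_apply, _root_.sub_apply]
    rw [hsymm u, hsymm u] at h1
    linear_combination -h1
  -- A trilinear expression symmetric in the first two slots and skew in the last two vanishes: the
  -- Koszul argument.
  have hD : F.conn p z u - S z u = 0 := by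
    refine hnd _ fun v => ?_
    have s1 : ∀ z u, F.conn p z u - S z u = F.conn p u z - S u z := fun z u => by
      rw [htf, hSsymm]
    have k1 := key z u v
    have k2 := key u v z
    have k3 := key v z u
    rw [s1 u v] at k2
    rw [s1 v z, s1 v u] at k3
    rw [s1 u z] at k2
    rw [s1 v u] at k2
    rw [s1 u v] at k2 k3
    rw [s1 v u] at k2 k3
    linear_combination (k1 + k2 - k3) / 2
  rw [← hS, sub_eq_zero.1 hD]

/-- As the Christoffel symbols are absorbed by the second derivative of `ψ`, covariant
differentiation becomes ordinary differentiation in the flat coordinates. This turns `∇ e = 0` and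
`∇ (∇ E) = 0` into statements about constant and affine fields. -/
theorem fderiv_pushforward {p : C3} (hψ : AnalyticAt ℂ ψ p)
    (hc : ∀ z u, fderiv ℂ (fderiv ℂ ψ) p z u = fderiv ℂ ψ p (F.conn p z u))
    {w : C3 → C3} (hw : DifferentiableAt ℂ w p) (z : C3) :
    fderiv ℂ (fun q => fderiv ℂ ψ q (w q)) p z = fderiv ℂ ψ p (covVec F.conn w p z) := by
  rw [fderiv_clm_apply_const hψ.fderiv.differentiableAt hw, hc]
  simp [covVec, add_comm]

theorem unit_ne_zero : ∀ᶠ p in 𝓝 0, F.unit p ≠ 0 := by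
  filter_upwards [F.unit_mul] with p hp h
  have := hp ![1, 0, 0]
  rw [h] at this
  simpa using congrFun this 0

/-- A flat chart: coordinates in which the metric is `2 dt dx + dy ^ 2` and the unity is `∂_t`. -/
structure IsChart (F : FrobeniusGerm) (ψ : C3 → C3) : Prop where
  analytic : AnalyticAt ℂ ψ 0
  map_zero : ψ 0 = 0
  metric : ∀ᶠ p in 𝓝 0, ∀ u v,
    F.metric p u v = flatForm (fderiv ℂ ψ p u) (fderiv ℂ ψ p v)
  unit : ∀ᶠ p in 𝓝 0, fderiv ℂ ψ p (F.unit p) = ![1, 0, 0]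

/-- The null vector `e` is completed to a hyperbolic pair `e, f`; the orthogonal complement of the
pair is a line, whose generator `h` is not null and can be normalized by a square root. Pairing with
`f`, `e` and `h / s` gives the new coordinates. -/
theorem exists_flatForm_eq (hs : ∀ u v, g₀ u v = g₀ v u) (hn : ∀ u, (∀ v, g₀ u v = 0) → u = 0)
    {e : C3} (he : e ≠ 0) (hee : g₀ e e = 0) :
    ∃ A : C3 →L[ℂ] C3, A e = ![1, 0, 0] ∧ ∀ u v, g₀ u v = flatForm (A u) (A v) := by
  obtain ⟨f, hef, hff⟩ : ∃ f, g₀ e f = 1 ∧ g₀ f f = 0 := by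
    obtain ⟨f, hf⟩ : ∃ f, g₀ e f ≠ 0 := by
      by_contra! h; exact he (hn e h)
    set f' := (g₀ e f)⁻¹ • f with hf'
    have h1 : g₀ e f' = 1 := by simp [hf', hf]
    -- Subtracting a multiple of the null vector makes the second vector null without changing its
    -- product with `e`.
    refine ⟨f' - (g₀ f' f' / 2) • e, ?_, ?_⟩
    · simp [h1, hee]
    · simp [h1, hee, hs f' e]; ring
  obtain ⟨h, hh0, hhe, hhf⟩ : ∃ h, h ≠ 0 ∧ g₀ h e = 0 ∧ g₀ h f = 0 := by
    let L : C3 →ₗ[ℂ] (Fin 2 → ℂ) := LinearMap.pi ![(g₀.flip e : C3 →ₗ[ℂ] ℂ), (g₀.flip f : C3 →ₗ[ℂ] ℂ)]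
    have hL : LinearMap.ker L ≠ ⊥ := LinearMap.ker_ne_bot_of_finrank_lt (by simp)
    obtain ⟨h, hh, hne⟩ := (Submodule.ne_bot_iff _).1 hL
    have h0 := congrFun (LinearMap.mem_ker.1 hh) 0
    have h1 := congrFun (LinearMap.mem_ker.1 hh) 1
    exact ⟨h, hne, by simpa [L] using h0, by simpa [L] using h1⟩
  have hli : LinearIndependent ℂ ![e, f, h] := by
    rw [Fintype.linearIndependent_iff]
    intro x hx
    simp only [Fin.sum_univ_three, Matrix.cons_val] at hx
    have h1 := congrArg (g₀ e) hx
    have h2 := congrArg (g₀ f) hx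
    simp [hee, hef, hs e h, hhe] at h1
    simp [hff, hs f e, hef, hs f h, hhf] at h2
    simp [h1, h2, hh0] at hx
    intro i; fin_cases i <;> assumption
  have hdec : ∀ v, ∃ x y z : ℂ, v = x • e + y • f + z • h := by
    intro v
    let B := basisOfLinearIndependentOfCardEqFinrank hli (by simp)
    refine ⟨B.repr v 0, B.repr v 1, B.repr v 2, ?_⟩
    conv_lhs => rw [← B.sum_repr v]
    simp [B, Fin.sum_univ_three]
  have hhh : g₀ h h ≠ 0 := by
    intro h0
    refine hh0 (hn h fun v => ?_)
    obtain ⟨x, y, z, rfl⟩ := hdec v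
    simp [hhe, hhf, h0]
  obtain ⟨s, hs2⟩ := IsAlgClosed.exists_eq_mul_self (g₀ h h)
  have hs0 : s ≠ 0 := by rintro rfl; simp at hs2; exact hhh hs2
  refine ⟨ContinuousLinearMap.pi ![g₀.flip f, g₀.flip e, s⁻¹ • g₀.flip h], ?_, ?_⟩
  · ext i; fin_cases i <;> simp [hef, hee, hs e h, hhe]
  · intro u v
    obtain ⟨x, y, z, rfl⟩ := hdec u
    obtain ⟨x', y', z', rfl⟩ := hdec v
    simp [hef, hee, hff, hs e h, hs f h, hhe, hhf, hs f e, hs2]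
    field_simp

/-- In any flat coordinates the unity has zero derivative, hence is a constant null vector; a linear
change then normalizes metric and unity simultaneously. -/
theorem exists_isChart (F : FrobeniusGerm) (hF : F.NullUnit) : ∃ ψ, F.IsChart ψ := by
  obtain ⟨ψ, g₀, hψ, hinj, hg⟩ := F.metric_flat
  have hsurj := surjective_of_injective hinj
  have hc := fderiv_fderiv_eq_conn hψ hg
  have hg0 := hg.self_of_nhds
  have hconst : ∀ᶠ p in 𝓝 0, fderiv ℂ ψ p (F.unit p) = fderiv ℂ ψ 0 (F.unit 0) := by
    refine eventually_eq_of_fderiv_eq_zero (f := fun p => fderiv ℂ ψ p (F.unit p)) ?_ ?_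
    · filter_upwards [hψ.eventually_analyticAt, F.analytic_unit.eventually_analyticAt] with p h1 h2
      exact h1.fderiv.differentiableAt.clm_apply h2.differentiableAt
    · filter_upwards [hψ.eventually_analyticAt, F.analytic_unit.eventually_analyticAt, hc,
        F.unit_constant] with p h1 h2 h3 h4
      ext1 z
      rw [fderiv_pushforward h1 h3 h2.differentiableAt, h4]
      simp
  have hsymm : ∀ u v, g₀ u v = g₀ v u := by
    intro u v
    obtain ⟨u, rfl⟩ := hsurj u
    obtain ⟨v, rfl⟩ := hsurj v
    rw [← hg0, ← hg0, F.metric_symm.self_of_nhds]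
  have hnd : ∀ u, (∀ v, g₀ u v = 0) → u = 0 := by
    intro u hu
    obtain ⟨u, rfl⟩ := hsurj u
    rw [F.metric_nondegenerate.self_of_nhds u fun v => by rw [hg0, hu], _root_.map_zero]
  obtain ⟨A, hAe, hA⟩ := exists_flatForm_eq hsymm hnd (e := fderiv ℂ ψ 0 (F.unit 0))
    (fun h => unit_ne_zero.self_of_nhds (hinj (h.trans (_root_.map_zero _).symm)))
    (by rw [← hg0]; exact hF.self_of_nhds)
  have hd : ∀ᶠ p in 𝓝 0, ∀ u, fderiv ℂ (fun q => A (ψ q - ψ 0)) p u = A (fderiv ℂ ψ p u) := by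
    filter_upwards [hψ.eventually_analyticAt] with p h u
    have := A.hasFDerivAt.comp p (h.differentiableAt.hasFDerivAt.sub_const (ψ 0))
    have h' : HasFDerivAt (fun q => A (ψ q - ψ 0)) _ p := this
    rw [h'.fderiv]; rfl
  refine ⟨fun q => A (ψ q - ψ 0), ?_, by simp, ?_, ?_⟩
  · exact (A.analyticAt _).comp (hψ.sub analyticAt_const)
  · filter_upwards [hg, hd] with p h1 h2 u v
    rw [h1, h2, h2, hA]
  · filter_upwards [hconst, hd] with p h1 h2
    rw [h2, h1, hAe]

/-- Composition of a flat chart with a linear isometry that fixes `∂_t`. -/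
theorem IsChart.comp_linear (h : F.IsChart ψ) {L : C3 →L[ℂ] C3}
    (hL : ∀ u v, flatForm (L u) (L v) = flatForm u v) (hL1 : L ![1, 0, 0] = ![1, 0, 0]) :
    F.IsChart (fun p => L (ψ p)) ∧
      ∀ᶠ p in 𝓝 0, ∀ u, fderiv ℂ (fun p => L (ψ p)) p u = L (fderiv ℂ ψ p u) := by
  have hd : ∀ᶠ p in 𝓝 0, ∀ u, fderiv ℂ (fun p => L (ψ p)) p u = L (fderiv ℂ ψ p u) := by
    filter_upwards [h.analytic.eventually_analyticAt] with p h u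
    have h' : HasFDerivAt (fun q => L (ψ q)) _ p :=
      L.hasFDerivAt.comp p h.differentiableAt.hasFDerivAt
    rw [h'.fderiv]; rfl
  refine ⟨⟨(L.analyticAt _).comp h.analytic, by simp [h.map_zero], ?_, ?_⟩, hd⟩
  · filter_upwards [h.metric, hd] with p h1 h2 u v
    rw [h1, h2, h2, hL]
  · filter_upwards [h.unit, hd] with p h1 h2
    rw [h2, h1, hL1]

end FrobeniusGerm

end

/-! ### Product and Euler field in a flat chart -/

noncomputable section

/-- A commutative associative product with unity `∂_t` and invariant form `2 dt dx + dy ^ 2` is a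
Frobenius product. -/
theorem eq_frobMul {m : C3 →L[ℂ] C3 →L[ℂ] C3} (hc : ∀ u v, m u v = m v u)
    (ha : ∀ u v w, m (m u v) w = m u (m v w))
    (hi : ∀ u v w, flatForm (m u v) w = flatForm u (m v w))
    (h1 : ∀ v, m ![1, 0, 0] v = v) :
    m = frobMul (m ![0, 0, 1] ![0, 0, 1] 2) (m ![0, 0, 1] ![0, 0, 1] 0)
      (m ![0, 1, 0] ![0, 0, 1] 0) := by
  -- The components of a product are its pairings with the basis; invariance together with the unity
  -- makes those with `∂_t` known and identifies the remaining ones with one another.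
  have e22 : m ![0, 0, 1] ![0, 0, 1] = ![m ![0, 0, 1] ![0, 0, 1] 0, 1,
      m ![0, 0, 1] ![0, 0, 1] 2] := by
    have := hi ![0, 0, 1] ![0, 0, 1] ![1, 0, 0]
    rw [hc ![0, 0, 1] ![1, 0, 0], h1] at this
    ext i; fin_cases i
    · rfl
    · simpa using this
    · rfl
  have e12 : m ![0, 1, 0] ![0, 0, 1] = ![m ![0, 1, 0] ![0, 0, 1] 0, 0,
      m ![0, 0, 1] ![0, 0, 1] 0] := by
    have h3 := hi ![0, 1, 0] ![0, 0, 1] ![1, 0, 0]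
    have h4 := hi ![0, 1, 0] ![0, 0, 1] ![0, 0, 1]
    rw [hc ![0, 0, 1] ![1, 0, 0], h1] at h3
    ext i; fin_cases i
    · rfl
    · simpa using h3
    · simpa using h4
  have e11' : m ![0, 1, 0] ![0, 1, 0] = ![m ![0, 1, 0] ![0, 1, 0] 0, 0,
      m ![0, 1, 0] ![0, 0, 1] 0] := by
    have h3 := hi ![0, 1, 0] ![0, 1, 0] ![1, 0, 0]
    have h4 := hi ![0, 1, 0] ![0, 1, 0] ![0, 0, 1]
    rw [hc ![0, 1, 0] ![1, 0, 0], h1] at h3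
    ext i; fin_cases i
    · rfl
    · simpa using h3
    · simpa using h4
  generalize m ![0, 0, 1] ![0, 0, 1] 2 = a at *
  generalize m ![0, 0, 1] ![0, 0, 1] 0 = b at *
  generalize m ![0, 1, 0] ![0, 0, 1] 0 = c at *
  generalize m ![0, 1, 0] ![0, 1, 0] 0 = d at *
  have hdec : ∀ V : C3, V = V 0 • ![1, 0, 0] + V 1 • ![0, 1, 0] + V 2 • ![0, 0, 1] := by
    intro V; ext i; fin_cases i <;> simp
  have e21 : m ![0, 0, 1] ![0, 1, 0] = ![c, 0, b] := by rw [hc, e12]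
  have r1 : ∀ v, m v ![1, 0, 0] = v := fun v => by rw [hc, h1]
  have expand : ∀ u v : C3, m u v =
      ![u 0 * v 0 + b * (u 2 * v 2) + c * (u 1 * v 2 + u 2 * v 1) + d * (u 1 * v 1),
      u 0 * v 1 + u 1 * v 0 + u 2 * v 2,
      u 0 * v 2 + u 2 * v 0 + a * (u 2 * v 2) + b * (u 1 * v 2 + u 2 * v 1) +
        c * (u 1 * v 1)] := by
    intro u v
    conv_lhs => rw [hdec u, hdec v]
    simp only [map_add, map_smul, _root_.add_apply, _root_.smul_apply, h1, r1, e22, e12, e21, e11']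
    ext i; fin_cases i <;> simp <;> ring
  -- The only relation left by associativity: `(∂_y ∘ ∂_y) ∘ ∂_x = ∂_y ∘ (∂_y ∘ ∂_x)`.
  have hd : d = b ^ 2 - a * c := by
    have h3 := congrFun (ha ![0, 0, 1] ![0, 0, 1] ![0, 1, 0]) 0
    simp [expand] at h3
    linear_combination h3
  ext1 u; ext1 v
  rw [expand, frobMul_apply, hd]

theorem analyticAt_clm_apply {E F G : Type*} [NormedAddCommGroup E] [NormedSpace ℂ E]
    [NormedAddCommGroup F] [NormedSpace ℂ F] [NormedAddCommGroup G] [NormedSpace ℂ G]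
    {T : E → F →L[ℂ] G} {w : E → F} {p : E} (hT : AnalyticAt ℂ T p) (hw : AnalyticAt ℂ w p) :
    AnalyticAt ℂ (fun q => T q (w q)) p :=
  AnalyticAt.comp (g := fun x : (F →L[ℂ] G) × F => ContinuousLinearMap.id ℂ (F →L[ℂ] G) x.1 x.2)
    (f := fun q => (T q, w q)) (ContinuousLinearMap.analyticAt_bilinear _ _) (hT.prod hw)

theorem differentiableAt_clm_flip {D E F G : Type*} [NormedAddCommGroup D] [NormedSpace ℂ D]
    [NormedAddCommGroup E] [NormedSpace ℂ E]
    [NormedAddCommGroup F] [NormedSpace ℂ F] [NormedAddCommGroup G] [NormedSpace ℂ G]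
    {T : D → E →L[ℂ] F →L[ℂ] G} {p : D} (hT : DifferentiableAt ℂ T p) :
    DifferentiableAt ℂ (fun q => (T q).flip) p :=
by
  let e : (E →L[ℂ] F →L[ℂ] G) →L[ℂ] F →L[ℂ] E →L[ℂ] G :=
    (ContinuousLinearMap.flipₗᵢ ℂ E F G).toContinuousLinearEquiv.toContinuousLinearMap
  have he : Differentiable ℂ e := e.differentiable
  exact DifferentiableAt.fun_comp' (𝕜 := ℂ) (E := D) (F := E →L[ℂ] F →L[ℂ] G)
    (G := F →L[ℂ] E →L[ℂ] G) p he.differentiableAt hT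

namespace FrobeniusGerm

variable {F : FrobeniusGerm} {ψ : C3 → C3}

theorem IsChart.injective (h : F.IsChart ψ) : ∀ᶠ p in 𝓝 0, Function.Injective (fderiv ℂ ψ p) :=
  eventually_injective_of_metric h.metric

theorem IsChart.map_nhds (h : F.IsChart ψ) : map ψ (𝓝 0) = 𝓝 0 :=
  map_nhds_zero h.analytic h.map_zero h.injective.self_of_nhds

/-- The product in a flat chart is given by three functions of the flat coordinates. -/
theorem IsChart.exists_coefficients (h : F.IsChart ψ) : ∃ a b c : C3 → ℂ,
    AnalyticAt ℂ a 0 ∧ AnalyticAt ℂ b 0 ∧ AnalyticAt ℂ c 0 ∧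
    ∀ᶠ p in 𝓝 0, ∀ u v, fderiv ℂ ψ p (F.mul p u v) =
      frobMul (a (ψ p)) (b (ψ p)) (c (ψ p)) (fderiv ℂ ψ p u) (fderiv ℂ ψ p v) := by
  obtain ⟨φ, hφ, hφ0, hl, hr⟩ := exists_analytic_localInverse h.analytic h.map_zero
    h.injective.self_of_nhds
  have hD := fderiv_comp_eq_id h.analytic h.map_zero hφ hl
  -- The product is transported to the target by the local inverse `φ`, which makes its coefficients
  -- analytic functions of the flat coordinates.
  let M (u v q : C3) : C3 := fderiv ℂ ψ (φ q) (F.mul (φ q) (fderiv ℂ φ q u) (fderiv ℂ φ q v))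
  have hM : ∀ u v i, AnalyticAt ℂ (fun q => M u v q i) 0 := by
    intro u v i
    have hu (u : C3) : AnalyticAt ℂ (fun q => fderiv ℂ φ q u) 0 :=
      analyticAt_clm_apply hφ.fderiv analyticAt_const
    have hm : AnalyticAt ℂ (fun q => F.mul (φ q)) 0 :=
      AnalyticAt.comp (by rw [hφ0]; exact F.analytic_mul) hφ
    have hψ' : AnalyticAt ℂ (fun q => fderiv ℂ ψ (φ q)) 0 :=
      AnalyticAt.comp (g := fderiv ℂ ψ) (by rw [hφ0]; exact h.analytic.fderiv) hφ
    have := analyticAt_clm_apply hψ' (analyticAt_clm_apply (analyticAt_clm_apply hm (hu u)) (hu v))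
    exact (analyticAt_pi_iff.1 this) i
  refine ⟨_, _, _, hM ![0, 0, 1] ![0, 0, 1] 2, hM ![0, 0, 1] ![0, 0, 1] 0,
    hM ![0, 1, 0] ![0, 0, 1] 0, ?_⟩
  filter_upwards [hl, hD, h.injective, h.unit, h.metric, F.mul_comm, F.mul_assoc,
    F.metric_invariant, F.unit_mul] with p hlp hDp hinj hunit hmet hcomm hassoc hinv hum u v
  have hDp' : ∀ u, fderiv ℂ ψ p (fderiv ℂ φ (ψ p) u) = u := by
    intro u
    obtain ⟨u, rfl⟩ := surjective_of_injective hinj u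
    rw [hDp]
  let T : C3 →L[ℂ] C3 →L[ℂ] C3 :=
    (ContinuousLinearMap.compL ℂ C3 C3 C3 (fderiv ℂ ψ p)).comp
      ((F.mul p).bilinearComp (fderiv ℂ φ (ψ p)) (fderiv ℂ φ (ψ p)))
  have hT : ∀ u v, T u v = fderiv ℂ ψ p (F.mul p (fderiv ℂ φ (ψ p) u) (fderiv ℂ φ (ψ p) v)) :=
    fun u v => rfl
  have hTM : ∀ u v, M u v (ψ p) = T u v := by
    intro u v; simp only [M, hlp, hT]
  have key := eq_frobMul (m := T) (fun u v => by rw [hT, hT, hcomm])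
    (fun u v w => by simp only [hT, hDp, hassoc])
    (fun u v w => by
      obtain ⟨u, rfl⟩ := surjective_of_injective hinj u
      obtain ⟨w, rfl⟩ := surjective_of_injective hinj w
      rw [hT, hT, ← hmet, ← hmet, hDp, hDp, hinv])
    (fun v => by rw [hT, ← hunit, hDp, hum, hDp'])
  simp only [hTM]
  rw [← key, hT, hDp, hDp]

theorem IsChart.fderiv_fderiv (h : F.IsChart ψ) :
    ∀ᶠ p in 𝓝 0, ∀ z u, fderiv ℂ (fderiv ℂ ψ) p z u = fderiv ℂ ψ p (F.conn p z u) :=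
  fderiv_fderiv_eq_conn h.analytic h.metric

theorem fderiv_transported {N : ProductField} {p : C3} (hψ : AnalyticAt ℂ ψ p)
    (hN : AnalyticAt ℂ N (ψ p)) (u v z : C3) :
    fderiv ℂ (fun q => N (ψ q) (fderiv ℂ ψ q u) (fderiv ℂ ψ q v)) p z =
      fderiv ℂ N (ψ p) (fderiv ℂ ψ p z) (fderiv ℂ ψ p u) (fderiv ℂ ψ p v) +
      N (ψ p) (fderiv ℂ (fderiv ℂ ψ) p z u) (fderiv ℂ ψ p v) +
      N (ψ p) (fderiv ℂ ψ p u) (fderiv ℂ (fderiv ℂ ψ) p z v) := by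
  have h3 (w : C3) := hψ.fderiv.differentiableAt.hasFDerivAt.clm_apply (hasFDerivAt_const w p)
  have h4 := ((hN.differentiableAt.hasFDerivAt.comp p
    hψ.differentiableAt.hasFDerivAt).clm_apply (h3 u)).clm_apply (h3 v)
  have h5 : HasFDerivAt (fun q => N (ψ q) (fderiv ℂ ψ q u) (fderiv ℂ ψ q v)) _ p := h4
  rw [h5.fderiv]
  simp
  abel

/-- In a flat chart the derivative of the product is symmetric. -/
theorem IsChart.symmetric (h : F.IsChart ψ) {N : ProductField} (hN : AnalyticAt ℂ N 0)
    (hrel : ∀ᶠ p in 𝓝 0, ∀ u v, fderiv ℂ ψ p (F.mul p u v) =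
      N (ψ p) (fderiv ℂ ψ p u) (fderiv ℂ ψ p v)) :
    ∀ᶠ p in 𝓝 0, ∀ z u v w,
      flatForm (fderiv ℂ N p z u v) w = flatForm (fderiv ℂ N p u z v) w := by
  -- A property near `0` in the flat coordinates is checked at the points `ψ p`.
  rw [← h.map_nhds, eventually_map]
  filter_upwards [hrel.eventually_nhds, h.metric.eventually_nhds, h.injective, h.fderiv_fderiv,
    h.analytic.eventually_analyticAt, (tendsto_nhds_zero h.analytic h.map_zero).eventually
    hN.eventually_analyticAt, F.potential] with p hrel hmet hinj hcon hψ hN hpot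
  have hcov : ∀ z u v w, covC F.metric F.mul F.conn p z u v w =
      flatForm (fderiv ℂ N (ψ p) (fderiv ℂ ψ p z) (fderiv ℂ ψ p u) (fderiv ℂ ψ p v))
        (fderiv ℂ ψ p w) := by
    intro z u v w
    have ht : ∀ u v w, (fun q => tensorC F.metric F.mul q u v w) =ᶠ[𝓝 p]
        fun q => flatForm (N (ψ q) (fderiv ℂ ψ q u) (fderiv ℂ ψ q v)) (fderiv ℂ ψ q w) := by
      intro u v w
      filter_upwards [hrel, hmet] with q h1 h2
      rw [tensorC, h2, h1]
    have hdw : DifferentiableAt ℂ (fun q => fderiv ℂ ψ q w) p :=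
      hψ.fderiv.differentiableAt.clm_apply (differentiableAt_const w)
    have hdn : DifferentiableAt ℂ (fun q => N (ψ q) (fderiv ℂ ψ q u) (fderiv ℂ ψ q v)) p :=
      ((hN.differentiableAt.comp p hψ.differentiableAt).clm_apply
        (hψ.fderiv.differentiableAt.clm_apply (differentiableAt_const u))).clm_apply
        (hψ.fderiv.differentiableAt.clm_apply (differentiableAt_const v))
    have hd2 := ((flatForm.hasFDerivAt.comp p hdn.hasFDerivAt).clm_apply hdw.hasFDerivAt)
    have hd2' : HasFDerivAt (fun q => flatForm (N (ψ q) (fderiv ℂ ψ q u) (fderiv ℂ ψ q v))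
      (fderiv ℂ ψ q w)) _ p := hd2
    have hw : fderiv ℂ (fun q => fderiv ℂ ψ q w) p z = fderiv ℂ (fderiv ℂ ψ) p z w := by
      rw [fderiv_clm_apply_const hψ.fderiv.differentiableAt (differentiableAt_const w)]
      simp
    have ht0 : ∀ u v w, tensorC F.metric F.mul p u v w =
        flatForm (N (ψ p) (fderiv ℂ ψ p u) (fderiv ℂ ψ p v)) (fderiv ℂ ψ p w) :=
      fun u v w => (ht u v w).self_of_nhds
    rw [covC, (ht u v w).fderiv_eq, hd2'.fderiv, ht0, ht0, ht0]
    simp only [_root_.add_apply, ContinuousLinearMap.comp_apply, Function.comp_apply,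
      ContinuousLinearMap.flip_apply, fderiv_transported hψ hN, hw, hcon, map_add]
    ring
  intro z u v w
  have hsurj := surjective_of_injective hinj
  obtain ⟨z, rfl⟩ := hsurj z
  obtain ⟨u, rfl⟩ := hsurj u
  obtain ⟨v, rfl⟩ := hsurj v
  obtain ⟨w, rfl⟩ := hsurj w
  rw [← hcov, ← hcov]
  exact (hpot z u v w).1

/-- In a flat chart the Euler field is affine and rescales the product and the metric. -/
theorem IsChart.exists_euler (h : F.IsChart ψ) {N : ProductField} (hN : AnalyticAt ℂ N 0)
    (hrel : ∀ᶠ p in 𝓝 0, ∀ u v, fderiv ℂ ψ p (F.mul p u v) =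
      N (ψ p) (fderiv ℂ ψ p u) (fderiv ℂ ψ p v)) :
    ∃ (B : C3 →L[ℂ] C3) (β : C3) (k d : ℂ),
      (∀ᶠ p in 𝓝 0, ∀ u v, fderiv ℂ N p (B p + β) u v - B (N p u v) + N p (B u) v + N p u (B v) =
        k • N p u v) ∧
      (∀ u v, flatForm (B u) v + flatForm u (B v) = d * flatForm u v) ∧
      ∃ᶠ p in 𝓝 0, LinearIndependent ℂ ![![1, 0, 0], B p + β] := by
  obtain ⟨φ, hφ, hφ0, hl, hr⟩ := exists_analytic_localInverse h.analytic h.map_zero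
    h.injective.self_of_nhds
  obtain ⟨E, hEdef⟩ : ∃ E : C3 → C3, E = fun q => fderiv ℂ ψ (φ q) (F.euler (φ q)) := ⟨_, rfl⟩
  have hE : AnalyticAt ℂ E 0 := by
    rw [hEdef]
    have h1 : AnalyticAt ℂ (fun q => fderiv ℂ ψ (φ q)) 0 :=
      AnalyticAt.comp (g := fderiv ℂ ψ) (by rw [hφ0]; exact h.analytic.fderiv) hφ
    have h2 : AnalyticAt ℂ (fun q => F.euler (φ q)) 0 :=
      AnalyticAt.comp (by rw [hφ0]; exact F.analytic_euler) hφ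
    exact analyticAt_clm_apply h1 h2
  have hEψ : ∀ᶠ p in 𝓝 0, E (ψ p) = fderiv ℂ ψ p (F.euler p) := by
    filter_upwards [hl] with p hp
    simp only [hEdef, hp]
  have htends := tendsto_nhds_zero h.analytic h.map_zero
  have hDE : ∀ᶠ p in 𝓝 0, ∀ z, fderiv ℂ E (ψ p) (fderiv ℂ ψ p z) =
      fderiv ℂ ψ p (covVec F.conn F.euler p z) := by
    filter_upwards [hEψ.eventually_nhds, h.fderiv_fderiv, h.analytic.eventually_analyticAt,
      F.analytic_euler.eventually_analyticAt, htends.eventually hE.eventually_analyticAt]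
      with p h1 h2 h3 h4 h5 z
    rw [← fderiv_pushforward h3 h2 h4.differentiableAt]
    have h6 : (fun q => E (ψ q)) =ᶠ[𝓝 p] fun q => fderiv ℂ ψ q (F.euler q) := h1
    rw [← h6.fderiv_eq]
    have h7 : HasFDerivAt (fun q => E (ψ q)) _ p :=
      h5.differentiableAt.hasFDerivAt.comp p h3.differentiableAt.hasFDerivAt
    rw [h7.fderiv]; rfl
  -- This is `∇ (∇ E) = 0` read in flat coordinates, by differentiating `hDE` once more.
  have hD2 : ∀ᶠ p in 𝓝 0, fderiv ℂ (fderiv ℂ E) p = 0 := by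
    rw [← h.map_nhds, eventually_map]
    filter_upwards [hDE.eventually_nhds, h.fderiv_fderiv, h.injective,
      h.analytic.eventually_analyticAt, F.analytic_euler.eventually_analyticAt,
      F.analytic_conn.eventually_analyticAt,
      htends.eventually hE.eventually_analyticAt, F.euler_linear] with p h1 h2 hinj h3 h4 hcn h5 h6
    have hsurj := surjective_of_injective hinj
    ext1 z; ext1 u
    obtain ⟨z, rfl⟩ := hsurj z
    obtain ⟨u, rfl⟩ := hsurj u
    have hT : DifferentiableAt ℂ (covVec F.conn F.euler) p :=
      h4.fderiv.differentiableAt.add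
        ((differentiableAt_clm_flip hcn.differentiableAt).clm_apply h4.differentiableAt)
    have e1 : (fun q => fderiv ℂ E (ψ q) (fderiv ℂ ψ q u)) =ᶠ[𝓝 p]
      fun q => fderiv ℂ ψ q (covVec F.conn F.euler q u) := h1.mono fun q hq => hq u
    have e2 := congrArg (fun L : C3 →L[ℂ] C3 => L z) (e1.fderiv_eq (𝕜 := ℂ))
    have hdu : DifferentiableAt ℂ (fun q => fderiv ℂ ψ q u) p :=
      h3.fderiv.differentiableAt.clm_apply (differentiableAt_const u)
    have hTu : DifferentiableAt ℂ (fun q => covVec F.conn F.euler q u) p :=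
      hT.clm_apply (differentiableAt_const u)
    have hcomp : HasFDerivAt (fun q => fderiv ℂ E (ψ q)) _ p :=
      h5.fderiv.differentiableAt.hasFDerivAt.comp p h3.differentiableAt.hasFDerivAt
    rw [fderiv_clm_apply_const hcomp.differentiableAt hdu,
      fderiv_clm_apply_const h3.fderiv.differentiableAt hTu, hcomp.fderiv,
      fderiv_clm_apply_const h3.fderiv.differentiableAt (differentiableAt_const u),
      fderiv_clm_apply_const hT (differentiableAt_const u)] at e2
    have h1p := h1.self_of_nhds
    have h6' := h6 z u
    rw [covEnd] at h6'
    have h7 := congrArg (fderiv ℂ ψ p) h6'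
    rw [map_sub, map_add, _root_.map_zero] at h7
    simp [h2, h1p] at e2
    simp only [_root_.zero_apply]
    rw [← h7]
    linear_combination (exp := 1) e2
  have hD1 : ∀ᶠ p in 𝓝 0, fderiv ℂ E p = fderiv ℂ E 0 :=
    eventually_eq_of_fderiv_eq_zero
      (hE.eventually_analyticAt.mono fun p hp => hp.fderiv.differentiableAt) hD2
  have hEB : ∀ᶠ p in 𝓝 0, E p = fderiv ℂ E 0 p + E 0 := by
    have := eventually_eq_of_fderiv_eq_zero (f := fun p => E p - fderiv ℂ E 0 p)
      (hE.eventually_analyticAt.mono fun p hp =>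
        hp.differentiableAt.sub (fderiv ℂ E 0).differentiableAt) (by
        filter_upwards [hD1, hE.eventually_analyticAt] with p h1 h2
        rw [fderiv_fun_sub h2.differentiableAt (fderiv ℂ E 0).differentiableAt, h1,
          ContinuousLinearMap.fderiv, sub_self])
    filter_upwards [this] with p hp
    rw [_root_.map_zero, sub_zero] at hp
    rw [← hp]; abel
  obtain ⟨k, hk⟩ := F.euler_mul
  obtain ⟨d, hd⟩ := F.euler_metric
  refine ⟨fderiv ℂ E 0, E 0, k, d, ?_, ?_, ?_⟩
  -- Naturality of the Lie derivative: the terms with the connection cancel because it is torsion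
  -- free.
  · have : ∀ᶠ p in 𝓝 0, ∀ u v, lieMul E N p u v = k • N p u v := by
      rw [← h.map_nhds, eventually_map]
      filter_upwards [hrel.eventually_nhds, h.fderiv_fderiv, h.injective,
        h.analytic.eventually_analyticAt, F.analytic_mul.eventually_analyticAt,
        htends.eventually hN.eventually_analyticAt, hDE, hEψ, hk, F.leviCivita.1]
        with p h1 h2 hinj h3 h4 h5 h6 h7 h8 h9 u v
      have hsurj := surjective_of_injective hinj
      obtain ⟨u, rfl⟩ := hsurj u
      obtain ⟨v, rfl⟩ := hsurj v
      have e1 : (fun q => fderiv ℂ ψ q (F.mul q u v)) =ᶠ[𝓝 p]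
        fun q => N (ψ q) (fderiv ℂ ψ q u) (fderiv ℂ ψ q v) := h1.mono fun q hq => hq u v
      have e2 := congrArg (fun L : C3 →L[ℂ] C3 => L (F.euler p)) (e1.fderiv_eq (𝕜 := ℂ))
      have hmu : DifferentiableAt ℂ (fun q => F.mul q u) p :=
        h4.differentiableAt.clm_apply (differentiableAt_const u)
      have hmuv : DifferentiableAt ℂ (fun q => F.mul q u v) p :=
        hmu.clm_apply (differentiableAt_const v)
      rw [fderiv_transported h3 h5, fderiv_clm_apply_const h3.fderiv.differentiableAt hmuv,
        fderiv_clm_apply_const hmu (differentiableAt_const v),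
        fderiv_clm_apply_const h4.differentiableAt (differentiableAt_const u)] at e2
      have h1p := h1.self_of_nhds
      have h8' := congrArg (fderiv ℂ ψ p) (h8 u v)
      simp only [lieMul, map_add, map_sub, map_smul, h1p] at h8'
      simp [h2] at e2
      rw [lieMul, h7, h6, h6, ← h1p, h6]
      simp only [covVec, _root_.add_apply, ContinuousLinearMap.flip_apply, map_add, h1p]
      rw [← h8', h9 u, h9 v, h9 (F.mul p u v)]
      linear_combination (exp := 1) -e2
    filter_upwards [this, hD1, hEB] with p h1 h2 h3 u v
    rw [← h1, lieMul, h2, h3]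
  · have hinj := h.injective.self_of_nhds
    have hsurj := surjective_of_injective hinj
    intro u v
    obtain ⟨u, rfl⟩ := hsurj u
    obtain ⟨v, rfl⟩ := hsurj v
    have h1 := hDE.self_of_nhds
    rw [h.map_zero] at h1
    have hm := h.metric.self_of_nhds
    rw [h1, h1, ← hm, ← hm, ← hm, ← hd.self_of_nhds, lieMetric, F.leviCivita.2.self_of_nhds]
    have hs := F.leviCivita.1.self_of_nhds
    simp only [covVec, _root_.add_apply, ContinuousLinearMap.flip_apply, map_add]
    rw [hs u, hs v]
    ring
  · have : ∃ᶠ p in 𝓝 0, LinearIndependent ℂ ![![1, 0, 0], E p] := by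
      rw [← h.map_nhds, frequently_map]
      refine (F.euler_nontrivial.and_eventually (h.injective.and (h.unit.and hEψ))).mono ?_
      rintro p ⟨hli, hinj, hu, hE⟩
      rw [hE, ← hu]
      rw [LinearIndependent.pair_iff] at hli ⊢
      intro s t hst
      refine hli s t (hinj ?_)
      rw [map_add, map_smul, map_smul, hst, _root_.map_zero]
    exact (this.and_eventually hEB).mono fun p hp => by rw [← hp.2]; exact hp.1

/-- The homogeneity equations of the coefficients for the planar part
`(w₁ x + β₁) ∂_x + (w₂ y + s x + β₂) ∂_y` of an Euler field. -/
structure _root_.IsHomogeneous (a b c : C3 → ℂ) (w₁ w₂ s β₁ β₂ : ℂ) : Prop where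
  nontrivial : ¬ (w₁ = 0 ∧ w₂ = 0 ∧ s = 0 ∧ β₁ = 0 ∧ β₂ = 0)
  eq_a : ∀ᶠ p in 𝓝 0, (w₁ * p 1 + β₁) * pd 1 a p + (w₂ * p 2 + s * p 1 + β₂) * pd 2 a p =
    (w₂ - w₁) * a p + 3 * s
  eq_b : ∀ᶠ p in 𝓝 0, (w₁ * p 1 + β₁) * pd 1 b p + (w₂ * p 2 + s * p 1 + β₂) * pd 2 b p =
    2 * (w₂ - w₁) * b p - s * a p
  eq_c : ∀ᶠ p in 𝓝 0, (w₁ * p 1 + β₁) * pd 1 c p + (w₂ * p 2 + s * p 1 + β₂) * pd 2 c p =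
    3 * (w₂ - w₁) * c p - 2 * s * b p

theorem IsChart.exists_isPotential (h : F.IsChart ψ) : ∃ (a b c : C3 → ℂ) (w₁ w₂ s β₁ β₂ : ℂ),
    IsPotential a b c ∧ IsHomogeneous a b c w₁ w₂ s β₁ β₂ ∧
    ∀ᶠ p in 𝓝 0, ∀ u v, fderiv ℂ ψ p (F.mul p u v) =
      frobMul (a (ψ p)) (b (ψ p)) (c (ψ p)) (fderiv ℂ ψ p u) (fderiv ℂ ψ p v) := by
  obtain ⟨a, b, c, ha, hb, hc, hrel⟩ := h.exists_coefficients
  have hN := analyticAt_frobMul ha hb hc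
  have hsymm := h.symmetric hN hrel
  obtain ⟨B, β, k, d, hB1, hB2, hB3⟩ := h.exists_euler hN hrel
  have hda : ∀ᶠ p in 𝓝 0, DifferentiableAt ℂ a p ∧ DifferentiableAt ℂ b p ∧
      DifferentiableAt ℂ c p := by
    filter_upwards [ha.eventually_analyticAt, hb.eventually_analyticAt,
      hc.eventually_analyticAt] with p h1 h2 h3
    exact ⟨h1.differentiableAt, h2.differentiableAt, h3.differentiableAt⟩
  have hpot : ∀ᶠ p in 𝓝 0, pd 0 a p = 0 ∧ pd 0 b p = 0 ∧ pd 0 c p = 0 ∧ pd 1 a p = pd 2 b p ∧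
      pd 1 b p = pd 2 c p ∧ pd 1 c p = 2 * b p * pd 2 b p - pd 2 a p * c p - a p * pd 2 c p := by
    filter_upwards [hda, hsymm] with p ⟨h1, h2, h3⟩ hs
    have e0 := hs ![1, 0, 0] ![0, 0, 1] ![0, 0, 1] ![0, 0, 1]
    have e1 := hs ![1, 0, 0] ![0, 0, 1] ![0, 1, 0] ![0, 0, 1]
    have e2 := hs ![1, 0, 0] ![0, 1, 0] ![0, 0, 1] ![0, 1, 0]
    have e3 := hs ![0, 1, 0] ![0, 0, 1] ![0, 0, 1] ![0, 0, 1]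
    have e4 := hs ![0, 1, 0] ![0, 0, 1] ![0, 1, 0] ![0, 0, 1]
    have e5 := hs ![0, 1, 0] ![0, 0, 1] ![0, 1, 0] ![0, 1, 0]
    simp only [fderiv_frobMul h1 h2 h3, frobMulDeriv_apply, fderiv_eq_pd] at e0 e1 e2 e3 e4 e5
    simp at e0 e1 e2 e3 e4 e5
    exact ⟨e0, e1, e2, e3, e4, e5⟩
  -- The scaling of the product, evaluated on `e ∘ e = e`, says that `e` is an eigenvector of the
  -- linear part of `E`.
  have hBk : B ![1, 0, 0] = k • ![1, 0, 0] := by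
    have h1 := hB1.self_of_nhds ![1, 0, 0] ![1, 0, 0]
    obtain ⟨d1, d2, d3⟩ := hda.self_of_nhds
    rw [fderiv_frobMul d1 d2 d3, frobMul_comm _ _ _ (B _), frobMul_unit, frobMul_unit] at h1
    rw [← h1]
    ext i; fin_cases i <;> simp [frobMulDeriv_apply]
  have b00 := congrFun hBk 0
  have b10 := congrFun hBk 1
  have b20 := congrFun hBk 2
  -- The linear part of `E` is conformal for the metric; fixing the line of `e`, it has only the
  -- parameters `w₁`, `w₂` and the shear `s`.
  have g02 := hB2 ![1, 0, 0] ![0, 0, 1]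
  have g01 := hB2 ![1, 0, 0] ![0, 1, 0]
  have g11 := hB2 ![0, 1, 0] ![0, 1, 0]
  have g12 := hB2 ![0, 1, 0] ![0, 0, 1]
  have g22 := hB2 ![0, 0, 1] ![0, 0, 1]
  rw [hBk] at g02 g01
  simp at g02 g01 g11 g12 g22
  obtain ⟨w₁, hw1⟩ : ∃ w, w = B ![0, 1, 0] 1 := ⟨_, rfl⟩
  obtain ⟨w₂, hw2⟩ : ∃ w, w = B ![0, 0, 1] 2 := ⟨_, rfl⟩
  obtain ⟨s, hs⟩ : ∃ w, w = B ![0, 1, 0] 2 := ⟨_, rfl⟩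
  have hkw : k = 2 * w₂ - w₁ := by rw [hw1, hw2]; linear_combination g01 - g22
  have hBx : B ![0, 1, 0] = ![0, w₁, s] := by
    ext i; fin_cases i
    · simpa using g11
    · simp [hw1]
    · simp [hs]
  have hBy : B ![0, 0, 1] = ![-s, 0, w₂] := by
    ext i; fin_cases i
    · simp [hs]; linear_combination g12
    · simpa using g02
    · simp [hw2]
  have hBp : ∀ p : C3, B p = ![k * p 0 - s * p 2, w₁ * p 1, w₂ * p 2 + s * p 1] := by
    intro p
    have : p = p 0 • ![1, 0, 0] + p 1 • ![0, 1, 0] + p 2 • ![0, 0, 1] := by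
      ext i; fin_cases i <;> simp
    conv_lhs => rw [this]
    rw [map_add, map_add, map_smul, map_smul, map_smul, hBk, hBx, hBy]
    ext i; fin_cases i <;> simp <;> ring
  have heq : ∀ᶠ p in 𝓝 0,
      ((w₁ * p 1 + β 1) * pd 1 a p + (w₂ * p 2 + s * p 1 + β 2) * pd 2 a p =
        (w₂ - w₁) * a p + 3 * s) ∧
      ((w₁ * p 1 + β 1) * pd 1 b p + (w₂ * p 2 + s * p 1 + β 2) * pd 2 b p =
        2 * (w₂ - w₁) * b p - s * a p) ∧
      ((w₁ * p 1 + β 1) * pd 1 c p + (w₂ * p 2 + s * p 1 + β 2) * pd 2 c p =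
        3 * (w₂ - w₁) * c p - 2 * s * b p) := by
    filter_upwards [hB1, hda, hpot] with p h1 ⟨d1, d2, d3⟩ ⟨p1, p2, p3, _⟩
    have e1 := congrFun (h1 ![0, 0, 1] ![0, 0, 1]) 2
    have e2 := congrFun (h1 ![0, 0, 1] ![0, 0, 1]) 0
    have e3 := congrFun (h1 ![0, 1, 0] ![0, 0, 1]) 0
    simp only [fderiv_frobMul d1 d2 d3, frobMulDeriv_apply, fderiv_eq_pd, p1, p2, p3, hBx, hBy,
      frobMul_apply, hBp] at e1 e2 e3
    simp at e1 e2 e3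
    rw [hkw] at e1 e2 e3
    refine ⟨?_, ?_, ?_⟩
    · linear_combination e1
    · linear_combination e2
    · linear_combination e3
  refine ⟨a, b, c, w₁, w₂, s, β 1, β 2, ⟨ha, hb, hc, ?_, ?_, ?_, ?_, ?_, ?_⟩, ⟨?_, ?_, ?_, ?_⟩, hrel⟩
  · exact hpot.mono fun p hp => hp.1
  · exact hpot.mono fun p hp => hp.2.1
  · exact hpot.mono fun p hp => hp.2.2.1
  · exact hpot.mono fun p hp => hp.2.2.2.1
  · exact hpot.mono fun p hp => hp.2.2.2.2.1
  · exact hpot.mono fun p hp => hp.2.2.2.2.2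
  -- With zero planar part, `E` would be everywhere a multiple of `e`.
  · rintro ⟨rfl, rfl, rfl, h1, h2⟩
    obtain ⟨p, hp⟩ := hB3.exists
    rw [LinearIndependent.pair_iff] at hp
    have := hp (B p 0 + β 0) (-1) (by
      rw [hBp]
      ext i
      rw [Pi.add_apply, Pi.smul_apply, Pi.smul_apply, Pi.add_apply]
      fin_cases i <;> simp [h1, h2])
    simp at this
  · exact heq.mono fun p hp => hp.1
  · exact heq.mono fun p hp => hp.2.1
  · exact heq.mono fun p hp => hp.2.2

end FrobeniusGerm

end

/-! ### Comparison of a given web with the booklet cubic -/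

noncomputable section

/-- The coefficients of the binary cubic form obtained from the booklet cubic by the substitution
`V 1 = p v₀ + q v₁`, `V 2 = s v₀ + t v₁`; the coefficient of `v₀ ^ 3`. -/
def pullbackCoeff₀ (a b c p _q s _t : ℂ) : ℂ :=
  s ^ 3 - a * s ^ 2 * p - 2 * b * s * p ^ 2 - c * p ^ 3

/-- The coefficient of `v₁ v₀ ^ 2`. -/
def pullbackCoeff₁ (a b c p q s t : ℂ) : ℂ :=
  3 * s ^ 2 * t - a * (s ^ 2 * q + 2 * s * t * p) - 2 * b * (2 * s * p * q + t * p ^ 2) -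
    3 * c * p ^ 2 * q

/-- The coefficient of `v₁ ^ 2 v₀`. -/
def pullbackCoeff₂ (a b c p q s t : ℂ) : ℂ :=
  3 * s * t ^ 2 - a * (2 * s * t * q + t ^ 2 * p) - 2 * b * (s * q ^ 2 + 2 * t * p * q) -
    3 * c * p * q ^ 2

/-- The coefficient of `v₁ ^ 3`. -/
def pullbackCoeff₃ (a b c _p q _s t : ℂ) : ℂ :=
  t ^ 3 - a * t ^ 2 * q - 2 * b * t * q ^ 2 - c * q ^ 3

theorem bookletCubic_eq_pullback (a b c p q s t v₀ v₁ : ℂ) (V : C3) (h1 : V 1 = p * v₀ + q * v₁)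
    (h2 : V 2 = s * v₀ + t * v₁) : bookletCubic a b c V =
      pullbackCoeff₀ a b c p q s t * v₀ ^ 3 + pullbackCoeff₁ a b c p q s t * v₁ * v₀ ^ 2 +
      pullbackCoeff₂ a b c p q s t * v₁ ^ 2 * v₀ + pullbackCoeff₃ a b c p q s t * v₁ ^ 3 := by
  rw [bookletCubic, h1, h2, pullbackCoeff₀, pullbackCoeff₁, pullbackCoeff₂, pullbackCoeff₃]
  ring

theorem quadratic_eq_zero {A B C x y z : ℂ} (hxy : x ≠ y) (hxz : x ≠ z) (hyz : y ≠ z)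
    (hx : A * x ^ 2 + B * x + C = 0) (hy : A * y ^ 2 + B * y + C = 0)
    (hz : A * z ^ 2 + B * z + C = 0) : A = 0 ∧ B = 0 ∧ C = 0 := by
  have h1 : A * (x + y) + B = 0 := by
    apply mul_left_cancel₀ (sub_ne_zero.2 hxy); linear_combination hx - hy
  have h2 : A * (x + z) + B = 0 := by
    apply mul_left_cancel₀ (sub_ne_zero.2 hxz); linear_combination hx - hz
  have hA : A = 0 := by
    apply mul_left_cancel₀ (sub_ne_zero.2 hyz); linear_combination h1 - h2
  subst hA
  have hB : B = 0 := by linear_combination h1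
  subst hB
  exact ⟨rfl, rfl, by linear_combination hx⟩

/-- A binary cubic form without multiple roots is determined by its roots up to a factor. -/
theorem pullbackCoeff_eq {a b c p q s t α β : ℂ} (hd : bookletDiscr a b c ≠ 0)
    (hJ : p * t - q * s ≠ 0)
    (h : ∀ v₀ v₁ : ℂ, ¬(v₀ = 0 ∧ v₁ = 0) →
      bookletCubic a b c ![0, p * v₀ + q * v₁, s * v₀ + t * v₁] = 0 →
      v₁ ^ 3 + α * v₁ * v₀ ^ 2 + β * v₀ ^ 3 = 0) :
    pullbackCoeff₂ a b c p q s t = 0 ∧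
    pullbackCoeff₁ a b c p q s t - pullbackCoeff₃ a b c p q s t * α = 0 ∧
    pullbackCoeff₀ a b c p q s t - pullbackCoeff₃ a b c p q s t * β = 0 := by
  obtain ⟨l, hl⟩ := exists_isRootTriple a b c
  -- The line of slope `x` pulls back to a direction `(v₀, v₁)`. The normal form is monic in `v₁`,
  -- so `v₀ ≠ 0` and the slope `m = v₁ / v₀` is a common root of both cubics. Subtracting
  -- `pullbackCoeff₃` times the normal form leaves a polynomial of degree at most 2 in `m`.
  have hroot : ∀ x ∈ ({l 0, l 1, l 2} : Set ℂ), ∃ m : ℂ, ∃ v₀ : ℂ, v₀ ≠ 0 ∧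
      p * v₀ + q * (m * v₀) = 1 ∧ s * v₀ + t * (m * v₀) = x ∧
      m ^ 3 + α * m + β = 0 ∧
      pullbackCoeff₂ a b c p q s t * m ^ 2 +
      (pullbackCoeff₁ a b c p q s t - pullbackCoeff₃ a b c p q s t * α) * m +
      (pullbackCoeff₀ a b c p q s t - pullbackCoeff₃ a b c p q s t * β) = 0 := by
    intro x hx
    obtain ⟨v₀, v₁, e1, e2⟩ : ∃ v₀ v₁ : ℂ, p * v₀ + q * v₁ = 1 ∧ s * v₀ + t * v₁ = x := by
      refine ⟨(t - q * x) / (p * t - q * s), (p * x - s) / (p * t - q * s), ?_, ?_⟩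
      · rw [mul_div_assoc', mul_div_assoc', ← add_div, div_eq_one_iff_eq hJ]; ring
      · rw [mul_div_assoc', mul_div_assoc', ← add_div, div_eq_iff hJ]; ring
    have hv : ¬(v₀ = 0 ∧ v₁ = 0) := by
      rintro ⟨rfl, rfl⟩; simp at e1
    have hR : bookletCubic a b c ![0, p * v₀ + q * v₁, s * v₀ + t * v₁] = 0 := by
      rw [hl.cubic_eq, e1, e2]
      rcases hx with rfl | rfl | rfl <;> simp
    have hP := h v₀ v₁ hv hR
    have hv0 : v₀ ≠ 0 := by
      rintro rfl
      exact hv ⟨rfl, by simpa using hP⟩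
    rw [bookletCubic_eq_pullback a b c p q s t v₀ v₁ _ rfl rfl] at hR
    have hm : v₁ = v₁ / v₀ * v₀ := by field_simp
    generalize v₁ / v₀ = m at hm
    subst hm
    refine ⟨m, v₀, hv0, e1, e2, ?_, ?_⟩
    · apply mul_left_cancel₀ (pow_ne_zero 3 hv0); linear_combination hP
    · apply mul_left_cancel₀ (pow_ne_zero 3 hv0)
      linear_combination hR - pullbackCoeff₃ a b c p q s t * hP
  rw [hl.discr_eq] at hd
  obtain ⟨m0, x0, -, a0, b0, -, c0⟩ := hroot (l 0) (by simp)
  obtain ⟨m1, x1, -, a1, b1, -, c1⟩ := hroot (l 1) (by simp)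
  obtain ⟨m2, x2, -, a2, b2, -, c2⟩ := hroot (l 2) (by simp)
  -- A slope `m` comes from one root only, so the three distinct roots give three distinct zeros of
  -- the quadratic, which must vanish.
  have hne : ∀ m x x' y y' : ℂ, p * x + q * (m * x) = 1 → s * x + t * (m * x) = y →
      p * x' + q * (m * x') = 1 → s * x' + t * (m * x') = y' → y = y' := by
    intro m x x' y y' h1 h2 h3 h4
    have hpm : p + q * m ≠ 0 := by
      intro h0
      have : x * (p + q * m) = 1 := by linear_combination h1
      rw [h0] at this; simp at this
    have : x = x' := by
      apply mul_right_cancel₀ hpm; linear_combination h1 - h3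
    rw [← h2, ← h4, this]
  refine quadratic_eq_zero ?_ ?_ ?_ c0 c1 c2
  · rintro rfl
    rw [hne _ _ _ _ _ a0 b0 a1 b1] at hd; simp at hd
  · rintro rfl
    rw [hne _ _ _ _ _ a0 b0 a2 b2] at hd; simp at hd
  · rintro rfl
    rw [hne _ _ _ _ _ a1 b1 a2 b2] at hd; simp at hd

/-- If the product of two germs of functions vanishes and the first one is analytic and not zero,
then the second one, if analytic, is zero. -/
theorem eventually_eq_zero_of_imp {E : Type*} [NormedAddCommGroup E] [NormedSpace ℂ E]
    {f g : E → ℂ} (hf : AnalyticAt ℂ f 0) (hg : AnalyticAt ℂ g 0)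
    (hne : ∃ᶠ p in 𝓝 0, f p ≠ 0) (h : ∀ᶠ p in 𝓝 0, f p ≠ 0 → g p = 0) :
    ∀ᶠ p in 𝓝 0, g p = 0 := by
  obtain ⟨r, hr, H⟩ := Metric.eventually_nhds_iff_ball.1
    ((hf.eventually_analyticAt.and hg.eventually_analyticAt).and h)
  obtain ⟨x, hx1, hx⟩ := (hne.and_eventually (Metric.ball_mem_nhds (0 : E) hr)).exists
  have hfx' : ∀ᶠ y in 𝓝 x, f y ≠ 0 :=
    (H x hx).1.1.continuousAt.eventually_ne hx1
  have hg0 : g =ᶠ[𝓝 x] 0 := by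
    filter_upwards [hfx', Metric.isOpen_ball.mem_nhds hx] with y hy hyb
    exact (H y hyb).2 hy
  have := AnalyticOnNhd.eqOn_zero_of_preconnected_of_eventuallyEq_zero (U := Metric.ball (0 : E) r)
    (fun y hy => (H y hy).1.2) (convex_ball (0 : E) r).isPreconnected hx hg0
  exact Metric.eventually_nhds_iff_ball.2 ⟨r, hr, fun y hy => this hy⟩

theorem tendsto_planar : Tendsto (fun p : C3 => (![p 1, p 2] : C2)) (𝓝 0) (𝓝 0) := by
  have : Continuous fun p : C3 => (![p 1, p 2] : C2) := by
    refine continuous_pi fun i => ?_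
    fin_cases i <;> simp <;> fun_prop
  have h2 := this.tendsto 0
  have h3 : (![(0 : C3) 1, (0 : C3) 2] : C2) = 0 := by ext i; fin_cases i <;> rfl
  rwa [h3] at h2

/-- The segment joining two points with equal `x` and `y` stays in the convex ball, and `f` has zero
derivative along it. Thus values of `a`, `b`, `c` off the surface equal values on it. -/
theorem exists_ball_eq_of_pd_zero {f : C3 → ℂ} (hf : AnalyticAt ℂ f 0)
    (h : ∀ᶠ p in 𝓝 0, pd 0 f p = 0) : ∃ r > 0, ∀ p ∈ Metric.ball (0 : C3) r,
      ∀ p' ∈ Metric.ball (0 : C3) r, p 1 = p' 1 → p 2 = p' 2 → f p = f p' := by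
  obtain ⟨r, hr, H⟩ := Metric.eventually_nhds_iff_ball.1 (hf.eventually_analyticAt.and h)
  refine ⟨r, hr, fun p hp p' hp' h1 h2 => ?_⟩
  have hu : p' - p = Pi.single 0 (p' 0 - p 0) := by
    ext i; fin_cases i <;> simp [h1, h2]
  have hseg : ∀ s ∈ Set.Icc (0 : ℝ) 1, p + (s : ℂ) • (p' - p) ∈ Metric.ball (0 : C3) r := by
    intro s hs
    have := (convex_ball (0 : C3) r).add_smul_sub_mem hp hp' hs
    have e : (s : ℂ) • (p' - p) = s • (p' - p) := by ext i; simp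
    rwa [e]
  have hder : ∀ s ∈ Set.Icc (0 : ℝ) 1,
      HasDerivAt (fun s : ℝ => f (p + (s : ℂ) • (p' - p))) 0 s := by
    intro s hs
    have hq := H _ (hseg s hs)
    have h3 : HasDerivAt (fun s : ℝ => p + (s : ℂ) • (p' - p)) (p' - p) s := by
      have := ((Complex.ofRealCLM.hasDerivAt (x := s)).smul_const (p' - p)).const_add p
      simpa using this
    have h4 : HasDerivAt (fun s : ℝ => f (p + (s : ℂ) • (p' - p))) _ s :=
      (hq.1.differentiableAt.hasFDerivAt.restrictScalars ℝ).comp_hasDerivAt s h3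
    have h5 : fderiv ℂ f (p + (s : ℂ) • (p' - p)) (p' - p) = 0 := by
      have h6 := hq.2
      rw [pd] at h6
      have : (p' - p) = (p' 0 - p 0) • Pi.single 0 1 := by
        rw [hu]; ext i; fin_cases i <;> simp
      rw [this, map_smul, ← this, h6, smul_zero]
    exact h4.congr_deriv h5
  have hc := constant_of_has_deriv_right_zero (f := fun s : ℝ => f (p + (s : ℂ) • (p' - p)))
    (a := 0) (b := 1)
    (fun s hs => (hder s hs).continuousAt.continuousWithinAt)
    (fun s hs => (hder s ⟨hs.1, hs.2.le⟩).hasDerivWithinAt) 1 (by simp)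
  simpa using hc.symm

namespace FrobeniusGerm

variable {F : FrobeniusGerm} {ψ : C3 → C3}

theorem isIdempotentBasis_iff {p : C3} (hinj : Function.Injective (fderiv ℂ ψ p)) {a b c : ℂ}
    (hrel : ∀ u v, fderiv ℂ ψ p (F.mul p u v) = frobMul a b c (fderiv ℂ ψ p u) (fderiv ℂ ψ p v))
    (ε : Fin 3 → C3) : F.IsIdempotentBasis p ε ↔
      IsIdempotents (frobMul a b c) (fun i => fderiv ℂ ψ p (ε i)) := by
  have hli : LinearIndependent ℂ (fun i => fderiv ℂ ψ p (ε i)) ↔ LinearIndependent ℂ ε :=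
    LinearMap.linearIndependent_iff_of_injOn (fderiv ℂ ψ p : C3 →ₗ[ℂ] C3) hinj.injOn
  rw [IsIdempotentBasis, IsIdempotents, hli]
  refine and_congr_right fun _ => forall_congr' fun i => forall_congr' fun j => ?_
  rw [← hrel]
  constructor
  · intro h; rw [h]; split_ifs <;> simp
  · intro h
    apply hinj
    rw [h]; split_ifs <;> simp

theorem mem_span_pair_iff {p : C3} (hinj : Function.Injective (fderiv ℂ ψ p)) (x y v : C3) :
    v ∈ Submodule.span ℂ {x, y} ↔
      fderiv ℂ ψ p v ∈ Submodule.span ℂ {fderiv ℂ ψ p x, fderiv ℂ ψ p y} := by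
  simp only [Submodule.mem_span_pair, ← map_smul, ← map_add, hinj.eq_iff]


/-- The differential `(p q; s t)` of the planar part of a parametrized surface. -/
def _root_.surfEntry (τ : C2 → C3) (i : Fin 3) (j : Fin 2) (q : C2) : ℂ :=
  fderiv ℂ τ q (Pi.single j 1) i

theorem _root_.fderiv_surf (τ : C2 → C3) (i : Fin 3) (q v : C2) :
    fderiv ℂ τ q v i = surfEntry τ i 0 q * v 0 + surfEntry τ i 1 q * v 1 := by
  have : v = v 0 • Pi.single 0 1 + v 1 • Pi.single 1 1 := by
    ext l; fin_cases l <;> simp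
  conv_lhs => rw [this]
  simp [surfEntry]; ring

theorem _root_.analyticAt_surfEntry {τ : C2 → C3} (h : AnalyticAt ℂ τ 0) (i : Fin 3) (j : Fin 2) :
    AnalyticAt ℂ (surfEntry τ i j) 0 :=
  analyticAt_pi_iff.1 (analyticAt_clm_apply h.fderiv analyticAt_const) i

/-- The Jacobian of the projection of a parametrized surface to the `(x, y)`-plane. -/
def _root_.surfJac (τ : C2 → C3) (q : C2) : ℂ :=
  surfEntry τ 1 0 q * surfEntry τ 2 1 q - surfEntry τ 1 1 q * surfEntry τ 2 0 q

/-- The union of the `t`-lines through a surface. -/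
def _root_.ruled (τ : C2 → C3) (p : C3) : C3 := τ ![p 1, p 2] + ![p 0, 0, 0]

/-- The `t`-lines through a transverse surface fill a neighbourhood of the origin, so a property of
functions independent of `t` may be checked on the surface alone. -/
theorem _root_.map_ruled {τ : C2 → C3} (h : AnalyticAt ℂ τ 0) (h0 : τ 0 = 0)
    (hJ : surfJac τ 0 ≠ 0) : map (ruled τ) (𝓝 0) = 𝓝 0 := by
  let π : C3 →L[ℂ] C2 := ContinuousLinearMap.pi
    ![(ContinuousLinearMap.proj 1 : C3 →L[ℂ] ℂ), ContinuousLinearMap.proj 2]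
  let ι : C3 →L[ℂ] C3 := (ContinuousLinearMap.proj 0 : C3 →L[ℂ] ℂ).smulRight ![1, 0, 0]
  have hr : ruled τ = fun p => τ (π p) + ι p := by
    funext p
    have e1 : π p = ![p 1, p 2] := by ext i; fin_cases i <;> simp [π]
    have e2 : ι p = ![p 0, 0, 0] := by ext i; fin_cases i <;> simp [ι]
    rw [ruled, e1, e2]
  have hτπ : AnalyticAt ℂ τ (π 0) := by rwa [map_zero]
  have ha : AnalyticAt ℂ (ruled τ) 0 := by
    rw [hr]
    exact (hτπ.comp (π.analyticAt 0)).add (ι.analyticAt 0)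
  refine map_nhds_zero ha (by rw [hr]; simp [h0]) ?_
  have hd : ∀ u, fderiv ℂ (ruled τ) 0 u = fderiv ℂ τ 0 (π u) + ι u := by
    intro u
    have := (hτπ.differentiableAt.hasFDerivAt.comp 0 π.hasFDerivAt).add ι.hasFDerivAt
    have h' : HasFDerivAt (fun p => τ (π p) + ι p) _ 0 := this
    rw [hr, h'.fderiv]
    simp
  refine (injective_iff_map_eq_zero _).2 fun u hu => ?_
  rw [hd] at hu
  have h1 := congrFun hu 1
  have h2 := congrFun hu 2
  have h0' := congrFun hu 0
  simp [fderiv_surf, π, ι] at h1 h2 h0'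
  rw [surfJac] at hJ
  have u1 : u 1 = 0 := by
    apply mul_left_cancel₀ hJ
    linear_combination surfEntry τ 2 1 0 * h1 - surfEntry τ 1 1 0 * h2
  have u2 : u 2 = 0 := by
    apply mul_left_cancel₀ hJ
    linear_combination surfEntry τ 1 0 0 * h2 - surfEntry τ 2 0 0 * h1
  have u0 : u 0 = 0 := by simpa [u1, u2] using h0'
  ext i; fin_cases i <;> simp [u0, u1, u2]

/-- A direction killed by the projection along `∂_t` would be tangent both to the surface and to
`e`, against transversality. -/
theorem IsChart.surfJac_ne_zero (h : F.IsChart ψ) {σ : C2 → C3} (hσ : F.IsTransverseSurface σ) :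
    surfJac (ψ ∘ σ) 0 ≠ 0 := by
  obtain ⟨h1, h2, h3⟩ := hσ
  intro hJ
  have hψ : AnalyticAt ℂ ψ (σ 0) := by rw [h2]; exact h.analytic
  have hd : ∀ v, fderiv ℂ (ψ ∘ σ) 0 v = fderiv ℂ ψ 0 (fderiv ℂ σ 0 v) := by
    intro v
    rw [(hψ.differentiableAt.hasFDerivAt.comp 0 h1.differentiableAt.hasFDerivAt).fderiv, h2]
    rfl
  have key : ∀ v : C2, surfEntry (ψ ∘ σ) 1 0 0 * v 0 + surfEntry (ψ ∘ σ) 1 1 0 * v 1 = 0 →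
      surfEntry (ψ ∘ σ) 2 0 0 * v 0 + surfEntry (ψ ∘ σ) 2 1 0 * v 1 = 0 → v = 0 := by
    intro v e1 e2
    rw [← fderiv_surf] at e1 e2
    refine (h3 (-(fderiv ℂ (ψ ∘ σ) 0 v 0)) v (h.injective.self_of_nhds ?_)).2
    rw [map_add, map_smul, h.unit.self_of_nhds, ← hd, _root_.map_zero]
    ext i
    rw [Pi.add_apply, Pi.smul_apply]
    fin_cases i
    · simp
    · simpa using e1
    · simpa using e2
  rw [surfJac] at hJ
  -- If the determinant vanished, the vector orthogonal to each row would lie in the kernel and be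
  -- zero; both rows would vanish, and `(1, 0)` would lie in the kernel.
  have k1 := key ![-surfEntry (ψ ∘ σ) 1 1 0, surfEntry (ψ ∘ σ) 1 0 0] (by simp; ring)
    (by simp; linear_combination hJ)
  have k2 := key ![-surfEntry (ψ ∘ σ) 2 1 0, surfEntry (ψ ∘ σ) 2 0 0]
    (by simp; linear_combination -hJ) (by simp; ring)
  have k10 := congrFun k1 0
  have k11 := congrFun k1 1
  have k20 := congrFun k2 0
  have k21 := congrFun k2 1
  simp at k10 k11 k20 k21
  have k3 := key ![1, 0] (by simp [k11]) (by simp [k21])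
  simpa using congrFun k3 0

/-- The web of a flat chart is the pullback of the booklet cubic, up to a factor. -/
theorem IsChart.pullbackCoeff_eq (h : F.IsChart ψ) (hF : F.Massive) {a b c : C3 → ℂ}
    (hpot : IsPotential a b c)
    (hrel : ∀ᶠ p in 𝓝 0, ∀ u v, fderiv ℂ ψ p (F.mul p u v) =
      frobMul (a (ψ p)) (b (ψ p)) (c (ψ p)) (fderiv ℂ ψ p u) (fderiv ℂ ψ p v))
    {σ : C2 → C3} {P : C2 → C2 → ℂ} (hcut : F.CutsWeb σ P) {α β : C2 → ℂ}
    (hα : AnalyticAt ℂ α 0) (hβ : AnalyticAt ℂ β 0)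
    (hP : ∀ q v, P q v = v 1 ^ 3 + α q * v 1 * v 0 ^ 2 + β q * v 0 ^ 3)
    {τ : C2 → C3} (hτ : τ = ψ ∘ σ) {A B C p q s t : C2 → ℂ}
    (hA : A = a ∘ τ) (hB : B = b ∘ τ) (hC : C = c ∘ τ) (hp : p = surfEntry τ 1 0)
    (hq : q = surfEntry τ 1 1) (hs : s = surfEntry τ 2 0) (ht : t = surfEntry τ 2 1) :
    ∀ᶠ x in 𝓝 0,
      pullbackCoeff₂ (A x) (B x) (C x) (p x) (q x) (s x) (t x) = 0 ∧
      pullbackCoeff₁ (A x) (B x) (C x) (p x) (q x) (s x) (t x) =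
        pullbackCoeff₃ (A x) (B x) (C x) (p x) (q x) (s x) (t x) * α x ∧
      pullbackCoeff₀ (A x) (B x) (C x) (p x) (q x) (s x) (t x) =
        pullbackCoeff₃ (A x) (B x) (C x) (p x) (q x) (s x) (t x) * β x := by
  obtain ⟨hσt, hweb⟩ := hcut
  have hJ0 : surfJac τ 0 ≠ 0 := by rw [hτ]; exact h.surfJac_ne_zero hσt
  have hσ := hσt.1
  have hσ0 := hσt.2.1
  have hσt := tendsto_nhds_zero hσ hσ0
  have hτa : AnalyticAt ℂ τ 0 := by
    rw [hτ]; exact AnalyticAt.comp (by rw [hσ0]; exact h.analytic) hσ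
  have hτ0 : τ 0 = 0 := by simp [hτ, hσ0, h.map_zero]
  have aA : AnalyticAt ℂ A 0 := by
    rw [hA]; exact AnalyticAt.comp (by rw [hτ0]; exact hpot.analytic_a) hτa
  have aB : AnalyticAt ℂ B 0 := by
    rw [hB]; exact AnalyticAt.comp (by rw [hτ0]; exact hpot.analytic_b) hτa
  have aC : AnalyticAt ℂ C 0 := by
    rw [hC]; exact AnalyticAt.comp (by rw [hτ0]; exact hpot.analytic_c) hτa
  have ap : AnalyticAt ℂ p 0 := by rw [hp]; exact analyticAt_surfEntry hτa _ _
  have aq : AnalyticAt ℂ q 0 := by rw [hq]; exact analyticAt_surfEntry hτa _ _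
  have as : AnalyticAt ℂ s 0 := by rw [hs]; exact analyticAt_surfEntry hτa _ _
  have at' : AnalyticAt ℂ t 0 := by rw [ht]; exact analyticAt_surfEntry hτa _ _
  have hd : AnalyticAt ℂ (fun x => bookletDiscr (A x) (B x) (C x)) 0 := by
    unfold bookletDiscr; fun_prop
  -- Massiveness gives nonzero discriminant at points near the origin, possibly off the surface; as
  -- the discriminant does not depend on `t`, it cannot vanish identically on the surface.
  have hfreq : ∃ᶠ x in 𝓝 0, bookletDiscr (A x) (B x) (C x) ≠ 0 := by
    have h1 : ∃ᶠ p in 𝓝 0, bookletDiscr (a p) (b p) (c p) ≠ 0 := by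
      rw [← h.map_nhds, frequently_map]
      refine (hF.and_eventually (h.injective.and hrel)).mono ?_
      rintro p ⟨⟨ε, hε⟩, hinj, hr⟩
      exact ((isIdempotentBasis_iff hinj hr ε).1 hε).discr_ne_zero
    obtain ⟨r1, hr1, H1⟩ := exists_ball_eq_of_pd_zero hpot.analytic_a hpot.a_t
    obtain ⟨r2, hr2, H2⟩ := exists_ball_eq_of_pd_zero hpot.analytic_b hpot.b_t
    obtain ⟨r3, hr3, H3⟩ := exists_ball_eq_of_pd_zero hpot.analytic_c hpot.c_t
    by_contra hcon
    rw [not_frequently] at hcon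
    refine h1 ?_
    rw [← map_ruled hτa hτ0 hJ0, eventually_map]
    have hpr := tendsto_planar
    have hru : Tendsto (ruled τ) (𝓝 0) (𝓝 0) := (map_ruled hτa hτ0 hJ0).le
    have hb (r : ℝ) (hr : 0 < r) := (hru.eventually (Metric.ball_mem_nhds (0 : C3) hr)).and
      (((tendsto_nhds_zero hτa hτ0).comp hpr).eventually (Metric.ball_mem_nhds (0 : C3) hr))
    filter_upwards [hpr.eventually hcon, hb r1 hr1, hb r2 hr2, hb r3 hr3] with p hp b1 b2 b3
    have e1 : ruled τ p 1 = τ ![p 1, p 2] 1 := by simp [ruled]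
    have e2 : ruled τ p 2 = τ ![p 1, p 2] 2 := by simp [ruled]
    rw [not_not] at hp ⊢
    rw [H1 _ b1.1 _ b1.2 e1 e2, H2 _ b2.1 _ b2.2 e1 e2, H3 _ b3.1 _ b3.2 e1 e2]
    simpa [hA, hB, hC] using hp
  have hJ : ∀ᶠ x in 𝓝 0, surfJac τ x ≠ 0 := by
    have : AnalyticAt ℂ (surfJac τ) 0 :=
      ((analyticAt_surfEntry hτa 1 0).mul (analyticAt_surfEntry hτa 2 1)).sub
        ((analyticAt_surfEntry hτa 1 1).mul (analyticAt_surfEntry hτa 2 0))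
    exact this.continuousAt.eventually_ne hJ0
  have hdτ : ∀ᶠ x in 𝓝 0, ∀ v, fderiv ℂ τ x v = fderiv ℂ ψ (σ x) (fderiv ℂ σ x v) := by
    filter_upwards [hσ.eventually_analyticAt,
      hσt.eventually h.analytic.eventually_analyticAt] with x h1 h2 v
    rw [hτ, (h2.differentiableAt.hasFDerivAt.comp x h1.differentiableAt.hasFDerivAt).fderiv]
    rfl
  have key : ∀ᶠ x in 𝓝 0, bookletDiscr (A x) (B x) (C x) ≠ 0 →
      pullbackCoeff₂ (A x) (B x) (C x) (p x) (q x) (s x) (t x) = 0 ∧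
      pullbackCoeff₁ (A x) (B x) (C x) (p x) (q x) (s x) (t x) -
        pullbackCoeff₃ (A x) (B x) (C x) (p x) (q x) (s x) (t x) * α x = 0 ∧
      pullbackCoeff₀ (A x) (B x) (C x) (p x) (q x) (s x) (t x) -
        pullbackCoeff₃ (A x) (B x) (C x) (p x) (q x) (s x) (t x) * β x = 0 := by
    filter_upwards [hJ, hdτ, hweb, hσt.eventually hrel, hσt.eventually h.injective,
      hσt.eventually h.unit] with x hJ hdτ hweb hrel hinj hunit hdisc
    obtain ⟨l, hl⟩ := exists_isRootTriple (A x) (B x) (C x)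
    obtain ⟨ε', hε'⟩ := hl.exists_isIdempotents hdisc
    choose ε hε using fun i => surjective_of_injective hinj (ε' i)
    have hrel' : ∀ u v, fderiv ℂ ψ (σ x) (F.mul (σ x) u v) =
        frobMul (A x) (B x) (C x) (fderiv ℂ ψ (σ x) u) (fderiv ℂ ψ (σ x) v) := by
      simpa [hA, hB, hC, hτ] using hrel
    have hεF : F.IsIdempotentBasis (σ x) ε := by
      rw [isIdempotentBasis_iff hinj hrel']
      simpa [hε] using hε'
    have hiff : ∀ v : C2, v ≠ 0 →
        (P x v = 0 ↔ bookletCubic (A x) (B x) (C x) (fderiv ℂ τ x v) = 0) := by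
      intro v hv
      rw [hweb ε hεF v hv, hε'.cubic_eq_zero_iff]
      refine exists_congr fun i => ?_
      rw [mem_span_pair_iff hinj, hunit, hε, hdτ]
    refine _root_.pullbackCoeff_eq hdisc (by simpa [surfJac, hp, hq, hs, ht] using hJ) ?_
    intro v₀ v₁ hv hz
    have hv' : (![v₀, v₁] : C2) ≠ 0 := by
      intro h0
      exact hv ⟨by simpa using congrFun h0 0, by simpa using congrFun h0 1⟩
    have := (hiff _ hv').2 (by
      rw [← hz, bookletCubic, bookletCubic, fderiv_surf, fderiv_surf]
      simp [hp, hq, hs, ht])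
    rw [hP] at this
    simpa using this
  -- The identities hold where the discriminant is nonzero and extend to all points by analyticity.
  have k2 := eventually_eq_zero_of_imp hd
    (g := fun x => pullbackCoeff₂ (A x) (B x) (C x) (p x) (q x) (s x) (t x))
    (by unfold pullbackCoeff₂; fun_prop) hfreq (key.mono fun x hx h => (hx h).1)
  have k1 := eventually_eq_zero_of_imp hd
    (g := fun x => pullbackCoeff₁ (A x) (B x) (C x) (p x) (q x) (s x) (t x) -
        pullbackCoeff₃ (A x) (B x) (C x) (p x) (q x) (s x) (t x) * α x)
    (by unfold pullbackCoeff₁ pullbackCoeff₃; fun_prop) hfreq (key.mono fun x hx h => (hx h).2.1)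
  have k0 := eventually_eq_zero_of_imp hd
    (g := fun x => pullbackCoeff₀ (A x) (B x) (C x) (p x) (q x) (s x) (t x) -
        pullbackCoeff₃ (A x) (B x) (C x) (p x) (q x) (s x) (t x) * β x)
    (by unfold pullbackCoeff₀ pullbackCoeff₃; fun_prop) hfreq (key.mono fun x hx h => (hx h).2.2)
  filter_upwards [k2, k1, k0] with x h2 h1 h0
  exact ⟨h2, sub_eq_zero.1 h1, sub_eq_zero.1 h0⟩

end FrobeniusGerm

end

/-! ### Jets of the normal forms and adapted charts -/

noncomputable section

namespace EllipticForm

/-- The coefficient of `p` in the implicit cubic equation. -/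
def webLin : EllipticForm → C2 → ℂ
  | form2, q => 2 * q 0
  | form3, q => q 1 - 2 / 3 * q 0 ^ 2
  | form4, q => 4 * q 0 * (q 1 - 4 / 9 * q 0 ^ 3)

/-- The constant coefficient in the implicit cubic equation. -/
def webConst : EllipticForm → C2 → ℂ
  | form2, q => q 1
  | form3, q => -(2 / 3 * q 0 * (q 1 - 2 / 9 * q 0 ^ 2))
  | form4, q => q 1 ^ 2 + 64 / 81 * q 0 ^ 6 - 32 / 9 * q 1 * q 0 ^ 3

theorem web_eq_cubic (k : EllipticForm) (q v : C2) :
    k.web q v = v 1 ^ 3 + k.webLin q * v 1 * v 0 ^ 2 + k.webConst q * v 0 ^ 3 := by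
  cases k <;> simp only [web, webLin, webConst]
  ring

theorem analyticAt_webLin (k : EllipticForm) (q : C2) : AnalyticAt ℂ k.webLin q := by
  have h0 := analyticAt_coord 0 q
  have h1 := analyticAt_coord 1 q
  cases k
  · exact analyticAt_const.mul h0
  · exact h1.sub (analyticAt_const.mul (h0.pow 2))
  · exact (analyticAt_const.mul h0).mul (h1.sub (analyticAt_const.mul (h0.pow 3)))

theorem analyticAt_webConst (k : EllipticForm) (q : C2) : AnalyticAt ℂ k.webConst q := by
  have h0 := analyticAt_coord 0 q
  have h1 := analyticAt_coord 1 q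
  cases k
  · exact h1
  · exact ((analyticAt_const.mul h0).mul (h1.sub (analyticAt_const.mul (h0.pow 2)))).neg
  · exact ((h1.pow 2).add (analyticAt_const.mul (h0.pow 6))).sub
      ((analyticAt_const.mul h1).mul (h0.pow 3))

/-- The only point with a triple root is the origin. -/
theorem eq_zero_of_webLin_eq_zero (k : EllipticForm) {q : C2} (h1 : k.webLin q = 0)
    (h2 : k.webConst q = 0) : q = 0 := by
  have key : q 0 = 0 ∧ q 1 = 0 := by
    cases k
    · simp only [webLin, webConst] at h1 h2
      exact ⟨by linear_combination h1 / 2, h2⟩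
    · simp only [webLin, webConst] at h1 h2
      have h0 : q 0 = 0 := by
        have : q 0 ^ 3 = 0 := by
          linear_combination -(27 / 8) * h2 - 9 / 4 * q 0 * h1
        exact pow_eq_zero_iff (by norm_num) |>.1 this
      rw [h0] at h1
      exact ⟨h0, by linear_combination h1⟩
    · simp only [webLin, webConst] at h1 h2
      have h0 : q 0 = 0 := by
        have : q 0 ^ 7 = 0 := by
          linear_combination (-27 / 16 * q 0) * h2 + (27 / 64 * q 1 - 21 / 16 * q 0 ^ 3) * h1
        exact pow_eq_zero_iff (by norm_num) |>.1 this
      rw [h0] at h2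
      refine ⟨h0, pow_eq_zero_iff (n := 2) (by norm_num) |>.1 (by linear_combination h2)⟩
  ext i; fin_cases i
  · exact key.1
  · exact key.2

/-- The derivative of `webLin` at the origin in the direction `∂_y`. -/
def webLinDeriv : EllipticForm → ℂ
  | form2 => 0
  | form3 => 1
  | form4 => 0

/-- The derivative of `webConst` at the origin in the direction `∂_y`. -/
def webConstDeriv : EllipticForm → ℂ
  | form2 => 1
  | form3 => 0
  | form4 => 0

theorem hasDerivAt_webLin (k : EllipticForm) :
    HasDerivAt (fun z : ℂ => k.webLin ![0, z]) k.webLinDeriv 0 := by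
  cases k
  · simpa [webLin, webLinDeriv] using hasDerivAt_const (0 : ℂ) (0 : ℂ)
  · simpa [webLin, webLinDeriv] using hasDerivAt_id' (0 : ℂ)
  · simpa [webLin, webLinDeriv] using hasDerivAt_const (0 : ℂ) (0 : ℂ)

theorem hasDerivAt_webConst (k : EllipticForm) :
    HasDerivAt (fun z : ℂ => k.webConst ![0, z]) k.webConstDeriv 0 := by
  cases k
  · simpa [webConst, webConstDeriv] using hasDerivAt_id' (0 : ℂ)
  · simpa [webConst, webConstDeriv] using hasDerivAt_const (0 : ℂ) (0 : ℂ)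
  · simpa [webConst, webConstDeriv] using hasDerivAt_pow 2 (0 : ℂ)

theorem hasDerivAt_webConst_x (k : EllipticForm) :
    HasDerivAt (fun z : ℂ => k.webConst ![z, 0]) 0 0 := by
  cases k
  · simpa [webConst] using hasDerivAt_const (0 : ℂ) (0 : ℂ)
  · have := ((hasDerivAt_pow 3 (0 : ℂ)).const_mul (4 / 27 : ℂ))
    simp only [webConst]
    refine (this.congr_deriv (by simp)).congr_of_eventuallyEq (.of_forall fun z => ?_)
    simp; ring
  · have := ((hasDerivAt_pow 6 (0 : ℂ)).const_mul (64 / 81 : ℂ))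
    simp only [webConst]
    refine (this.congr_deriv (by simp)).congr_of_eventuallyEq (.of_forall fun z => ?_)
    simp

theorem hasDerivAt_webLin_x (k : EllipticForm) :
    HasDerivAt (fun z : ℂ => k.webLin ![z, 0]) (match k with | form2 => 2 | _ => 0) 0 := by
  cases k
  · simpa [webLin] using (hasDerivAt_id (0 : ℂ)).const_mul 2
  · have := ((hasDerivAt_pow 2 (0 : ℂ)).const_mul (-2 / 3 : ℂ))
    simp only [webLin]
    refine (this.congr_deriv (by simp)).congr_of_eventuallyEq (.of_forall fun z => ?_)
    simp; ring
  · have := ((hasDerivAt_pow 4 (0 : ℂ)).const_mul (-16 / 9 : ℂ))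
    simp only [webLin]
    refine (this.congr_deriv (by simp)).congr_of_eventuallyEq (.of_forall fun z => ?_)
    simp; ring

end EllipticForm

theorem hasDerivAt_line {f : C2 → ℂ} (hf : AnalyticAt ℂ f 0) (u : C2) :
    HasDerivAt (fun z : ℂ => f (z • u)) (fderiv ℂ f 0 u) 0 := by
  have h1 : HasDerivAt (fun z : ℂ => z • u) u 0 := by
    simpa using (hasDerivAt_id (0 : ℂ)).smul_const u
  have h2 : HasFDerivAt f (fderiv ℂ f 0) ((0 : ℂ) • u) := by
    rw [zero_smul]; exact hf.differentiableAt.hasFDerivAt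
  exact h2.comp_hasDerivAt 0 h1

/-- All terms of `pullbackCoeff₀` except `c p ^ 3` contain two factors vanishing at `0`, and
`pullbackCoeff₃` equals `t ^ 3` there; the identity is the first-order part of the comparison. -/
theorem jet_pullbackCoeff₀ {A B C p q s t β : ℂ → ℂ} {A' B' C' p' s' r' β' : ℂ}
    (hA : HasDerivAt A A' 0) (hB : HasDerivAt B B' 0) (hC : HasDerivAt C C' 0)
    (hp : HasDerivAt p p' 0) (hs : HasDerivAt s s' 0)
    (hβ : HasDerivAt β β' 0)
    (hr : HasDerivAt (fun z => pullbackCoeff₃ (A z) (B z) (C z) (p z) (q z) (s z) (t z)) r' 0)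
    (A0 : A 0 = 0) (B0 : B 0 = 0) (C0 : C 0 = 0) (s0 : s 0 = 0) (β0 : β 0 = 0)
    (h : ∀ᶠ z in 𝓝 0, pullbackCoeff₀ (A z) (B z) (C z) (p z) (q z) (s z) (t z) =
      pullbackCoeff₃ (A z) (B z) (C z) (p z) (q z) (s z) (t z) * β z) :
    -C' * p 0 ^ 3 = t 0 ^ 3 * β' := by
  have h1 := (((hs.pow 3).sub ((hA.mul (hs.pow 2)).mul hp)).sub
    (((hB.const_mul 2).mul hs).mul (hp.pow 2))).sub (hC.mul (hp.pow 3))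
  have h2 : HasDerivAt (fun z => pullbackCoeff₀ (A z) (B z) (C z) (p z) (q z) (s z) (t z)) _ 0 := h1
  have h3 := (hr.mul hβ).congr_of_eventuallyEq h
  have := h2.unique h3
  simp [A0, B0, C0, s0, β0, pullbackCoeff₃] at this
  linear_combination this

theorem jet_pullbackCoeff₁ {A B C p q s t α : ℂ → ℂ} {A' B' C' p' q' s' t' r' α' : ℂ}
    (hA : HasDerivAt A A' 0) (hB : HasDerivAt B B' 0) (hC : HasDerivAt C C' 0)
    (hp : HasDerivAt p p' 0) (hq : HasDerivAt q q' 0) (hs : HasDerivAt s s' 0)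
    (ht : HasDerivAt t t' 0) (hα : HasDerivAt α α' 0)
    (hr : HasDerivAt (fun z => pullbackCoeff₃ (A z) (B z) (C z) (p z) (q z) (s z) (t z)) r' 0)
    (A0 : A 0 = 0) (B0 : B 0 = 0) (C0 : C 0 = 0) (s0 : s 0 = 0) (α0 : α 0 = 0)
    (h : ∀ᶠ z in 𝓝 0, pullbackCoeff₁ (A z) (B z) (C z) (p z) (q z) (s z) (t z) =
      pullbackCoeff₃ (A z) (B z) (C z) (p z) (q z) (s z) (t z) * α z) :
    -2 * B' * t 0 * p 0 ^ 2 - 3 * C' * p 0 ^ 2 * q 0 = t 0 ^ 3 * α' := by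
  have h1 := ((((hs.pow 2).const_mul 3).mul ht).sub (hA.mul (((hs.pow 2).mul hq).add
    (((hs.const_mul 2).mul ht).mul hp)))).sub ((hB.const_mul 2).mul ((((hs.const_mul 2).mul hp).mul
    hq).add (ht.mul (hp.pow 2)))) |>.sub (((hC.const_mul 3).mul (hp.pow 2)).mul hq)
  have h2 : HasDerivAt (fun z => pullbackCoeff₁ (A z) (B z) (C z) (p z) (q z) (s z) (t z)) _ 0 :=
    h1.congr_of_eventuallyEq (.of_forall fun z => by simp [pullbackCoeff₁])
  have h3 := (hr.mul hα).congr_of_eventuallyEq h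
  have := h2.unique h3
  simp [A0, B0, C0, s0, α0, pullbackCoeff₃] at this
  linear_combination this

/-- The linear parts of `b` and `c` that distinguish the three normal forms. -/
def EllipticForm.IsJet (k : EllipticForm) (b c : C3 → ℂ) : Prop :=
  match k with
  | .form2 => pd 2 c 0 ≠ 0
  | .form3 => pd 2 c 0 = 0 ∧ pd 2 b 0 ≠ 0
  | .form4 => pd 2 c 0 = 0 ∧ pd 2 b 0 = 0

/-- The shear of `ℂ³` that preserves the flat metric and `∂_t`. -/
def shear (r : ℂ) : C3 →L[ℂ] C3 :=
  ContinuousLinearMap.pi ![ContinuousLinearMap.proj 0 - r • ContinuousLinearMap.proj 2 -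
    (r ^ 2 / 2) • ContinuousLinearMap.proj 1, ContinuousLinearMap.proj 1,
    ContinuousLinearMap.proj 2 + r • ContinuousLinearMap.proj 1]

theorem shear_apply (r : ℂ) (p : C3) :
    shear r p = ![p 0 - r * p 2 - r ^ 2 / 2 * p 1, p 1, p 2 + r * p 1] := by
  ext i; fin_cases i <;> simp [shear]

/-- The conditions on the coefficients of a flat chart adapted to the normal form `k`. -/
structure IsAdapted (k : EllipticForm) (a b c : C3 → ℂ) : Prop where
  a_zero : a 0 = 0
  b_zero : b 0 = 0
  c_zero : c 0 = 0
  jet : k.IsJet b c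
  isolated : ∀ᶠ p in 𝓝 0, b p + a p ^ 2 / 6 = 0 →
    c p + 2 / 3 * a p * b p + 2 / 27 * a p ^ 3 = 0 → p 1 = 0 ∧ p 2 = 0

namespace FrobeniusGerm

variable {F : FrobeniusGerm}

/-- In depressed form the booklet cubic is `P ^ 3 - 2 (b + a ^ 2 / 6) P - (c + 2 a b / 3 + 2 a ^ 3 /
27)`, so the two equations in `IsAdapted.isolated` describe a triple root. Everything follows from
the equality of the pulled back cubic with a multiple of the normal form, whose only triple root is
at the origin. -/
theorem exists_adapted_chart (hN : F.NullUnit) {k : EllipticForm} (hk : F.IsBookletWeb k.web) :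
    ∃ (ψ : C3 → C3) (a b c : C3 → ℂ) (w₁ w₂ s β₁ β₂ : ℂ), F.IsChart ψ ∧
    IsPotential a b c ∧ IsHomogeneous a b c w₁ w₂ s β₁ β₂ ∧ IsAdapted k a b c ∧
    ∀ᶠ p in 𝓝 0, ∀ u v, fderiv ℂ ψ p (F.mul p u v) =
      frobMul (a (ψ p)) (b (ψ p)) (c (ψ p)) (fderiv ℂ ψ p u) (fderiv ℂ ψ p v) := by
  obtain ⟨hmass, σ, hcut⟩ := hk
  have hσ := hcut.1.1
  have hσ0 := hcut.1.2.1
  obtain ⟨α0, β0⟩ : k.webLin 0 = 0 ∧ k.webConst 0 = 0 := by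
    cases k <;> simp [EllipticForm.webLin, EllipticForm.webConst]
  obtain ⟨ψ, hψ, hs0⟩ : ∃ ψ, F.IsChart ψ ∧ surfEntry (ψ ∘ σ) 2 0 0 = 0 := by
    obtain ⟨ψ, hψ⟩ := exists_isChart F hN
    obtain ⟨a, b, c, w₁, w₂, s, β₁, β₂, hpot, hhom, hrel⟩ := hψ.exists_isPotential
    have hJ := hψ.surfJac_ne_zero hcut.1
    have key := (hψ.pullbackCoeff_eq hmass hpot hrel hcut (k.analyticAt_webLin 0)
      (k.analyticAt_webConst 0) k.web_eq_cubic rfl rfl rfl rfl rfl rfl rfl rfl).self_of_nhds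
    have k0 := key.2.2
    rw [β0, mul_zero, pullbackCoeff₀] at k0
    -- At the origin the normal form is `v₁ ^ 3`. If the image of the triple direction `v₁ = 0` had
    -- no `x`-component, it would have no `y`-component either, against the nonzero Jacobian.
    have hp : surfEntry (ψ ∘ σ) 1 0 0 ≠ 0 := by
      intro h0
      rw [h0] at k0
      have : surfEntry (ψ ∘ σ) 2 0 0 = 0 := by
        refine pow_eq_zero_iff (n := 3) (by norm_num) |>.1 ?_
        linear_combination k0
      exact hJ (by rw [surfJac, h0, this]; ring)
    -- The shear by this `r` makes the triple direction horizontal in the new flat coordinates.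
    set r := -(surfEntry (ψ ∘ σ) 2 0 0 / surfEntry (ψ ∘ σ) 1 0 0) with hr
    obtain ⟨hL, hdL⟩ := hψ.comp_linear (L := shear r)
      (fun u v => by simp [shear_apply]; ring)
      (by rw [shear_apply]; ext i; fin_cases i <;> simp)
    refine ⟨_, hL, ?_⟩
    have hd : ∀ i, surfEntry ((fun p => shear r (ψ p)) ∘ σ) i 0 0 =
        shear r (fderiv ℂ (ψ ∘ σ) 0 (Pi.single 0 1)) i := by
      intro i
      have hc : DifferentiableAt ℂ (ψ ∘ σ) 0 :=
        (AnalyticAt.comp (by rw [hσ0]; exact hψ.analytic) hσ).differentiableAt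
      have h' : HasFDerivAt ((fun p => shear r (ψ p)) ∘ σ) _ 0 :=
        (shear r).hasFDerivAt.comp 0 hc.hasFDerivAt
      rw [surfEntry, h'.fderiv]; rfl
    rw [hd, shear_apply]
    simp only [Matrix.cons_val]
    rw [← surfEntry, ← surfEntry, hr]
    field_simp
    ring
  obtain ⟨a, b, c, w₁, w₂, s, β₁, β₂, hpot, hhom, hrel⟩ := hψ.exists_isPotential
  refine ⟨ψ, a, b, c, w₁, w₂, s, β₁, β₂, hψ, hpot, hhom, ?_, hrel⟩
  have hJ := hψ.surfJac_ne_zero hcut.1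
  have key := (hψ.pullbackCoeff_eq hmass hpot hrel hcut (k.analyticAt_webLin 0)
      (k.analyticAt_webConst 0) k.web_eq_cubic rfl rfl rfl rfl rfl rfl rfl rfl)
  obtain ⟨τ, hτ⟩ : ∃ τ, τ = ψ ∘ σ := ⟨_, rfl⟩
  rw [← hτ] at key hs0 hJ
  have hτa : AnalyticAt ℂ τ 0 := by
    rw [hτ]; exact AnalyticAt.comp (by rw [hσ0]; exact hψ.analytic) hσ
  have hτ0 : τ 0 = 0 := by simp [hτ, hσ0, hψ.map_zero]
  rw [surfJac, hs0, mul_zero, sub_zero] at hJ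
  have hp := left_ne_zero_of_mul hJ
  have ht := right_ne_zero_of_mul hJ
  obtain ⟨k2, k1, k0⟩ := key.self_of_nhds
  rw [β0, mul_zero] at k0
  rw [α0, mul_zero] at k1
  simp only [Function.comp_apply, hτ0, hs0, pullbackCoeff₂, pullbackCoeff₁, pullbackCoeff₀]
    at k2 k1 k0
  -- With horizontal triple direction, the vanishing of the coefficients of `v₀ ^ 3`, `v₁ v₀ ^ 2`,
  -- `v₁ ^ 2 v₀` at the origin gives `c`, `b`, `a` in turn.
  have c0 : c 0 = 0 := by
    apply mul_right_cancel₀ (pow_ne_zero 3 hp); linear_combination -k0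
  have b0 : b 0 = 0 := by
    apply mul_right_cancel₀ (mul_ne_zero ht (pow_ne_zero 2 hp))
    rw [c0] at k1; linear_combination (-1 / 2) * k1
  have a0 : a 0 = 0 := by
    apply mul_right_cancel₀ (mul_ne_zero (pow_ne_zero 2 ht) hp)
    rw [c0, b0] at k2; linear_combination -k2
  have aA : AnalyticAt ℂ (a ∘ τ) 0 := AnalyticAt.comp (by rw [hτ0]; exact hpot.analytic_a) hτa
  have aB : AnalyticAt ℂ (b ∘ τ) 0 := AnalyticAt.comp (by rw [hτ0]; exact hpot.analytic_b) hτa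
  have aC : AnalyticAt ℂ (c ∘ τ) 0 := AnalyticAt.comp (by rw [hτ0]; exact hpot.analytic_c) hτa
  have ae (i : Fin 3) (j : Fin 2) := analyticAt_surfEntry hτa i j
  have hline : ∀ u : C2, Tendsto (fun z : ℂ => z • u) (𝓝 0) (𝓝 0) := by
    intro u
    have : Continuous fun z : ℂ => z • u := by fun_prop
    simpa using this.tendsto 0
  have hr3 : AnalyticAt ℂ (fun x => pullbackCoeff₃ ((a ∘ τ) x) ((b ∘ τ) x) ((c ∘ τ) x)
      (surfEntry τ 1 0 x) (surfEntry τ 1 1 x) (surfEntry τ 2 0 x) (surfEntry τ 2 1 x)) 0 := by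
    have e11 := ae 1 1
    have e21 := ae 2 1
    unfold pullbackCoeff₃
    generalize a ∘ τ = A at *
    generalize b ∘ τ = B at *
    generalize c ∘ τ = C at *
    generalize surfEntry τ 1 1 = x at *
    generalize surfEntry τ 2 1 = y at *
    fun_prop
  have hchain : ∀ {f : C3 → ℂ}, AnalyticAt ℂ f 0 → pd 0 f 0 = 0 → ∀ u, fderiv ℂ (f ∘ τ) 0 u =
      pd 1 f 0 * (surfEntry τ 1 0 0 * u 0 + surfEntry τ 1 1 0 * u 1) +
      pd 2 f 0 * (surfEntry τ 2 1 0 * u 1) := by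
    intro f hf hf0 u
    have hf' : AnalyticAt ℂ f (τ 0) := by rwa [hτ0]
    rw [(hf'.differentiableAt.hasFDerivAt.comp 0 hτa.differentiableAt.hasFDerivAt).fderiv,
      ContinuousLinearMap.comp_apply, hτ0, fderiv_eq_pd, hf0, fderiv_surf τ 1, fderiv_surf τ 2, hs0]
    ring
  have jet0 : ∀ u β', HasDerivAt (fun z : ℂ => k.webConst (z • u)) β' 0 →
      -(fderiv ℂ (c ∘ τ) 0 u) * surfEntry τ 1 0 0 ^ 3 = surfEntry τ 2 1 0 ^ 3 * β' := by
    intro u β' hβ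
    have := jet_pullbackCoeff₀ (hasDerivAt_line aA u) (hasDerivAt_line aB u)
      (hasDerivAt_line aC u) (hasDerivAt_line (ae 1 0) u)
      (hasDerivAt_line (ae 2 0) u) hβ (hasDerivAt_line hr3 u) (by simp [hτ0, a0]) (by simp [hτ0, b0])
      (by simp [hτ0, c0]) (by simp [hs0]) (by simp [β0])
      ((hline u).eventually (key.mono fun x hx => hx.2.2))
    simpa using this
  have jet1 : ∀ u α', HasDerivAt (fun z : ℂ => k.webLin (z • u)) α' 0 →
      -2 * fderiv ℂ (b ∘ τ) 0 u * surfEntry τ 2 1 0 * surfEntry τ 1 0 0 ^ 2 -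
        3 * fderiv ℂ (c ∘ τ) 0 u * surfEntry τ 1 0 0 ^ 2 * surfEntry τ 1 1 0 =
        surfEntry τ 2 1 0 ^ 3 * α' := by
    intro u α' hα
    have := jet_pullbackCoeff₁ (hasDerivAt_line aA u) (hasDerivAt_line aB u)
      (hasDerivAt_line aC u) (hasDerivAt_line (ae 1 0) u) (hasDerivAt_line (ae 1 1) u)
      (hasDerivAt_line (ae 2 0) u) (hasDerivAt_line (ae 2 1) u) hα (hasDerivAt_line hr3 u)
      (by simp [hτ0, a0]) (by simp [hτ0, b0])
      (by simp [hτ0, c0]) (by simp [hs0]) (by simp [α0])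
      ((hline u).eventually (key.mono fun x hx => hx.2.1))
    simpa using this
  refine ⟨a0, b0, c0, ?_, ?_⟩
  · have bt := hpot.b_t.self_of_nhds
    have ct := hpot.c_t.self_of_nhds
    -- The derivatives `c_y` and `b_y` at the origin are read off from the linear terms in `y`: form
    -- 2 has one in the constant coefficient, form 3 in the coefficient of `p`, form 4 in neither.
    -- The derivatives along `x` make the tilt of the second coordinate direction harmless.
    have x1 := jet0 ![1, 0] 0 (by simpa using k.hasDerivAt_webConst_x)
    have x2 := jet0 ![0, 1] _ (by simpa using k.hasDerivAt_webConst)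
    have y2 := jet1 ![0, 1] _ (by simpa using k.hasDerivAt_webLin)
    rw [hchain hpot.analytic_c ct] at x1 x2 y2
    rw [hchain hpot.analytic_b bt] at y2
    simp [hp] at x1
    simp [x1] at x2 y2
    cases k
    · show pd 2 c 0 ≠ 0
      intro h2
      simp [h2, EllipticForm.webConstDeriv] at x2
      exact pow_ne_zero 3 ht x2.symm
    · have c2 : pd 2 c 0 = 0 := by simpa [EllipticForm.webConstDeriv, ht, hp] using x2
      refine ⟨c2, fun h2 => ?_⟩
      have y1 := jet1 ![1, 0] 0 (by simpa using EllipticForm.form3.hasDerivAt_webLin_x)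
      rw [hchain hpot.analytic_c ct, hchain hpot.analytic_b bt] at y1
      simp [x1, ht, hp] at y1
      simp [h2, c2, y1, EllipticForm.webLinDeriv] at y2
      exact pow_ne_zero 3 ht y2.symm
    · have c2 : pd 2 c 0 = 0 := by simpa [EllipticForm.webConstDeriv, ht, hp] using x2
      refine ⟨c2, ?_⟩
      have y1 := jet1 ![1, 0] 0 (by simpa using EllipticForm.form4.hasDerivAt_webLin_x)
      rw [hchain hpot.analytic_c ct, hchain hpot.analytic_b bt] at y1
      simp [x1, ht, hp] at y1
      simpa [c2, y1, EllipticForm.webLinDeriv, ht, hp] using y2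
  · have hJ0 : surfJac τ 0 ≠ 0 := by
      rw [surfJac, hs0, mul_zero, sub_zero]; exact hJ
    obtain ⟨r1, hr1, H1⟩ := exists_ball_eq_of_pd_zero hpot.analytic_a hpot.a_t
    obtain ⟨r2, hr2, H2⟩ := exists_ball_eq_of_pd_zero hpot.analytic_b hpot.b_t
    obtain ⟨r3, hr3, H3⟩ := exists_ball_eq_of_pd_zero hpot.analytic_c hpot.c_t
    have hJ' : ∀ᶠ x in 𝓝 0, surfJac τ x ≠ 0 := by
      have : AnalyticAt ℂ (surfJac τ) 0 := ((ae 1 0).mul (ae 2 1)).sub ((ae 1 1).mul (ae 2 0))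
      exact this.continuousAt.eventually_ne hJ0
    rw [← map_ruled hτa hτ0 hJ0, eventually_map]
    have hpr := tendsto_planar
    have hru : Tendsto (ruled τ) (𝓝 0) (𝓝 0) := (map_ruled hτa hτ0 hJ0).le
    have hb (r : ℝ) (hr : 0 < r) := (hru.eventually (Metric.ball_mem_nhds (0 : C3) hr)).and
      (((tendsto_nhds_zero hτa hτ0).comp hpr).eventually (Metric.ball_mem_nhds (0 : C3) hr))
    filter_upwards [hpr.eventually key, hpr.eventually hJ', hb r1 hr1, hb r2 hr2, hb r3 hr3]
      with p hkey hJp b1 b2 b3 hlin hconst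
    have e1 : ruled τ p 1 = τ ![p 1, p 2] 1 := by simp [ruled]
    have e2 : ruled τ p 2 = τ ![p 1, p 2] 2 := by simp [ruled]
    rw [H1 _ b1.1 _ b1.2 e1 e2, H2 _ b2.1 _ b2.2 e1 e2] at hlin
    rw [H1 _ b1.1 _ b1.2 e1 e2, H2 _ b2.1 _ b2.2 e1 e2, H3 _ b3.1 _ b3.2 e1 e2] at hconst
    simp only [Function.comp_apply] at hlin hconst hkey
    have hz : (![p 1, p 2] : C2) = 0 := by
      rw [surfJac] at hJp
      generalize (![p 1, p 2] : C2) = x at *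
      obtain ⟨h2, h1, h0⟩ := hkey
      -- At a triple root the booklet cubic is `(V 2 - a / 3 * V 1) ^ 3` and pulls back to `(X v₀ +
      -- Y v₁) ^ 3`. This is `Y ^ 3` times the normal form, which has no `v₁ ^ 2 v₀` term; hence `X
      -- = 0`, and both lower coefficients of the normal form vanish.
      obtain ⟨X, hX⟩ : ∃ X, X = surfEntry τ 2 0 x - a (τ x) / 3 * surfEntry τ 1 0 x := ⟨_, rfl⟩
      obtain ⟨Y, hY⟩ : ∃ Y, Y = surfEntry τ 2 1 x - a (τ x) / 3 * surfEntry τ 1 1 x := ⟨_, rfl⟩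
      have hbx : b (τ x) = -a (τ x) ^ 2 / 6 := by linear_combination hlin
      have hcx : c (τ x) = a (τ x) ^ 3 / 27 := by rw [hbx] at hconst; linear_combination hconst
      rw [hbx, hcx] at h2 h1 h0
      have g3 : pullbackCoeff₃ (a (τ x)) (-a (τ x) ^ 2 / 6) (a (τ x) ^ 3 / 27) (surfEntry τ 1 0 x)
          (surfEntry τ 1 1 x) (surfEntry τ 2 0 x) (surfEntry τ 2 1 x) = Y ^ 3 := by
        rw [hY, pullbackCoeff₃]; ring
      rw [g3] at h1 h0
      have h2' : 3 * X * Y ^ 2 = 0 := by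
        rw [← h2, hX, hY, pullbackCoeff₂]; ring
      have h1' : 3 * X ^ 2 * Y = Y ^ 3 * k.webLin x := by
        rw [← h1, hX, hY, pullbackCoeff₁]; ring
      have h0' : X ^ 3 = Y ^ 3 * k.webConst x := by
        rw [← h0, hX, pullbackCoeff₀]; ring
      have hY0 : Y ≠ 0 := by
        intro hY0
        have hX0 : X = 0 := by
          rw [hY0] at h0'
          exact pow_eq_zero_iff (n := 3) (by norm_num) |>.1 (by linear_combination h0')
        apply hJp
        linear_combination surfEntry τ 1 0 x * (hY0 - hY) - surfEntry τ 1 1 x * (hX0 - hX)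
      have hX0 : X = 0 := by
        apply mul_right_cancel₀ (pow_ne_zero 2 hY0)
        linear_combination h2' / 3
      rw [hX0] at h1' h0'
      apply k.eq_zero_of_webLin_eq_zero
      · apply mul_left_cancel₀ (pow_ne_zero 3 hY0); linear_combination -h1'
      · apply mul_left_cancel₀ (pow_ne_zero 3 hY0); linear_combination -h0'
    rw [e1, e2, hz, hτ0]
    exact ⟨rfl, rfl⟩

end FrobeniusGerm

end

/-! ### The Euler field fixes the triple point; its weights -/

noncomputable section

theorem hasDerivAt_comp_curve {f : C3 → ℂ} {γ : ℝ → C3} {t : ℝ} {v : C3}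
    (hf : DifferentiableAt ℂ f (γ t)) (hγ : HasDerivAt γ v t) :
    HasDerivAt (fun s => f (γ s)) (v 0 * pd 0 f (γ t) + v 1 * pd 1 f (γ t) + v 2 * pd 2 f (γ t))
      t := by
  have := (hf.hasFDerivAt.restrictScalars ℝ).comp_hasDerivAt t hγ
  rw [← fderiv_eq_pd]
  exact this

theorem eventually_eq_zero_of_linear_ode {h : ℝ → ℂ} {k : ℂ} (h0 : h 0 = 0)
    (hd : ∀ᶠ t in 𝓝 0, HasDerivAt h (k * h t) t) : ∀ᶠ t in 𝓝 0, h t = 0 := by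
  obtain ⟨r, hr, H⟩ := Metric.eventually_nhds_iff_ball.1 hd
  have H' : ∀ t ∈ Metric.ball (0 : ℝ) r,
      HasDerivAt (fun s : ℝ => Complex.exp (-k * s) * h s) 0 t := by
    intro t ht
    have h1 : HasDerivAt (fun s : ℝ => -k * (s : ℂ)) (-k) t := by
      simpa using (Complex.ofRealCLM.hasDerivAt (x := t)).const_mul (-k)
    exact (h1.cexp.mul (H t ht)).congr_deriv (by ring)
  refine Metric.eventually_nhds_iff_ball.2 ⟨r, hr, fun t ht => ?_⟩
  have := Metric.isOpen_ball.is_const_of_deriv_eq_zero (convex_ball (0 : ℝ) r).isPreconnected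
    (fun s hs => (H' s hs).differentiableAt.differentiableWithinAt)
    (fun s hs => (H' s hs).deriv) ht (Metric.mem_ball_self hr)
  simpa [h0] using this

theorem contDiff_affineField (w₁ w₂ s β₁ β₂ : ℂ) : ContDiff ℝ 1
    (fun p : C3 => (![0, w₁ * p 1 + β₁, w₂ * p 2 + s * p 1 + β₂] : C3)) := by
  rw [contDiff_pi]
  intro i
  fin_cases i
  · exact contDiff_const
  · simp; fun_prop
  · simp; fun_prop

/-- The integral curve of the planar Euler field through the origin stays in the triple-root locus,
hence is constant in `x` and `y`; so the field vanishes there. -/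
theorem IsHomogeneous.shift_eq_zero {k : EllipticForm} {a b c : C3 → ℂ} {w₁ w₂ s β₁ β₂ : ℂ}
    (hp : IsPotential a b c) (hh : IsHomogeneous a b c w₁ w₂ s β₁ β₂)
    (ha : IsAdapted k a b c) : s = 0 ∧ β₁ = 0 ∧ β₂ = 0 := by
  obtain ⟨γ, γ0, ε, hε, hγ⟩ := (contDiff_affineField w₁ w₂ s β₁ β₂).contDiffAt (x := 0) |>.exists_forall_mem_closedBall_exists_eq_forall_mem_Ioo_hasDerivAt₀ (0 : ℝ)
  have hγ' : ∀ᶠ t in 𝓝 0, HasDerivAt γ ![0, w₁ * γ t 1 + β₁, w₂ * γ t 2 + s * γ t 1 + β₂] t := by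
    filter_upwards [Ioo_mem_nhds (a := 0 - ε) (b := 0 + ε) (by linarith) (by linarith)] with t ht
    exact hγ t ht
  have hγ0 := hγ'.self_of_nhds
  have hlim : Tendsto γ (𝓝 0) (𝓝 0) := by
    have := hγ0.continuousAt.tendsto
    rwa [γ0] at this
  have da := hlim.eventually hp.analytic_a.eventually_analyticAt
  have db := hlim.eventually hp.analytic_b.eventually_analyticAt
  have dc := hlim.eventually hp.analytic_c.eventually_analyticAt
  have ta := hlim.eventually hp.a_t
  have tb := hlim.eventually hp.b_t
  have tc := hlim.eventually hp.c_t
  have ea := hlim.eventually hh.eq_a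
  have eb := hlim.eventually hh.eq_b
  have ec := hlim.eventually hh.eq_c
  -- The coefficients of the depressed cubic are insensitive to shears: the terms with `s` cancel
  -- and each of them satisfies a homogeneous linear equation along the curve.
  have hA : ∀ᶠ t in 𝓝 0, b (γ t) + a (γ t) ^ 2 / 6 = 0 := by
    refine eventually_eq_zero_of_linear_ode (k := 2 * (w₂ - w₁)) ?_ ?_
    · simp [γ0, ha.a_zero, ha.b_zero]
    · filter_upwards [hγ', da, db, ta, tb, ea, eb] with t hγ da db ta tb ea eb
      have h1 := hasDerivAt_comp_curve da.differentiableAt hγ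
      have h2 := hasDerivAt_comp_curve db.differentiableAt hγ
      refine (h2.add ((h1.pow 2).div_const 6)).congr_deriv ?_
      simp
      linear_combination eb + a (γ t) / 3 * ea
  have hB : ∀ᶠ t in 𝓝 0, c (γ t) + 2 / 3 * a (γ t) * b (γ t) + 2 / 27 * a (γ t) ^ 3 = 0 := by
    refine eventually_eq_zero_of_linear_ode (k := 3 * (w₂ - w₁)) ?_ ?_
    · simp [γ0, ha.a_zero, ha.c_zero]
    · filter_upwards [hγ', da, db, dc, ta, tb, tc, ea, eb, ec, hA]
        with t hγ da db dc ta tb tc ea eb ec hA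
      have h1 := hasDerivAt_comp_curve da.differentiableAt hγ
      have h2 := hasDerivAt_comp_curve db.differentiableAt hγ
      have h3 := hasDerivAt_comp_curve dc.differentiableAt hγ
      refine ((h3.add ((h1.const_mul (2 / 3)).mul h2)).add ((h1.pow 3).const_mul (2 / 27)))
        |>.congr_deriv ?_
      simp
      linear_combination ec + 2 / 3 * a (γ t) * eb + (2 / 3 * b (γ t) + 2 / 9 * a (γ t) ^ 2) * ea
  have hz : ∀ᶠ t in 𝓝 0, γ t 1 = 0 ∧ γ t 2 = 0 := by
    filter_upwards [hA, hB, hlim.eventually ha.isolated] with t h1 h2 h3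
    exact h3 h1 h2
  have hd := hasDerivAt_pi.1 hγ0
  have d1 := (hd 1).unique ((hasDerivAt_const (0 : ℝ) (0 : ℂ)).congr_of_eventuallyEq
    (hz.mono fun t ht => ht.1))
  have d2 := (hd 2).unique ((hasDerivAt_const (0 : ℝ) (0 : ℂ)).congr_of_eventuallyEq
    (hz.mono fun t ht => ht.2))
  simp [γ0] at d1 d2
  -- At the origin the equation for `a` reduces to `0 = 3 s`.
  have e0 := hh.eq_a.self_of_nhds
  simp [d1, d2, ha.a_zero] at e0
  exact ⟨e0, d1, d2⟩

/-- Write `φ = z ^ n g` with `g 0 ≠ 0`, divide the Euler equation by `z ^ n` and let `z → 0`. -/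
theorem exists_degree_of_euler {φ : ℂ → ℂ} (hφ : AnalyticAt ℂ φ 0) (h0 : φ 0 = 0)
    (hne : ¬∀ᶠ z in 𝓝 0, φ z = 0) {w l : ℂ} (h : ∀ᶠ z in 𝓝 0, w * z * deriv φ z = l * φ z) :
    ∃ n : ℕ, 1 ≤ n ∧ l = n * w := by
  obtain ⟨n, g, hg, g0, heq⟩ := hφ.exists_eventuallyEq_pow_smul_nonzero_iff.2 hne
  simp only [sub_zero, smul_eq_mul] at heq
  have hn : n ≠ 0 := by
    rintro rfl
    have := heq.self_of_nhds
    simp [h0] at this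
    exact g0 this.symm
  refine ⟨n, Nat.one_le_iff_ne_zero.2 hn, ?_⟩
  obtain ⟨m, rfl⟩ := Nat.exists_eq_succ_of_ne_zero hn
  have key : ∀ᶠ z in 𝓝[≠] (0 : ℂ), (l - (m + 1 : ℕ) * w) * g z - w * z * deriv g z = 0 := by
    filter_upwards [eventually_nhdsWithin_of_eventually_nhds heq.eventually_nhds,
      eventually_nhdsWithin_of_eventually_nhds h,
      eventually_nhdsWithin_of_eventually_nhds hg.eventually_analyticAt, self_mem_nhdsWithin]
      with z h1 h2 h3 hz
    have hd := (((hasDerivAt_pow (m + 1) z).mul h3.differentiableAt.hasDerivAt).congr_of_eventuallyEq h1).deriv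
    rw [hd, h1.self_of_nhds] at h2
    apply mul_left_cancel₀ (pow_ne_zero (m + 1) hz)
    simp at h2
    push_cast
    linear_combination -h2
  have hc : ContinuousAt (fun z => (l - (m + 1 : ℕ) * w) * g z - w * z * deriv g z) 0 := by
    have := hg.continuousAt
    have := hg.deriv.continuousAt
    fun_prop
  have hlim : Tendsto (fun z => (l - (m + 1 : ℕ) * w) * g z - w * z * deriv g z) (𝓝[≠] 0) (𝓝 0) :=
    tendsto_const_nhds.congr' (key.mono fun z hz => hz.symm)
  have := tendsto_nhds_unique (hc.tendsto.mono_left nhdsWithin_le_nhds) hlim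
  simp only [mul_zero, zero_mul, sub_zero] at this
  have := (mul_eq_zero.1 this).resolve_right g0
  simpa [sub_eq_zero] using this

/-- The embedding of a coordinate axis. -/
theorem tendsto_single (i : Fin 3) :
    Tendsto (fun z : ℂ => (Pi.single i z : C3)) (𝓝 0) (𝓝 0) := by
  have : Continuous fun z : ℂ => (Pi.single i z : C3) :=
    (ContinuousLinearMap.single ℂ (fun _ : Fin 3 => ℂ) i).continuous
  simpa using this.tendsto 0

theorem exists_degree_of_axis {i : Fin 3} {f : C3 → ℂ} (hf : AnalyticAt ℂ f 0) (h0 : f 0 = 0)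
    (hne : ¬∀ᶠ z in 𝓝 (0 : ℂ), f (Pi.single i z) = 0) {w l : ℂ}
    (h : ∀ᶠ z in 𝓝 (0 : ℂ), w * z * pd i f (Pi.single i z) = l * f (Pi.single i z)) :
    ∃ n : ℕ, 1 ≤ n ∧ l = n * w := by
  have hs : AnalyticAt ℂ (fun z : ℂ => (Pi.single i z : C3)) 0 :=
    (ContinuousLinearMap.single ℂ (fun _ : Fin 3 => ℂ) i).analyticAt 0
  refine exists_degree_of_euler (φ := fun z => f (Pi.single i z)) ?_ (by simpa using h0) hne ?_
  · exact AnalyticAt.comp (by simpa using hf) hs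
  · filter_upwards [h, (tendsto_single i).eventually hf.eventually_analyticAt] with z hz hfz
    have hd : HasDerivAt (fun z : ℂ => (Pi.single i z : C3)) (Pi.single i 1) z :=
      (ContinuousLinearMap.single ℂ (fun _ : Fin 3 => ℂ) i).hasDerivAt
    have hd' : HasDerivAt (fun z => f (Pi.single i z)) (pd i f (Pi.single i z)) z :=
      hfz.differentiableAt.hasFDerivAt.comp_hasDerivAt z hd
    rwa [hd'.deriv]

/-- If `a`, `b`, `c` all vanished on the axis, it would consist of triple points. The first of them
that does not vanish there has degree `m (w₂ - w₁)` with `m = 1, 2, 3`. -/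
theorem IsAdapted.exists_degree {k : EllipticForm} {a b c : C3 → ℂ} {w₁ w₂ : ℂ}
    (hp : IsPotential a b c) (ha : IsAdapted k a b c) {i : Fin 3} (hi : i ≠ 0) {w : ℂ}
    (ea : ∀ᶠ z in 𝓝 (0 : ℂ), w * z * pd i a (Pi.single i z) = (w₂ - w₁) * a (Pi.single i z))
    (eb : ∀ᶠ z in 𝓝 (0 : ℂ), w * z * pd i b (Pi.single i z) = (2 * (w₂ - w₁)) * b (Pi.single i z))
    (ec : ∀ᶠ z in 𝓝 (0 : ℂ), w * z * pd i c (Pi.single i z) = (3 * (w₂ - w₁)) * c (Pi.single i z)) :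
    ∃ m n : ℕ, 1 ≤ m ∧ m ≤ 3 ∧ 1 ≤ n ∧ m * (w₂ - w₁) = n * w := by
  by_cases h1 : ∀ᶠ z in 𝓝 (0 : ℂ), a (Pi.single i z) = 0
  · by_cases h2 : ∀ᶠ z in 𝓝 (0 : ℂ), b (Pi.single i z) = 0
    · by_cases h3 : ∀ᶠ z in 𝓝 (0 : ℂ), c (Pi.single i z) = 0
      · exfalso
        have : ∀ᶠ z in 𝓝 (0 : ℂ), z = 0 := by
          filter_upwards [h1, h2, h3, (tendsto_single i).eventually ha.isolated] with z h1 h2 h3 h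
          have := h (by simp [h1, h2]) (by simp [h1, h3])
          fin_cases i
          · exact absurd rfl hi
          · simpa using this.1
          · simpa using this.2
        have h4 : ∀ᶠ z in 𝓝[≠] (0 : ℂ), z = 0 := eventually_nhdsWithin_of_eventually_nhds this
        obtain ⟨z, hz, hz'⟩ := (h4.and self_mem_nhdsWithin).exists
        exact hz' hz
      · obtain ⟨n, hn, h⟩ := exists_degree_of_axis hp.analytic_c ha.c_zero h3 ec
        exact ⟨3, n, by norm_num, by norm_num, hn, by simpa using h⟩
    · obtain ⟨n, hn, h⟩ := exists_degree_of_axis hp.analytic_b ha.b_zero h2 eb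
      exact ⟨2, n, by norm_num, by norm_num, hn, by simpa using h⟩
  · obtain ⟨n, hn, h⟩ := exists_degree_of_axis hp.analytic_a ha.a_zero h1 ea
    exact ⟨1, n, by norm_num, by norm_num, hn, by simpa using h⟩

/-- The possible ratios of the weights. -/
theorem IsHomogeneous.weights {k : EllipticForm} {a b c : C3 → ℂ} {w₁ w₂ s β₁ β₂ : ℂ}
    (hp : IsPotential a b c) (hh : IsHomogeneous a b c w₁ w₂ s β₁ β₂)
    (ha : IsAdapted k a b c) : w₁ ≠ 0 ∧ (w₂ = 3 / 2 * w₁ ∨ w₂ = 2 * w₁ ∨ w₂ = 3 * w₁) := by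
  obtain ⟨rfl, rfl, rfl⟩ := hh.shift_eq_zero hp ha
  obtain ⟨m, n, hm, hm', hn, h1⟩ := ha.exists_degree hp (i := 1) (by decide) (w := w₁) (w₁ := w₁)
    (w₂ := w₂) (((tendsto_single 1).eventually hh.eq_a).mono fun z hz => by simpa using hz)
    (((tendsto_single 1).eventually hh.eq_b).mono fun z hz => by simpa using hz)
    (((tendsto_single 1).eventually hh.eq_c).mono fun z hz => by simpa using hz)
  obtain ⟨m', n', hm2, hm2', hn2, h2⟩ := ha.exists_degree hp (i := 2) (by decide) (w := w₂)
    (w₁ := w₁) (w₂ := w₂)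
    (((tendsto_single 2).eventually hh.eq_a).mono fun z hz => by simpa using hz)
    (((tendsto_single 2).eventually hh.eq_b).mono fun z hz => by simpa using hz)
    (((tendsto_single 2).eventually hh.eq_c).mono fun z hz => by simpa using hz)
  have m0 : (m : ℂ) ≠ 0 := by exact_mod_cast (by omega : m ≠ 0)
  have hw : w₁ ≠ 0 := by
    rintro rfl
    have hw2 : w₂ = 0 := by simpa [m0] using h1
    exact hh.nontrivial (by simp [hw2])
  refine ⟨hw, ?_⟩
  -- Eliminating `w₂` between the conditions of the two axes forces `n' < m' ≤ 3`; then `w₂ = m' /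
  -- (m' - n') * w₁` has three possible values.
  have key : ((m' : ℂ)) * n = n' * (m + n) := by
    apply mul_right_cancel₀ hw
    linear_combination -(m' : ℂ) * h1 + (m : ℂ) * h2 + (n' : ℂ) * h1
  have key' : m' * n = n' * (m + n) := by exact_mod_cast key
  have hlt : n' < m' := by
    by_contra hcon
    push Not at hcon
    nlinarith [Nat.mul_le_mul_right n hcon]
  have h2' : ((m' : ℂ) - n') * w₂ = m' * w₁ := by linear_combination h2
  interval_cases m'
  · omega
  · interval_cases n'
    right; left
    push_cast at h2'
    linear_combination h2'
  · interval_cases n'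
    · left
      push_cast at h2'
      linear_combination h2' / 2
    · right; right
      push_cast at h2'
      linear_combination h2'

end

/-! ### Quasihomogeneous germs and homogeneous potentials -/

noncomputable section

theorem pd_congr {f g : C3 → ℂ} (h : ∀ᶠ p in 𝓝 0, f p = g p) (i : Fin 3) :
    ∀ᶠ p in 𝓝 0, pd i f p = pd i g p := by
  filter_upwards [h.eventually_nhds] with p hp
  rw [pd, pd, EventuallyEq.fderiv_eq hp]

theorem AnalyticAt.pd {f : C3 → ℂ} {p : C3} (hf : AnalyticAt ℂ f p) (i : Fin 3) :
    AnalyticAt ℂ (_root_.pd i f) p :=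
  ((ContinuousLinearMap.apply ℂ ℂ (Pi.single i 1 : C3)).analyticAt _).comp hf.fderiv

theorem pd_comm {f : C3 → ℂ} {p : C3} (hf : AnalyticAt ℂ f p) (i j : Fin 3) :
    pd i (pd j f) p = pd j (pd i f) p := by
  have h (i j : Fin 3) : pd i (pd j f) p = fderiv ℂ (fderiv ℂ f) p (Pi.single i 1) (Pi.single j 1) := by
    have := hf.fderiv.differentiableAt.hasFDerivAt.clm_apply
      (hasFDerivAt_const (Pi.single j 1 : C3) p)
    rw [pd, show pd j f = fun q => fderiv ℂ f q (Pi.single j 1) from rfl, this.fderiv]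
    simp
  rw [h, h]
  exact (hf.contDiffAt (n := 2)).isSymmSndFDerivAt (by simp) _ _

/-- `f(x, y)` is analytic near the origin and homogeneous of degree `w` for the weights `m`, `n`. -/
structure IsQuasihomogeneous (m n : ℕ) (w : ℤ) (f : C3 → ℂ) : Prop where
  analytic : AnalyticAt ℂ f 0
  pd_t : ∀ᶠ p in 𝓝 0, pd 0 f p = 0
  euler : ∀ᶠ p in 𝓝 0, m * p 1 * pd 1 f p + n * p 2 * pd 2 f p = w * f p

namespace IsQuasihomogeneous

variable {m n : ℕ} {w : ℤ} {f : C3 → ℂ}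

theorem pd_euler (h : IsQuasihomogeneous m n w f) (i : Fin 3) :
    ∀ᶠ p in 𝓝 0, m * p 1 * pd 1 (pd i f) p + n * p 2 * pd 2 (pd i f) p =
      w * pd i f p - (if i = 1 then m * pd 1 f p else 0) - (if i = 2 then n * pd 2 f p else 0) := by
  filter_upwards [pd_congr h.euler i, h.analytic.eventually_analyticAt] with p hp hf
  have h1 := (hf.pd 1).differentiableAt
  have h2 := (hf.pd 2).differentiableAt
  have h0 := hf.differentiableAt
  simp (disch := fun_prop) only [pd_add, pd_mul, pd_const, pd_coord] at hp
  rw [pd_comm hf 1 i, pd_comm hf 2 i]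
  split_ifs at hp ⊢ <;> linear_combination hp

theorem pd_pd_t (h : IsQuasihomogeneous m n w f) (i : Fin 3) :
    ∀ᶠ p in 𝓝 0, pd 0 (pd i f) p = 0 := by
  filter_upwards [pd_congr (g := fun _ => 0) h.pd_t i, h.analytic.eventually_analyticAt]
    with p hp hf
  rw [pd_comm hf, hp, pd_const]

theorem pd_one (h : IsQuasihomogeneous m n w f) : IsQuasihomogeneous m n (w - m) (pd 1 f) where
  analytic := h.analytic.pd 1
  pd_t := h.pd_pd_t 1
  euler := by
    filter_upwards [h.pd_euler 1] with p hp
    simp at hp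
    push_cast
    linear_combination hp

theorem pd_two (h : IsQuasihomogeneous m n w f) : IsQuasihomogeneous m n (w - n) (pd 2 f) where
  analytic := h.analytic.pd 2
  pd_t := h.pd_pd_t 2
  euler := by
    filter_upwards [h.pd_euler 2] with p hp
    simp at hp
    push_cast
    linear_combination hp

/-- The function `s ^ (-w) f(t, s ^ m x, s ^ n y)` is constant on `[0, 1]` by the Euler relation and
vanishes at `s = 0`. -/
theorem eq_zero_of_neg (h : IsQuasihomogeneous m n w f) (hw : w < 0) (hm : 0 < m) (hn : 0 < n) :
    ∀ᶠ p in 𝓝 0, f p = 0 := by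
  obtain ⟨k, rfl⟩ : ∃ k : ℕ, w = -(k + 1 : ℕ) := ⟨(-w - 1).toNat, by omega⟩
  obtain ⟨m, rfl⟩ := Nat.exists_eq_succ_of_ne_zero hm.ne'
  obtain ⟨n, rfl⟩ := Nat.exists_eq_succ_of_ne_zero hn.ne'
  obtain ⟨r, hr, H⟩ := Metric.eventually_nhds_iff_ball.1
    (h.analytic.eventually_analyticAt.and (h.pd_t.and h.euler))
  refine Metric.eventually_nhds_iff_ball.2 ⟨r, hr, fun p hp => ?_⟩
  set γ : ℝ → C3 := fun s => ![p 0, (s : ℂ) ^ (m + 1) * p 1, (s : ℂ) ^ (n + 1) * p 2] with hγ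
  have hball : ∀ s ∈ Set.Icc (0 : ℝ) 1, γ s ∈ Metric.ball (0 : C3) r := by
    intro s hs
    have hb := fun i => (pi_norm_lt_iff hr).1 (mem_ball_zero_iff.1 hp) i
    have hle (k : ℕ) (z : ℂ) (hz : ‖z‖ < r) : ‖(s : ℂ) ^ k * z‖ < r := by
      rw [norm_mul, norm_pow, Complex.norm_real, Real.norm_of_nonneg hs.1]
      exact lt_of_le_of_lt (mul_le_of_le_one_left (norm_nonneg _) (pow_le_one₀ hs.1 hs.2)) hz
    rw [mem_ball_zero_iff, pi_norm_lt_iff hr]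
    intro i
    fin_cases i
    · exact hb 0
    · exact hle _ _ (hb 1)
    · exact hle _ _ (hb 2)
  have hpow (k : ℕ) (s : ℝ) : HasDerivAt (fun s : ℝ => (s : ℂ) ^ (k + 1)) ((k + 1) * (s : ℂ) ^ k) s := by
    have h : HasDerivAt (fun s : ℝ => (s : ℂ) ^ (k + 1)) _ s :=
      (Complex.ofRealCLM.hasDerivAt (x := s)).pow (k + 1)
    exact h.congr_deriv (by simp)
  have hder : ∀ s ∈ Set.Icc (0 : ℝ) 1,
      HasDerivAt (fun s : ℝ => (s : ℂ) ^ (k + 1) * f (γ s)) 0 s := by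
    intro s hs
    obtain ⟨hf, ht, he⟩ := H _ (hball s hs)
    have hd : HasDerivAt γ
        ![0, (m + 1) * (s : ℂ) ^ m * p 1, (n + 1) * (s : ℂ) ^ n * p 2] s := by
      rw [hasDerivAt_pi]
      intro i
      fin_cases i
      · exact hasDerivAt_const _ _
      · exact (hpow m s).mul_const _
      · exact (hpow n s).mul_const _
    refine ((hpow k s).mul (hasDerivAt_comp_curve hf.differentiableAt hd)).congr_deriv ?_
    simp [hγ] at he ⊢
    linear_combination (s : ℂ) ^ k * he
  have hc := constant_of_has_deriv_right_zero
    (fun s hs => (hder s hs).continuousAt.continuousWithinAt)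
    (fun s hs => (hder s ⟨hs.1, hs.2.le⟩).hasDerivWithinAt) 1 (by simp)
  have h1 : γ 1 = p := by ext i; fin_cases i <;> simp [hγ]
  simpa [h1] using hc

theorem eq_const (h : IsQuasihomogeneous m n 0 f) (hm : 0 < m) (hn : 0 < n) :
    ∀ᶠ p in 𝓝 0, f p = f 0 := by
  refine eventually_eq_of_fderiv_eq_zero (h.analytic.eventually_analyticAt.mono fun p hp =>
    hp.differentiableAt) ?_
  filter_upwards [h.pd_t, h.pd_one.eq_zero_of_neg (by omega) hm hn,
    h.pd_two.eq_zero_of_neg (by omega) hm hn] with p h0 h1 h2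
  ext1 u
  simp [fderiv_eq_pd, h0, h1, h2]

section TwoThree

/-- Partial derivatives lower the weight, and Euler's relation recovers `f` from them when `w ≠ 0`.
The same descent, ending at constants and at negative weights, yields the polynomial forms below. -/
theorem two_three_one (h : IsQuasihomogeneous 2 3 1 f) : ∀ᶠ p in 𝓝 0, f p = 0 := by
  filter_upwards [h.euler, h.pd_one.eq_zero_of_neg (by norm_num) (by norm_num) (by norm_num),
    h.pd_two.eq_zero_of_neg (by norm_num) (by norm_num) (by norm_num)] with p h0 h1 h2
  simpa [h1, h2] using h0.symm

theorem two_three_two (h : IsQuasihomogeneous 2 3 2 f) :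
    ∃ k, ∀ᶠ p in 𝓝 0, f p = k * p 1 := by
  refine ⟨pd 1 f 0, ?_⟩
  filter_upwards [h.euler, eq_const (m := 2) (n := 3) h.pd_one (by norm_num) (by norm_num),
    h.pd_two.eq_zero_of_neg (by norm_num) (by norm_num) (by norm_num)] with p h0 h1 h2
  rw [h1, h2] at h0
  push_cast at h0
  linear_combination -h0 / 2

theorem two_three_three (h : IsQuasihomogeneous 2 3 3 f) :
    ∃ k, ∀ᶠ p in 𝓝 0, f p = k * p 2 := by
  refine ⟨pd 2 f 0, ?_⟩
  filter_upwards [h.euler, two_three_one h.pd_one,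
    eq_const (m := 2) (n := 3) h.pd_two (by norm_num) (by norm_num)] with p h0 h1 h2
  rw [h1, h2] at h0
  push_cast at h0
  linear_combination -h0 / 3

end TwoThree

theorem one_of_lt (h : IsQuasihomogeneous 1 n 1 f) (hn : 1 < n) :
    ∃ k, ∀ᶠ p in 𝓝 0, f p = k * p 1 := by
  refine ⟨pd 1 f 0, ?_⟩
  filter_upwards [h.euler, eq_const (m := 1) h.pd_one (by norm_num) (by omega),
    h.pd_two.eq_zero_of_neg (by omega) (by norm_num) (by omega)] with p h0 h1 h2
  rw [h1, h2] at h0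
  push_cast at h0
  linear_combination -h0

section OneTwo

theorem one_two_two (h : IsQuasihomogeneous 1 2 2 f) :
    ∃ k l, ∀ᶠ p in 𝓝 0, f p = k * p 1 ^ 2 + l * p 2 := by
  obtain ⟨k, hk⟩ := one_of_lt (n := 2) h.pd_one (by norm_num)
  refine ⟨k / 2, pd 2 f 0, ?_⟩
  filter_upwards [h.euler, hk, eq_const (m := 1) (n := 2) h.pd_two (by norm_num) (by norm_num)]
    with p h0 h1 h2
  rw [h1, h2] at h0
  push_cast at h0
  linear_combination -h0 / 2

theorem one_two_three (h : IsQuasihomogeneous 1 2 3 f) :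
    ∃ k l, ∀ᶠ p in 𝓝 0, f p = k * p 1 ^ 3 + l * (p 1 * p 2) := by
  obtain ⟨k, l, hk⟩ := one_two_two h.pd_one
  obtain ⟨l', hl⟩ := one_of_lt (n := 2) h.pd_two (by norm_num)
  refine ⟨k / 3, (l + 2 * l') / 3, ?_⟩
  filter_upwards [h.euler, hk, hl] with p h0 h1 h2
  rw [h1, h2] at h0
  push_cast at h0
  linear_combination -h0 / 3

end OneTwo

section OneThree

theorem one_three_two (h : IsQuasihomogeneous 1 3 2 f) :
    ∃ k, ∀ᶠ p in 𝓝 0, f p = k * p 1 ^ 2 := by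
  obtain ⟨k, hk⟩ := one_of_lt (n := 3) h.pd_one (by norm_num)
  refine ⟨k / 2, ?_⟩
  filter_upwards [h.euler, hk, h.pd_two.eq_zero_of_neg (by norm_num) (by norm_num) (by norm_num)]
    with p h0 h1 h2
  rw [h1, h2] at h0
  push_cast at h0
  linear_combination -h0 / 2

theorem one_three_three (h : IsQuasihomogeneous 1 3 3 f) :
    ∃ k l, ∀ᶠ p in 𝓝 0, f p = k * p 1 ^ 3 + l * p 2 := by
  obtain ⟨k, hk⟩ := one_three_two h.pd_one
  refine ⟨k / 3, pd 2 f 0, ?_⟩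
  filter_upwards [h.euler, hk, eq_const (m := 1) (n := 3) h.pd_two (by norm_num) (by norm_num)]
    with p h0 h1 h2
  rw [h1, h2] at h0
  push_cast at h0
  linear_combination -h0 / 3

theorem one_three_four (h : IsQuasihomogeneous 1 3 4 f) :
    ∃ k l, ∀ᶠ p in 𝓝 0, f p = k * p 1 ^ 4 + l * (p 1 * p 2) := by
  obtain ⟨k, l, hk⟩ := one_three_three h.pd_one
  obtain ⟨l', hl⟩ := one_of_lt (n := 3) h.pd_two (by norm_num)
  refine ⟨k / 4, (l + 3 * l') / 4, ?_⟩
  filter_upwards [h.euler, hk, hl] with p h0 h1 h2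
  rw [h1, h2] at h0
  push_cast at h0
  linear_combination -h0 / 4

theorem one_three_five (h : IsQuasihomogeneous 1 3 5 f) :
    ∃ k l, ∀ᶠ p in 𝓝 0, f p = k * p 1 ^ 5 + l * (p 1 ^ 2 * p 2) := by
  obtain ⟨k, l, hk⟩ := one_three_four h.pd_one
  obtain ⟨l', hl⟩ := one_three_two h.pd_two
  refine ⟨k / 5, (l + 3 * l') / 5, ?_⟩
  filter_upwards [h.euler, hk, hl] with p h0 h1 h2
  rw [h1, h2] at h0
  push_cast at h0
  linear_combination -h0 / 5

theorem one_three_six (h : IsQuasihomogeneous 1 3 6 f) :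
    ∃ k l j, ∀ᶠ p in 𝓝 0, f p = k * p 1 ^ 6 + l * (p 1 ^ 3 * p 2) + j * p 2 ^ 2 := by
  obtain ⟨k, l, hk⟩ := one_three_five h.pd_one
  obtain ⟨l', j, hl⟩ := one_three_three h.pd_two
  refine ⟨k / 6, (l + 3 * l') / 6, 3 * j / 6, ?_⟩
  filter_upwards [h.euler, hk, hl] with p h0 h1 h2
  rw [h1, h2] at h0
  push_cast at h0
  linear_combination -h0 / 6

end OneThree

end IsQuasihomogeneous

/-- Points for comparing coefficients of polynomial identities that hold only near the origin. -/
theorem exists_sample {P : C3 → Prop} (h : ∀ᶠ p in 𝓝 0, P p) :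
    ∃ z : ℂ, z ≠ 0 ∧ P ![0, z, 0] ∧ P ![0, 0, z] ∧ P ![0, z, z] := by
  have hl (u : C3) : Tendsto (fun z : ℂ => z • u) (𝓝[≠] 0) (𝓝 0) := by
    have : Continuous fun z : ℂ => z • u := by fun_prop
    have h2 := this.tendsto 0
    rw [zero_smul] at h2
    exact h2.mono_left nhdsWithin_le_nhds
  obtain ⟨z, ⟨⟨hz1, hz2⟩, hz3⟩, hz⟩ := ((((hl ![0, 1, 0]).eventually h).and
    ((hl ![0, 0, 1]).eventually h)).and ((hl ![0, 1, 1]).eventually h)).and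
    self_mem_nhdsWithin |>.exists
  exact ⟨z, hz, by simpa using hz1, by simpa using hz2, by simpa using hz3⟩

theorem IsAdapted.not_eventually_zero {k : EllipticForm} {a b c : C3 → ℂ}
    (h : IsAdapted k a b c) : ¬∀ᶠ p in 𝓝 0, a p = 0 ∧ b p = 0 ∧ c p = 0 := by
  intro h0
  obtain ⟨z, hz, ⟨⟨h1, h2, h3⟩, h4⟩, -⟩ := exists_sample (h0.and h.isolated)
  exact hz (by simpa using (h4 (by simp [h1, h2]) (by simp [h1, h3])).1)

namespace IsPotential

variable {a b c : C3 → ℂ}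

theorem two_three (hp : IsPotential a b c) (ha : IsQuasihomogeneous 2 3 1 a) (hb : IsQuasihomogeneous 2 3 2 b)
    (hc : IsQuasihomogeneous 2 3 3 c) :
    ∃ k, ∀ᶠ p in 𝓝 0, a p = 0 ∧ b p = k * p 1 ∧ c p = k * p 2 := by
  have hA := ha.two_three_one
  obtain ⟨k, hB⟩ := hb.two_three_two
  obtain ⟨l, hC⟩ := hc.two_three_three
  have hx := hp.b_x.and ((pd_congr hB 1).and (pd_congr hC 2))
  obtain ⟨h1, h2, h3⟩ := hx.self_of_nhds
  rw [h2, h3] at h1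
  simp (disch := fun_prop) [pd_mul, pd_const, pd_coord] at h1
  refine ⟨k, ?_⟩
  filter_upwards [hA, hB, hC] with p h1' h2' h3'
  exact ⟨h1', h2', by rw [h3', h1]⟩

/-- Here `a_x = b_y` and `b_x = c_y` tie the coefficients together, and the associativity equation
kills the `x ^ 3` term of `c` and expresses the rest through `k`. -/
theorem one_two (hp : IsPotential a b c) (ha : IsQuasihomogeneous 1 2 1 a) (hb : IsQuasihomogeneous 1 2 2 b)
    (hc : IsQuasihomogeneous 1 2 3 c) :
    ∃ k, ∀ᶠ p in 𝓝 0, a p = k * p 1 ∧ b p = k ^ 2 * p 1 ^ 2 + k * p 2 ∧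
      c p = 2 * k ^ 2 * (p 1 * p 2) := by
  obtain ⟨k, hA⟩ := ha.one_of_lt (by norm_num)
  obtain ⟨l, l', hB⟩ := hb.one_two_two
  obtain ⟨j, j', hC⟩ := hc.one_two_three
  obtain ⟨z, hz, h1, h2, -⟩ := exists_sample ((hp.a_x.and (hp.b_x.and hp.c_x)).and
    (((hA.and hB).and (hC.and (pd_congr hA 1))).and ((((pd_congr hA 2).and (pd_congr hB 1)).and
    ((pd_congr hB 2).and (pd_congr hC 1))).and (pd_congr hC 2))))
  simp (disch := fun_prop) [pd_add, pd_mul, pd_const, pd_coord, pd_pow] at h1 h2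
  obtain ⟨⟨x1, x2, x3⟩, ⟨⟨a1, b1⟩, c1, a1'⟩, ⟨⟨a2', b1'⟩, b2', c1'⟩, c2'⟩ := h1
  obtain ⟨⟨y1, y2, y3⟩, ⟨⟨a3, b3⟩, c3, a3'⟩, ⟨⟨a4', b3'⟩, b4', c3'⟩, c4'⟩ := h2
  have e1 : l' = k := by rw [a1', b2'] at x1; exact x1.symm
  have e2 : j' = 2 * l := by
    rw [b1', c2'] at x2
    apply mul_right_cancel₀ hz; linear_combination -x2
  have e3 : j = 0 := by
    rw [c1', b1, b2', a2', a1, c2', c1] at x3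
    apply mul_right_cancel₀ (pow_ne_zero 2 hz)
    linear_combination x3 / 3 - e2 * k * z ^ 2 / 3 + 2 / 3 * l * z ^ 2 * e1
  have e4 : j' = 2 * k ^ 2 := by
    rw [c3', b3, b4', a4', a3, c4', c3] at y3
    apply mul_right_cancel₀ hz
    linear_combination y3 + 2 * z * (l' + k) * e1
  refine ⟨k, ?_⟩
  filter_upwards [hA, hB, hC] with p h1' h2' h3'
  refine ⟨h1', ?_, ?_⟩
  · rw [h2']; linear_combination p 2 * e1 + p 1 ^ 2 * (e4 - e2) / 2
  · rw [h3', e3, e4]; ring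

theorem one_three (hp : IsPotential a b c) (ha : IsQuasihomogeneous 1 3 2 a) (hb : IsQuasihomogeneous 1 3 4 b)
    (hc : IsQuasihomogeneous 1 3 6 c) :
    ∃ k, ∀ᶠ p in 𝓝 0, a p = k * p 1 ^ 2 ∧ b p = k ^ 2 / 2 * p 1 ^ 4 + 2 * k * (p 1 * p 2) ∧
      c p = 2 * k ^ 2 * (p 1 ^ 3 * p 2) + k * p 2 ^ 2 := by
  obtain ⟨k, hA⟩ := ha.one_three_two
  obtain ⟨l, l', hB⟩ := hb.one_three_four
  obtain ⟨j, j', j'', hC⟩ := hc.one_three_six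
  obtain ⟨z, hz, h1, h2, h3⟩ := exists_sample ((hp.a_x.and (hp.b_x.and hp.c_x)).and
    (((hA.and hB).and (hC.and (pd_congr hA 1))).and ((((pd_congr hA 2).and (pd_congr hB 1)).and
    ((pd_congr hB 2).and (pd_congr hC 1))).and (pd_congr hC 2))))
  simp (disch := fun_prop) [pd_add, pd_mul, pd_const, pd_coord, pd_pow] at h1 h2 h3
  obtain ⟨⟨x1, x2, x3⟩, ⟨⟨a1, b1⟩, c1, a1'⟩, ⟨⟨a2', b1'⟩, b2', c1'⟩, c2'⟩ := h1
  obtain ⟨⟨y1, y2, y3⟩, ⟨⟨a3, b3⟩, c3, a3'⟩, ⟨⟨a4', b3'⟩, b4', c3'⟩, c4'⟩ := h2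
  obtain ⟨⟨z1, z2, z3⟩, ⟨⟨a5, b5⟩, c5, a5'⟩, ⟨⟨a6', b5'⟩, b6', c5'⟩, c6'⟩ := h3
  have e1 : l' = 2 * k := by
    rw [a1', b2'] at x1
    apply mul_right_cancel₀ hz; linear_combination -x1
  have e2 : j' = 4 * l := by
    rw [b1', c2'] at x2
    apply mul_right_cancel₀ (pow_ne_zero 3 hz); linear_combination -x2
  have e3 : j'' = k := by
    rw [b3', c4'] at y2
    apply mul_right_cancel₀ hz; linear_combination (-y2 + e1 * z) / 2
  have e4 : j = 0 := by
    rw [c1', b1, b2', a2', a1, c2', c1] at x3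
    apply mul_right_cancel₀ (pow_ne_zero 5 hz)
    linear_combination x3 / 6 - k * z ^ 5 / 6 * e2 + 2 * l * z ^ 5 / 6 * e1
  -- The `x ^ 2 y` term of the associativity equation vanishes on both axes, which is why the
  -- diagonal point is needed.
  have e5 : j' = 2 * k ^ 2 := by
    rw [c5', b5, b6', a6', a5, c6', c5, e1, e2, e3, e4] at z3
    apply mul_right_cancel₀ (pow_ne_zero 3 hz)
    rw [e2]
    linear_combination z3 / 3
  refine ⟨k, ?_⟩
  filter_upwards [hA, hB, hC] with p h1' h2' h3'
  refine ⟨h1', ?_, ?_⟩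
  · rw [h2']; linear_combination p 1 * p 2 * e1 + p 1 ^ 4 * (e5 - e2) / 4
  · rw [h3', e3, e4, e5]; ring

end IsPotential

end

/-! ### Normalization by dilations and equivalence of germs -/

noncomputable section

/-- The linear map `(t, x, y) ↦ (t, μ² x, μ y)`. -/
def dilation (μ : ℂ) : C3 →L[ℂ] C3 := diagField 1 (μ ^ 2) μ

theorem dilation_apply (μ : ℂ) (p : C3) : dilation μ p = ![p 0, μ ^ 2 * p 1, μ * p 2] := by
  rw [dilation, diagField_apply, one_mul]

theorem flatForm_dilation (μ : ℂ) (u v : C3) :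
    flatForm (dilation μ u) (dilation μ v) = μ ^ 2 * flatForm u v := by
  simp [dilation_apply]; ring

theorem dilation_injective {μ : ℂ} (hμ : μ ≠ 0) : Function.Injective (dilation μ) := by
  refine (injective_iff_map_eq_zero _).2 fun u hu => ?_
  rw [dilation_apply] at hu
  have h0 := congrFun hu 0
  have h1 := congrFun hu 1
  have h2 := congrFun hu 2
  simp [hμ] at h0 h1 h2
  ext i; fin_cases i <;> simp [h0, h1, h2]

/-- The structure functions `a`, `b`, `c` have weights 1, 2, 3 under the dilation, so it rescales
the potential while keeping `∂_t` and the conformal class of the metric. -/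
theorem dilation_frobMul (μ a b c : ℂ) (u v : C3) :
    dilation μ (frobMul (μ * a) (μ ^ 2 * b) (μ ^ 3 * c) u v) =
      frobMul a b c (dilation μ u) (dilation μ v) := by
  ext i
  fin_cases i <;> simp [dilation_apply, frobMul_apply] <;> ring

theorem IsHomogeneous.isQuasihomogeneous {a b c : C3 → ℂ} {w₁ w₂ : ℂ}
    (hp : IsPotential a b c) (hh : IsHomogeneous a b c w₁ w₂ 0 0 0) {m n d : ℕ}
    {r : ℂ} (hr : r ≠ 0) (h1 : w₁ = r * m) (h2 : w₂ = r * n) (h3 : n = m + d) :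
    IsQuasihomogeneous m n d a ∧ IsQuasihomogeneous m n (2 * d : ℕ) b ∧
      IsQuasihomogeneous m n (3 * d : ℕ) c := by
  have h3' : (n : ℂ) = m + d := by exact_mod_cast h3
  refine ⟨⟨hp.analytic_a, hp.a_t, ?_⟩, ⟨hp.analytic_b, hp.b_t, ?_⟩, ⟨hp.analytic_c, hp.c_t, ?_⟩⟩
  · filter_upwards [hh.eq_a] with p h
    rw [h1, h2] at h
    apply mul_left_cancel₀ hr
    push_cast
    linear_combination h + r * a p * h3'
  · filter_upwards [hh.eq_b] with p h
    rw [h1, h2] at h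
    apply mul_left_cancel₀ hr
    push_cast
    linear_combination h + 2 * r * b p * h3'
  · filter_upwards [hh.eq_c] with p h
    rw [h1, h2] at h
    apply mul_left_cancel₀ hr
    push_cast
    linear_combination h + 3 * r * c p * h3'

/-- The coefficients in an adapted chart are those of the normal form, up to a dilation. -/
theorem IsAdapted.exists_dilation {k : EllipticForm} {a b c : C3 → ℂ} {w₁ w₂ s β₁ β₂ : ℂ}
    (ha : IsAdapted k a b c) (hp : IsPotential a b c)
    (hh : IsHomogeneous a b c w₁ w₂ s β₁ β₂) :
    ∃ μ : ℂ, μ ≠ 0 ∧ ∀ᶠ p in 𝓝 0, a p = μ * k.coeffA (dilation μ p) ∧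
      b p = μ ^ 2 * k.coeffB (dilation μ p) ∧ c p = μ ^ 3 * k.coeffC (dilation μ p) := by
  obtain ⟨hw, hr⟩ := hh.weights hp ha
  obtain ⟨rfl, rfl, rfl⟩ := hh.shift_eq_zero hp ha
  have hj := ha.jet
  have root (n : ℕ) (hn : 0 < n) (κ : ℂ) (hκ : κ ≠ 0) : ∃ μ : ℂ, μ ≠ 0 ∧ μ ^ n = κ := by
    obtain ⟨μ, hμ⟩ := IsAlgClosed.exists_pow_nat_eq κ hn
    refine ⟨μ, ?_, hμ⟩
    rintro rfl
    exact hκ (by rw [← hμ, zero_pow hn.ne'])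
  rcases hr with hr | hr | hr
  · obtain ⟨qa, qb, qc⟩ := hh.isQuasihomogeneous hp (m := 2) (n := 3) (d := 1) (r := w₁ / 2)
      (by simpa using hw) (by push_cast; ring) (by rw [hr]; push_cast; ring) rfl
    obtain ⟨κ, h⟩ := hp.two_three qa qb qc
    have hκ : κ ≠ 0 := by
      rintro rfl
      exact ha.not_eventually_zero (by simpa using h)
    -- For weights `(2, 3)` the derivative `c_y(0) = κ` is nonzero, which only form 2 allows.
    have hc := (pd_congr (h.mono fun p hp => hp.2.2) 2).self_of_nhds
    simp (disch := fun_prop) [pd_mul, pd_const, pd_coord] at hc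
    cases k
    -- Matching `κ x` with `-μ ^ 4 x` fixes `μ` up to a fourth root of unity, and any choice works.
    · obtain ⟨μ, hμ, hμκ⟩ := root 4 (by norm_num) (-κ) (by simpa using hκ)
      refine ⟨μ, hμ, h.mono fun p hp => ?_⟩
      simp only [EllipticForm.coeffA, EllipticForm.coeffB, EllipticForm.coeffC, dilation_apply,
        Matrix.cons_val, hp.1, hp.2.1, hp.2.2]
      exact ⟨by ring, by linear_combination p 1 * hμκ, by linear_combination p 2 * hμκ⟩
    · exact absurd (hc.symm.trans hj.1) hκ
    · exact absurd (hc.symm.trans hj.1) hκ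
  · obtain ⟨qa, qb, qc⟩ := hh.isQuasihomogeneous hp (m := 1) (n := 2) (d := 1) (r := w₁)
      hw (by push_cast; ring) (by rw [hr]; push_cast; ring) rfl
    obtain ⟨κ, h⟩ := hp.one_two qa qb qc
    have hκ : κ ≠ 0 := by
      rintro rfl
      exact ha.not_eventually_zero (by simpa using h)
    -- For weights `(1, 2)` one has `c_y(0) = 0` and `b_y(0) = κ ≠ 0`, which singles out form 3.
    have hb := (pd_congr (h.mono fun p hp => hp.2.1) 2).self_of_nhds
    have hc := (pd_congr (h.mono fun p hp => hp.2.2) 2).self_of_nhds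
    simp (disch := fun_prop) [pd_add, pd_mul, pd_pow, pd_const, pd_coord] at hb hc
    cases k
    · exact absurd hc hj
    · obtain ⟨μ, hμ, hμκ⟩ := root 3 (by norm_num) (-2 * κ) (by simpa using hκ)
      refine ⟨μ, hμ, h.mono fun p hp => ?_⟩
      simp only [EllipticForm.coeffA, EllipticForm.coeffB, EllipticForm.coeffC, dilation_apply,
        Matrix.cons_val, hp.1, hp.2.1, hp.2.2]
      have hk : κ = -(1 / 2) * μ ^ 3 := by linear_combination hμκ / 2
      rw [hk]
      exact ⟨by ring, by ring, by ring⟩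
    · exact absurd (hb.symm.trans hj.2) hκ
  · obtain ⟨qa, qb, qc⟩ := hh.isQuasihomogeneous hp (m := 1) (n := 3) (d := 2) (r := w₁)
      hw (by push_cast; ring) (by rw [hr]; push_cast; ring) rfl
    obtain ⟨κ, h⟩ := hp.one_three qa qb qc
    have hκ : κ ≠ 0 := by
      rintro rfl
      exact ha.not_eventually_zero (by simpa using h)
    -- For weights `(1, 3)` both derivatives vanish at the origin, which singles out form 4.
    have hb := (pd_congr (h.mono fun p hp => hp.2.1) 2).self_of_nhds
    have hc := (pd_congr (h.mono fun p hp => hp.2.2) 2).self_of_nhds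
    simp (disch := fun_prop) [pd_add, pd_mul, pd_pow, pd_const, pd_coord] at hb hc
    cases k
    · exact absurd (hc.trans (by simp)) hj
    · exact absurd hb hj.2
    · obtain ⟨μ, hμ, hμκ⟩ := root 5 (by norm_num) (-κ) (by simpa using hκ)
      refine ⟨μ, hμ, h.mono fun p hp => ?_⟩
      simp only [EllipticForm.coeffA, EllipticForm.coeffB, EllipticForm.coeffC, dilation_apply,
        Matrix.cons_val, hp.1, hp.2.1, hp.2.2]
      have hk : κ = -μ ^ 5 := by linear_combination hμκ
      rw [hk]
      exact ⟨by ring, by ring, by ring⟩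

namespace FrobeniusGerm

theorem equivalent_germ {F : FrobeniusGerm} (hN : F.NullUnit) {k : EllipticForm}
    (hk : F.IsBookletWeb k.web) : F.Equivalent k.germ := by
  obtain ⟨ψ, a, b, c, w₁, w₂, s, β₁, β₂, hψ, hp, hh, ha, hrel⟩ := exists_adapted_chart hN hk
  obtain ⟨μ, hμ, hnf⟩ := ha.exists_dilation hp hh
  have hlim := tendsto_nhds_zero hψ.analytic hψ.map_zero
  have hd : ∀ᶠ p in 𝓝 0, fderiv ℂ (fun q => dilation μ (ψ q)) p = (dilation μ).comp (fderiv ℂ ψ p) := by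
    filter_upwards [hψ.analytic.eventually_analyticAt] with p h
    have h' : HasFDerivAt (fun q => dilation μ (ψ q)) _ p :=
      (dilation μ).hasFDerivAt.comp p h.differentiableAt.hasFDerivAt
    exact h'.fderiv
  refine ⟨fun p => dilation μ (ψ p), μ, ((dilation μ).analyticAt _).comp hψ.analytic,
    by simp [hψ.map_zero], ?_, hμ, ?_, ?_⟩
  · have hi : Function.Injective (fderiv ℂ (fun p => dilation μ (ψ p)) 0) := by
      rw [hd.self_of_nhds]
      exact (dilation_injective hμ).comp hψ.injective.self_of_nhds
    exact ⟨hi, surjective_of_injective hi⟩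
  · filter_upwards [hd, hψ.metric] with p hd hm u v
    rw [hd, hm]
    exact flatForm_dilation μ _ _
  · filter_upwards [hd, hrel, hlim.eventually hnf] with p hd hr hn u v
    rw [hd, ContinuousLinearMap.comp_apply, hr, hn.1, hn.2.1, hn.2.2, dilation_frobMul]
    rfl

theorem Equivalent.symm {F G : FrobeniusGerm} (h : F.Equivalent G) : G.Equivalent F := by
  obtain ⟨φ, c, hφ, h0, hbij, hc, hm, hmul⟩ := h
  obtain ⟨χ, hχ, χ0, hl, hr⟩ := exists_analytic_localInverse hφ h0 hbij.1
  have hlim := tendsto_nhds_zero hχ χ0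
  have h1 := fderiv_comp_eq_id hφ h0 hχ hl
  have h2 := fderiv_comp_eq_id hχ χ0 hφ hr
  refine ⟨χ, c⁻¹, hχ, χ0, ?_, inv_ne_zero hc, ?_, ?_⟩
  · have e1 := h1.self_of_nhds
    have e2 := h2.self_of_nhds
    rw [h0] at e1
    rw [χ0] at e2
    exact ⟨Function.LeftInverse.injective e2, Function.RightInverse.surjective e1⟩
  · filter_upwards [h2, hr, hlim.eventually hm] with p h2 hr hm u v
    have := hm (fderiv ℂ χ p u) (fderiv ℂ χ p v)
    rw [h2, h2, hr] at this
    rw [this]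
    field_simp
  · filter_upwards [h2, hr, hlim.eventually hmul, hlim.eventually h1] with p h2 hr hm h1 u v
    have := hm (fderiv ℂ χ p u) (fderiv ℂ χ p v)
    rw [h2, h2, hr] at this
    rw [← this]
    rw [hr] at h1
    exact h1 _

theorem Equivalent.trans {F G H : FrobeniusGerm} (h : F.Equivalent G) (h' : G.Equivalent H) :
    F.Equivalent H := by
  obtain ⟨φ, c, hφ, φ0, hbij, hc, hm, hmul⟩ := h
  obtain ⟨χ, d, hχ, χ0, hbij', hd, hm', hmul'⟩ := h'
  have hlim := tendsto_nhds_zero hφ φ0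
  have hder : ∀ᶠ p in 𝓝 0, fderiv ℂ (χ ∘ φ) p = (fderiv ℂ χ (φ p)).comp (fderiv ℂ φ p) := by
    filter_upwards [hφ.eventually_analyticAt, hlim.eventually hχ.eventually_analyticAt]
      with p h1 h2
    exact (h2.differentiableAt.hasFDerivAt.comp p h1.differentiableAt.hasFDerivAt).fderiv
  refine ⟨χ ∘ φ, d * c, AnalyticAt.comp (by rwa [φ0]) hφ, by simp [φ0, χ0], ?_, mul_ne_zero hd hc,
    ?_, ?_⟩
  · rw [hder.self_of_nhds, φ0]
    exact hbij'.comp hbij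
  · filter_upwards [hder, hm, hlim.eventually hm'] with p e h1 h2 u v
    rw [e]
    simp only [Function.comp_apply, ContinuousLinearMap.comp_apply]
    rw [h2, h1]
    ring
  · filter_upwards [hder, hmul, hlim.eventually hmul'] with p e h1 h2 u v
    rw [e]
    simp only [Function.comp_apply, ContinuousLinearMap.comp_apply]
    rw [h1, h2]

end FrobeniusGerm

end

theorem mainTheorem7 (k : EllipticForm) :
    (∃ F : FrobeniusGerm, F.NullUnit ∧ F.IsBookletWeb k.web ∧
      (∀ᶠ p in 𝓝 0, F.unit p = ![1, 0, 0] ∧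
        ∀ u v, F.metric p u v = u 0 * v 1 + u 1 * v 0 + u 2 * v 2) ∧
      F.CutsWeb k.flatSurface k.web) ∧
    (∀ F G : FrobeniusGerm, F.NullUnit → F.IsBookletWeb k.web →
      G.NullUnit → G.IsBookletWeb k.web → F.Equivalent G) :=
  ⟨⟨k.germ, k.germ_realizes⟩, fun _ _ hF hFk hG hGk =>
    (FrobeniusGerm.equivalent_germ hF hFk).trans (FrobeniusGerm.equivalent_germ hG hGk).symm⟩
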